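/- All simplicial complexes are finite and contain the empty face $\emptyset$. For a field $\mathbb{k}$, a simplicial complex $\Delta$ is a *$\mathbb{k}$-homology $(d-1)$-sphere* if for every face $\sigma\in\Delta$ (including $\sigma=\emptyset$) the link $\mathrm{lk}_\sigma\Delta=\{\tau\in\Delta:\tau\cup\sigma\in\Delta,\ \tau\cap\sigma=\emptyset\}$ satisfies $\widetilde H_*(\mathrm{lk}_\sigma\Delta;\mathbb{k})\cong\widetilde H_*(S^{d-1-|\sigma|};\mathbb{k})$. Let $\Delta$ be a simplicial complex of dimension $d-1$ with vertices $1,\dots,m$. Its face ring over $\mathbb{k}$ is $\mathbb{k}[\Delta]=\mathbb{k}[x_1,\dots,x_m]/I_\Delta$, where $I_\Delta$ is generated by the monomials $\prod_{j\in s}x_j$ with $s\subseteq\{1,\dots,m\}$, $s\notin\Delta$. For a field $\mathbb{F}$, let $\mathbb{k}=\mathbb{F}(a_{ij}:1\le i\le d,\ 1\le j\le m)$ be the field of rational functions in independent variables $a_{ij}$, and let $\theta_i=\sum_{j=1}^m a_{ij}x_j$ for $1\le i\le d$. The complex $\Delta$ is *generically anisotropic over $\mathbb{F}$* if the graded ring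 $A=\mathbb{k}[\Delta]/(\theta_1,\dots,\theta_d)$ is finite-dimensional over $\mathbb{k}$ (which is always the case) and $u^2\neq 0$ for every nonzero $u\in A_i$ with $i\le d/2$. For a facet $\sigma\neq\emptyset$ of a pure simplicial complex $\Delta$ and a new vertex $v$ (that is, $\{v\}\notin\Delta$), the *bistellar $0$-move* at $\sigma$ replaces $\Delta$ by $$\Delta'=\{\tau\in\Delta:\tau\cup\sigma\notin\Delta\}\cup\{a\cup b: a\subsetneq\sigma,\ b\subseteq\{v\}\}.$$ A *stacked $(d-1)$-sphere* is a complex obtained from the boundary complex of a $d$-simplex by a finite (possibly empty) sequence of bistellar $0$-moves. A *simplicial $1$-sphere* is a simplicial complex whose geometric realization is homeomorphic to the circle. **Theorem.** Let $\mathbb{F}$ be any field. 1. Let $\Delta$ be an $\mathbb{F}$-homology $(d-1)$-sphere, and let $\Delta'$ be obtained from $\Delta$ by a bistellar $0$-move. Then $\Delta$ is generically anisotropic over $\mathbb{F}$ if and only if $\Delta'$ is generically anisotropic over $\mathbb{F}$. 2. Every stacked sphere is generically anisotropic over $\mathbb{F}$. 3. Every simplicial $1$-sphere is generically anisotropic over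 $\mathbb{F}$. -/

import Mathlib

noncomputable section

/-- A finite abstract simplicial complex with vertices in `V`. The empty set is always a face, so
that the smallest complex is `{∅}`, of dimension `-1`. Not every element of `V` has to be a
vertex. -/
@[ext]
structure FinSimplicialComplex (V : Type*) where
  faces : Finset (Finset V)
  empty_mem : ∅ ∈ faces
  down_closed : ∀ s ∈ faces, ∀ t ⊆ s, t ∈ faces

namespace FinSimplicialComplex

/-- The vertices of `Δ`. -/
abbrev Vert {V : Type*} (Δ : FinSimplicialComplex V) : Type _ :=
  {v : V // {v} ∈ Δ.faces}

instance finite_vert {V : Type*} (Δ : FinSimplicialComplex V) : Finite Δ.Vert :=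
  Finite.of_injective (fun v : Δ.Vert => (⟨{v.1}, v.2⟩ : {s // s ∈ Δ.faces}))
    (fun _ _ h => Subtype.ext (Finset.singleton_injective (congrArg Subtype.val h)))

instance fintype_vert {V : Type*} (Δ : FinSimplicialComplex V) : Fintype Δ.Vert :=
  Fintype.ofFinite _

/-- The largest cardinality of a face, i.e. `dim Δ + 1`. -/
def rank {V : Type*} (Δ : FinSimplicialComplex V) : ℕ :=
  Δ.faces.sup Finset.card

/-- `Δ` is pure: all facets (maximal faces) have the same dimension, `dim Δ`. -/
def IsPure {V : Type*} (Δ : FinSimplicialComplex V) : Prop :=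
  ∀ s ∈ Δ.faces, (∀ t ∈ Δ.faces, s ⊆ t → t = s) → s.card = Δ.rank

/-- The link `{τ ∈ Δ : τ ∪ σ ∈ Δ, τ ∩ σ = ∅}` of a face `σ`. -/
def link {V : Type*} [DecidableEq V] (Δ : FinSimplicialComplex V) (σ : Finset V)
    (hσ : σ ∈ Δ.faces) : FinSimplicialComplex V where
  faces := Δ.faces.filter (fun τ => τ ∪ σ ∈ Δ.faces ∧ Disjoint τ σ)
  empty_mem := by
    simp [Δ.empty_mem, hσ]
  down_closed := by
    intro s hs t hts
    simp only [Finset.mem_filter] at hs ⊢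
    exact ⟨Δ.down_closed s hs.1 t hts,
      Δ.down_closed _ hs.2.1 _ (Finset.union_subset_union_left hts),
      Finset.disjoint_of_subset_left hts hs.2.2⟩

/-- The boundary complex of the simplex with (nonempty) vertex set `s`: all proper subsets. -/
def simplexBoundary {V : Type*} [DecidableEq V] (s : Finset V) (hs : s.Nonempty) :
    FinSimplicialComplex V where
  faces := s.ssubsets
  empty_mem := by
    simpa [Finset.mem_ssubsets] using hs
  down_closed := by
    intro a ha b hba
    rw [Finset.mem_ssubsets] at ha ⊢
    exact lt_of_le_of_lt hba ha

/-! ### Reduced simplicial homology -/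

/-- The faces of dimension `n - 1`, i.e. with `n` vertices. -/
abbrev Face {V : Type*} (Δ : FinSimplicialComplex V) (n : ℕ) : Type _ :=
  {s : Finset V // s ∈ Δ.faces.filter (fun s => s.card = n)}

/-- Simplicial chains of dimension `n - 1`: formal combinations `∑ c s * s` of the faces with `n`
vertices, given by their coefficients (`Chain K 0` is spanned by the empty face). -/
abbrev Chain {V : Type*} (K : Type*) [Field K] (Δ : FinSimplicialComplex V) (n : ℕ) : Type _ :=
  Δ.Face n → K

/-- The face obtained from `s` by removing the vertex `v`. -/
def Face.erase {V : Type*} [DecidableEq V] {Δ : FinSimplicialComplex V} {n : ℕ}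
    (s : Δ.Face (n + 1)) (v : {v // v ∈ s.1}) : Δ.Face n :=
  ⟨s.1.erase v.1, Finset.mem_filter.mpr
    ⟨Δ.down_closed _ (Finset.mem_filter.mp s.2).1 _ (Finset.erase_subset _ _), by
      rw [Finset.card_erase_of_mem v.2, (Finset.mem_filter.mp s.2).2, Nat.add_sub_cancel]⟩⟩

/-- The augmented simplicial boundary map. A face is oriented by the order of its vertices; the
`j`-th vertex (counted from `0`) is removed with the sign `(-1) ^ j`. -/
def boundary {V : Type*} [LinearOrder V] (K : Type*) [Field K] (Δ : FinSimplicialComplex V)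
    (n : ℕ) : Δ.Chain K (n + 1) →ₗ[K] Δ.Chain K n :=
  Fintype.linearCombination K (fun s : Δ.Face (n + 1) =>
    ∑ v : {v // v ∈ s.1},
      (Pi.single (s.erase v) ((-1 : K) ^ (s.1.filter (fun w => w < v.1)).card) : Δ.Chain K n))

/-- Reduced cycles of dimension `n - 1`. -/
def cycles {V : Type*} [LinearOrder V] (K : Type*) [Field K] (Δ : FinSimplicialComplex V) :
    (n : ℕ) → Submodule K (Δ.Chain K n)
  | 0 => ⊤
  | n + 1 => LinearMap.ker (Δ.boundary K n)

/-- The reduced simplicial homology of `Δ` in dimension `n - 1`, with coefficients in `K`. -/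
abbrev ReducedHomology {V : Type*} [LinearOrder V] (K : Type*) [Field K]
    (Δ : FinSimplicialComplex V) (n : ℕ) : Type _ :=
  Δ.cycles K n ⧸ (LinearMap.range (Δ.boundary K n)).submoduleOf (Δ.cycles K n)

/-- `Δ` is a `K`-homology sphere of dimension `d - 1`: for every face `σ`, including `∅`, the link
of `σ` has the reduced homology over `K` of the sphere of dimension `d - 1 - |σ|`. (Dimension
`n - 1` equals `d - 1 - |σ|` exactly if `n + |σ| = d`.) -/
def IsHomologySphere {V : Type*} [LinearOrder V] (K : Type*) [Field K] (d : ℕ)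
    (Δ : FinSimplicialComplex V) : Prop :=
  ∀ (σ : Finset V) (hσ : σ ∈ Δ.faces) (n : ℕ),
    Module.finrank K ((Δ.link σ hσ).ReducedHomology K n) = if n + σ.card = d then 1 else 0

/-! ### Bistellar moves, stacked spheres, simplicial spheres -/

/-- `Δ'` is obtained from the pure complex `Δ` by a bistellar `i`-move: there are a nonempty face
`σ` of dimension `dim Δ - i` and an `i`-simplex `τ ∉ Δ` such that the link of `σ` is the boundary
of `τ`, and `Δ' = (Δ \ st σ) ∪ (∂σ * τ)`. -/
def IsBistellarMove {V : Type*} [DecidableEq V] (i : ℕ) (Δ Δ' : FinSimplicialComplex V) : Prop :=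
  Δ.IsPure ∧
  ∃ (σ τ : Finset V) (hσ : σ ∈ Δ.faces),
    σ.Nonempty ∧ σ.card + i = Δ.rank ∧ τ.card = i + 1 ∧ τ ∉ Δ.faces ∧
    (∀ s, s ∈ (Δ.link σ hσ).faces ↔ s ⊂ τ) ∧
    ∀ s, s ∈ Δ'.faces ↔
      (s ∈ Δ.faces ∧ s ∪ σ ∉ Δ.faces) ∨ ∃ a b : Finset V, a ⊂ σ ∧ b ⊆ τ ∧ s = a ∪ b

/-- Stacked spheres of dimension `d - 1`: the complexes obtained from the boundary of a
`d`-simplex by a finite sequence of bistellar `0`-moves. -/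
inductive IsStackedSphere {V : Type*} [DecidableEq V] (d : ℕ) : FinSimplicialComplex V → Prop
  | boundary (s : Finset V) (hs : s.Nonempty) (hd : s.card = d + 1) :
      IsStackedSphere d (simplexBoundary s hs)
  | move (Δ Δ' : FinSimplicialComplex V) (h : IsStackedSphere d Δ) (hm : IsBistellarMove 0 Δ Δ') :
      IsStackedSphere d Δ'

/-- The geometric realization of `Δ`, in barycentric coordinates. -/
def realization {V : Type*} (Δ : FinSimplicialComplex V) : Set (V → ℝ) :=
  {w | (∀ v, 0 ≤ w v) ∧ ∃ s ∈ Δ.faces, (∀ v, v ∉ s → w v = 0) ∧ ∑ v ∈ s, w v = 1}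

/-- `Δ` is a simplicial `n`-sphere: its realization is homeomorphic to the `n`-sphere. -/
def IsSimplicialSphere {V : Type*} (n : ℕ) (Δ : FinSimplicialComplex V) : Prop :=
  Nonempty (Δ.realization ≃ₜ Metric.sphere (0 : EuclideanSpace ℝ (Fin (n + 1))) 1)

/-! ### Face rings and generic anisotropy -/

/-- The Stanley-Reisner ideal: generated by the squarefree monomials of the non-faces. -/
def stanleyReisnerIdeal {V : Type*} (K : Type*) [Field K] (Δ : FinSimplicialComplex V) :
    Ideal (MvPolynomial Δ.Vert K) :=
  Ideal.span {p | ∃ s : Finset Δ.Vert,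
    s.map (Function.Embedding.subtype _) ∉ Δ.faces ∧ p = ∏ v ∈ s, MvPolynomial.X v}

/-- The face ring `K[Δ]`. -/
abbrev FaceRing {V : Type*} (K : Type*) [Field K] (Δ : FinSimplicialComplex V) : Type _ :=
  MvPolynomial Δ.Vert K ⧸ Δ.stanleyReisnerIdeal K

/-- The linear form `∑ j, a j * x j` in the face ring. -/
def linearForm {V : Type*} {K : Type*} [Field K] (Δ : FinSimplicialComplex V) (a : Δ.Vert → K) :
    Δ.FaceRing K :=
  Ideal.Quotient.mk (Δ.stanleyReisnerIdeal K)
    (∑ v, MvPolynomial.C (a v) * MvPolynomial.X v)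

/-- The quotient `K(Δ; Θ) = K[Δ] / (θ₁, …, θ_d)`, where `θ i = ∑ j, M i j * x j`. -/
abbrev Reduction {V : Type*} {K : Type*} [Field K] (Δ : FinSimplicialComplex V) {d : ℕ}
    (M : Matrix (Fin d) Δ.Vert K) : Type _ :=
  Δ.FaceRing K ⧸ Ideal.span (Set.range (fun i => Δ.linearForm (M i)))

/-- The component of degree `i` of `K(Δ; Θ)`: the classes of the homogeneous polynomials of
degree `i`. -/
def gradedPiece {V : Type*} {K : Type*} [Field K] (Δ : FinSimplicialComplex V) {d : ℕ}
    (M : Matrix (Fin d) Δ.Vert K) (i : ℕ) : Set (Δ.Reduction M) :=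
  {u | ∃ p : MvPolynomial Δ.Vert K, p.IsHomogeneous i ∧
    u = Ideal.Quotient.mk (Ideal.span (Set.range (fun i => Δ.linearForm (M i))))
      (Ideal.Quotient.mk (Δ.stanleyReisnerIdeal K) p)}

/-- The rows of `M` give a linear system of parameters of `K[Δ]`: there are `dim Δ + 1` of them, and
`K(Δ; Θ)` is finite-dimensional (i.e. it is an Artinian reduction of `K[Δ]`). -/
def IsLSOP {V : Type*} {K : Type*} [Field K] (Δ : FinSimplicialComplex V) {d : ℕ}
    (M : Matrix (Fin d) Δ.Vert K) : Prop :=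
  d = Δ.rank ∧ Module.Finite K (Δ.Reduction M)

/-- `K(Δ; Θ)` is an anisotropic Artinian reduction: the square of every nonzero homogeneous element
of degree `i ≤ d / 2` is nonzero. -/
def IsAnisotropic {V : Type*} {K : Type*} [Field K] (Δ : FinSimplicialComplex V) {d : ℕ}
    (M : Matrix (Fin d) Δ.Vert K) : Prop :=
  Δ.IsLSOP M ∧
    ∀ i : ℕ, 2 * i ≤ d → ∀ u ∈ Δ.gradedPiece M i, u ≠ 0 → u ^ 2 ≠ 0

/-- The field `F(a_{ij})` of rational functions in one variable for each `i = 1, …, d` and each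
vertex `j` of `Δ`. -/
abbrev GenericField {V : Type*} (F : Type*) [Field F] (Δ : FinSimplicialComplex V) (d : ℕ) :
    Type _ :=
  FractionRing (MvPolynomial (Fin d × Δ.Vert) F)

/-- The matrix `(a_{ij})` of variables. -/
def genericMatrix {V : Type*} (F : Type*) [Field F] (Δ : FinSimplicialComplex V) (d : ℕ) :
    Matrix (Fin d) Δ.Vert (GenericField F Δ d) :=
  fun i j => algebraMap (MvPolynomial (Fin d × Δ.Vert) F) (GenericField F Δ d)
    (MvPolynomial.X (i, j))

/-- `Δ` is generically anisotropic over `F`: with `d = dim Δ + 1`, the Artinian reduction of the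
face ring over `F(a_{ij})` by the linear forms `θ i = ∑ j, a_{ij} * x j` is anisotropic. -/
def GenericallyAnisotropic {V : Type*} (F : Type*) [Field F] (Δ : FinSimplicialComplex V) : Prop :=
  Δ.IsAnisotropic (Δ.genericMatrix F Δ.rank)

end FinSimplicialComplex

end

/-! Let `A` be the generic Artinian reduction of `Δ` over its field of rational functions `k`, and
let `Δ'` arise from `Δ` by subdividing a facet `σ` with a new vertex `v`. Over the larger field `K`
of `Δ'` the columns of `σ ∪ {v}` satisfy one linear relation `c`, normalised by `c v = 1`, and all
its coefficients on `σ` are nonzero. The reduction of `Δ'` is the connected sum of `A_K` and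
`K[t]/(t^(d+1))`, glued along the degree `d` classes of `x_σ` and `t^d`. Its two components are
obtained by setting `x_v = 0` and by restricting to the line through `c`. For an element of the
ideal of `Δ'` the components are `s x_σ` and `s (∏ c_w) t^d` with the same scalar `s`
(`IsFacetSubdivision.exists_of_mem`); if both components vanish, the element lies in the ideal
(`IsFacetSubdivision.mem_of_killVar_mem`).

Suppose a form of degree `i` has square zero for `Δ'`. If `2i < d`, both components have square
zero. If `2i = d`, the components `u` and `e t^i` satisfy `u² = s x_σ` and `e² = s ∏ c_w`. The `c_w`
with `w ∈ σ` can replace the new column as independent parameters, so `K` embeds into lexicographic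
Hahn series over `k` with every `c_w` going to a separate monomial
(`IsFacetSubdivision.exists_hahn_embedding`). Leading coefficients show that `A_K` inherits
anisotropy from `A`, and that `s` has order divisible by two if `s ≠ 0` and `x_σ ≠ 0` in `A`. But `∏
c_w` has order `(1, …, 1)`, so `s ∏ c_w` is then not a square. Hence `s = 0`, in every
characteristic. In the other direction, a form of positive degree on `Δ` lifts to a form on `Δ'`
whose line component is zero.

The fact `x_σ ≠ 0` is needed only for even `d`. For an anisotropic homology sphere, powers of a
nonzero variable survive up to degree `d`, so some facet monomial is nonzero; nonvanishing passes
between adjacent facets, and the sphere is strongly connected (`IsHomologySphere.facetsNeZero`). For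
stacked spheres, nonvanishing of all facet monomials is carried along the induction, which starts
from `K[t]/(t^(d+1))` for the boundary of a simplex. Finally, a simplicial circle is a cycle graph
by an argument on the line, and contracting vertices down to a triangle exhibits it as a stacked
sphere. -/

open MvPolynomial
noncomputable section
namespace FinSimplicialComplex

/-! ### Artinian reductions as quotients of the polynomial ring on all of `V` -/

/-- The set of vertices of `Δ`. -/
def verts {V : Type*} [DecidableEq V] (Δ : FinSimplicialComplex V) : Finset V :=
  Δ.faces.biUnion id

lemma mem_verts {V : Type*} [DecidableEq V] {Δ : FinSimplicialComplex V} {v : V} :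
    v ∈ Δ.verts ↔ {v} ∈ Δ.faces := by
  simp only [verts, Finset.mem_biUnion, id]
  constructor
  · rintro ⟨s, hs, hv⟩
    exact Δ.down_closed s hs _ (Finset.singleton_subset_iff.mpr hv)
  · exact fun h => ⟨_, h, Finset.mem_singleton_self v⟩

lemma subset_verts {V : Type*} [DecidableEq V] {Δ : FinSimplicialComplex V} {s : Finset V}
    (hs : s ∈ Δ.faces) : s ⊆ Δ.verts := fun _ hv =>
  mem_verts.mpr (Δ.down_closed s hs _ (Finset.singleton_subset_iff.mpr hv))

lemma card_le_rank {V : Type*} {Δ : FinSimplicialComplex V} {s : Finset V} (hs : s ∈ Δ.faces) :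
    s.card ≤ Δ.rank :=
  Finset.le_sup (f := Finset.card) hs

lemma exists_card_eq_rank {V : Type*} (Δ : FinSimplicialComplex V) :
    ∃ s ∈ Δ.faces, s.card = Δ.rank := by
  obtain ⟨s, hs, h⟩ := Finset.exists_mem_eq_sup Δ.faces ⟨∅, Δ.empty_mem⟩ Finset.card
  exact ⟨s, hs, h.symm⟩

/-- The ideal generated by the monomials of all non-faces (including single non-vertices) and by
the linear forms `∑ j ∈ U, M i j * x j`. -/
def redIdeal {V K : Type*} [Field K] (Δ : FinSimplicialComplex V) (U : Finset V) {d : ℕ}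
    (M : Fin d → V → K) : Ideal (MvPolynomial V K) :=
  Ideal.span ({p | ∃ s ∉ Δ.faces, p = ∏ v ∈ s, X v} ∪
    Set.range fun i => ∑ j ∈ U, C (M i j) * X j)

lemma prod_X_mem_redIdeal {V K : Type*} [Field K] {Δ : FinSimplicialComplex V} {U : Finset V}
    {d : ℕ} {M : Fin d → V → K} {s : Finset V} (hs : s ∉ Δ.faces) :
    (∏ v ∈ s, X v : MvPolynomial V K) ∈ Δ.redIdeal U M :=
  Ideal.subset_span (Or.inl ⟨s, hs, rfl⟩)

lemma form_mem_redIdeal {V K : Type*} [Field K] (Δ : FinSimplicialComplex V) (U : Finset V)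
    {d : ℕ} (M : Fin d → V → K) (i : Fin d) :
    (∑ j ∈ U, C (M i j) * X j : MvPolynomial V K) ∈ Δ.redIdeal U M :=
  Ideal.subset_span (Or.inr ⟨i, rfl⟩)

/-- Row operations stay in the ideal. Combined with `HasDualRows` this isolates a single variable of
a face. -/
lemma combination_mem_redIdeal {V K : Type*} [Field K] (Δ : FinSimplicialComplex V) (U : Finset V)
    {d : ℕ} (M : Fin d → V → K) (r : Fin d → K) :
    (∑ j ∈ U, C (∑ i, r i * M i j) * X j : MvPolynomial V K) ∈ Δ.redIdeal U M := by
  have h : (∑ j ∈ U, C (∑ i, r i * M i j) * X j : MvPolynomial V K)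
      = ∑ i, C (r i) * ∑ j ∈ U, C (M i j) * X j := by
    simp only [map_sum, map_mul, Finset.sum_mul, Finset.mul_sum]
    rw [Finset.sum_comm]
    simp only [mul_assoc]
  rw [h]
  exact Ideal.sum_mem _ fun i _ => Ideal.mul_mem_left _ _ (form_mem_redIdeal Δ U M i)

lemma redIdeal_le {V K : Type*} [Field K] {Δ : FinSimplicialComplex V} {U : Finset V} {d : ℕ}
    {M : Fin d → V → K} {I : Ideal (MvPolynomial V K)}
    (h1 : ∀ s ∉ Δ.faces, (∏ v ∈ s, X v : MvPolynomial V K) ∈ I)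
    (h2 : ∀ i, (∑ j ∈ U, C (M i j) * X j : MvPolynomial V K) ∈ I) : Δ.redIdeal U M ≤ I := by
  refine Ideal.span_le.mpr ?_
  rintro p (⟨s, hs, rfl⟩ | ⟨i, rfl⟩)
  exacts [h1 s hs, h2 i]

lemma redIdeal_map {V k K : Type*} [Field k] [Field K] (f : k →+* K) (Δ : FinSimplicialComplex V)
    (U : Finset V) {d : ℕ} (M : Fin d → V → k) :
    (Δ.redIdeal U M).map (map f) = Δ.redIdeal U (fun i j => f (M i j)) := by
  rw [redIdeal, Ideal.map_span, redIdeal, Set.image_union, ← Set.range_comp]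
  congr 2
  · ext p
    constructor
    · rintro ⟨_, ⟨s, hs, rfl⟩, rfl⟩
      exact ⟨s, hs, by simp⟩
    · rintro ⟨s, hs, rfl⟩
      exact ⟨_, ⟨s, hs, rfl⟩, by simp⟩
  · congr 1
    ext1 i
    simp

lemma redIdeal_congr {V K : Type*} [Field K] (Δ : FinSimplicialComplex V) (U : Finset V) {d : ℕ}
    {M N : Fin d → V → K} (h : ∀ i, ∀ j ∈ U, M i j = N i j) :
    Δ.redIdeal U M = Δ.redIdeal U N := by
  have h' : (fun i => ∑ j ∈ U, C (M i j) * X j : Fin d → MvPolynomial V K) =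
      fun i => ∑ j ∈ U, C (N i j) * X j :=
    funext fun i => Finset.sum_congr rfl fun j hj => by rw [h i j hj]
  rw [redIdeal, redIdeal, h']

lemma monomial_mem_redIdeal {V K : Type*} [Field K] {Δ : FinSimplicialComplex V} {U : Finset V}
    {d : ℕ} {M : Fin d → V → K} {n : V →₀ ℕ} (hn : n.support ∉ Δ.faces) (r : K) :
    monomial n r ∈ Δ.redIdeal U M := by
  refine Ideal.mem_of_dvd _ ?_ (prod_X_mem_redIdeal hn)
  rw [monomial_eq, Finsupp.prod]
  refine Dvd.dvd.mul_left (Finset.prod_dvd_prod_of_dvd _ _ fun i hi => ?_) _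
  exact dvd_pow_self _ (Finsupp.mem_support_iff.mp hi)

/-- The matrix `M` extended by zero to all of `V`. -/
def extMatrix {V K : Type*} [Field K] [DecidableEq V] (Δ : FinSimplicialComplex V) {d : ℕ}
    (M : Matrix (Fin d) Δ.Vert K) : Fin d → V → K :=
  fun i j => if h : {j} ∈ Δ.faces then M i ⟨j, h⟩ else 0

lemma extMatrix_apply_vert {V K : Type*} [Field K] [DecidableEq V] (Δ : FinSimplicialComplex V)
    {d : ℕ} (M : Matrix (Fin d) Δ.Vert K) (i : Fin d) (v : Δ.Vert) :
    Δ.extMatrix M i v.1 = M i v :=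
  dif_pos v.2

/-- The map that sets all non-vertices to zero. -/
def killNonvertices {V : Type*} [DecidableEq V] (K : Type*) [Field K]
    (Δ : FinSimplicialComplex V) : MvPolynomial V K →ₐ[K] MvPolynomial Δ.Vert K :=
  aeval fun v => if h : {v} ∈ Δ.faces then X ⟨v, h⟩ else 0

/-- The quotient map onto the Artinian reduction. -/
def toReduction {V K : Type*} [Field K] (Δ : FinSimplicialComplex V) {d : ℕ}
    (M : Matrix (Fin d) Δ.Vert K) : MvPolynomial Δ.Vert K →ₐ[K] Δ.Reduction M :=
  (Ideal.Quotient.mkₐ K (Ideal.span (Set.range fun i => Δ.linearForm (M i)))).comp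
    (Ideal.Quotient.mkₐ K (Δ.stanleyReisnerIdeal K))

lemma toReduction_surjective {V K : Type*} [Field K] (Δ : FinSimplicialComplex V) {d : ℕ}
    (M : Matrix (Fin d) Δ.Vert K) : Function.Surjective (Δ.toReduction M) :=
  (Ideal.Quotient.mkₐ_surjective K _).comp (Ideal.Quotient.mkₐ_surjective K _)

lemma killNonvertices_rename {V K : Type*} [DecidableEq V] [Field K]
    (Δ : FinSimplicialComplex V) (p : MvPolynomial Δ.Vert K) :
    Δ.killNonvertices K (rename Subtype.val p) = p := by
  rw [killNonvertices, aeval_rename]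
  have h : ((fun v => if h : {v} ∈ Δ.faces then X ⟨v, h⟩ else 0) ∘ Subtype.val :
      Δ.Vert → MvPolynomial Δ.Vert K) = X := by
    ext1 v
    simp [v.2]
  rw [h, aeval_X_left_apply]

lemma toReduction_eq_zero_iff_mem_sup {V K : Type*} [Field K]
    (Δ : FinSimplicialComplex V) {d : ℕ} (M : Matrix (Fin d) Δ.Vert K)
    (p : MvPolynomial Δ.Vert K) :
    Δ.toReduction M p = 0 ↔
      p ∈ Ideal.span (Set.range fun i => ∑ v, C (M i v) * X v) ⊔ Δ.stanleyReisnerIdeal K := by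
  have h : Ideal.span (Set.range fun i => Δ.linearForm (M i)) =
      (Ideal.span (Set.range fun i => ∑ v, C (M i v) * X v)).map
        (Ideal.Quotient.mk (Δ.stanleyReisnerIdeal K)) := by
    rw [Ideal.map_span, ← Set.range_comp]
    rfl
  rw [← Ideal.mem_quotient_iff_mem_sup, ← h]
  exact Ideal.Quotient.eq_zero_iff_mem

lemma sum_verts {V K : Type*} [DecidableEq V] [Field K] (Δ : FinSimplicialComplex V)
    {A : Type*} [AddCommMonoid A] (f : V → A) : ∑ j ∈ Δ.verts, f j = ∑ v : Δ.Vert, f v.1 :=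
  Finset.sum_subtype _ (fun _ => mem_verts) _

/-- Replaces the double quotient over the vertices by an ideal on all of `V`, so that complexes with
different vertex sets can be compared inside one polynomial ring. -/
lemma toReduction_eq_zero_iff {V K : Type*} [DecidableEq V] [Field K]
    (Δ : FinSimplicialComplex V) {d : ℕ} (M : Matrix (Fin d) Δ.Vert K)
    (p : MvPolynomial Δ.Vert K) :
    Δ.toReduction M p = 0 ↔
      rename Subtype.val p ∈ Δ.redIdeal Δ.verts (Δ.extMatrix M) := by
  rw [toReduction_eq_zero_iff_mem_sup]
  constructor
  · suffices h : Ideal.span (Set.range fun i => ∑ v, C (M i v) * X v) ⊔ Δ.stanleyReisnerIdeal K ≤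
        (Δ.redIdeal Δ.verts (Δ.extMatrix M)).comap (rename Subtype.val) from fun hp => h hp
    refine sup_le (Ideal.span_le.mpr ?_) (Ideal.span_le.mpr ?_)
    · rintro _ ⟨i, rfl⟩
      have h := form_mem_redIdeal Δ Δ.verts (Δ.extMatrix M) i
      rw [sum_verts (K := K)] at h
      simpa [extMatrix_apply_vert] using h
    · rintro _ ⟨s, hs, rfl⟩
      have h := prod_X_mem_redIdeal (K := K) (U := Δ.verts) (M := Δ.extMatrix M) hs
      rw [Finset.prod_map] at h
      simpa using h
  · intro hp
    rw [← killNonvertices_rename Δ p]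
    suffices h : Δ.redIdeal Δ.verts (Δ.extMatrix M) ≤
        (Ideal.span (Set.range fun i => ∑ v, C (M i v) * X v) ⊔ Δ.stanleyReisnerIdeal K).comap
        (Δ.killNonvertices K) from h hp
    refine redIdeal_le (fun s hs => ?_) (fun i => ?_)
    · rw [Ideal.mem_comap, map_prod]
      by_cases h : ∃ v ∈ s, {v} ∉ Δ.faces
      · obtain ⟨v, hv, hvΔ⟩ := h
        rw [Finset.prod_eq_zero hv]
        · exact zero_mem _
        · simp [killNonvertices, hvΔ]
      · push Not at h
        refine Ideal.mem_sup_right (Ideal.subset_span ⟨s.subtype _, ?_, ?_⟩)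
        · rwa [Finset.subtype_map_of_mem h]
        · conv_lhs => rw [← Finset.subtype_map_of_mem h]
          rw [Finset.prod_map]
          refine Finset.prod_congr rfl fun v _ => ?_
          simp [killNonvertices, v.2]
    · rw [Ideal.mem_comap, sum_verts (K := K), map_sum]
      refine Ideal.mem_sup_left (Ideal.subset_span ⟨i, ?_⟩)
      refine Finset.sum_congr rfl fun v _ => ?_
      simp [killNonvertices, extMatrix, v.2]

lemma sub_rename_killNonvertices_mem {V K : Type*} [DecidableEq V] [Field K]
    (Δ : FinSimplicialComplex V) (U : Finset V) {d : ℕ} (M : Fin d → V → K)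
    (p : MvPolynomial V K) :
    p - rename Subtype.val (Δ.killNonvertices K p) ∈ Δ.redIdeal U M := by
  rw [← Ideal.Quotient.eq]
  change (Ideal.Quotient.mkₐ K (Δ.redIdeal U M)) p = ((Ideal.Quotient.mkₐ K (Δ.redIdeal U M)).comp
    ((rename Subtype.val).comp (Δ.killNonvertices K))) p
  congr 1
  refine algHom_ext fun v => ?_
  by_cases h : {v} ∈ Δ.faces
  · simp [killNonvertices, h]
  · have h' : (X v : MvPolynomial V K) ∈ Δ.redIdeal U M := by
      simpa using prod_X_mem_redIdeal (K := K) (U := U) (M := M) h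
    simpa [killNonvertices, h] using Ideal.Quotient.eq_zero_iff_mem.mpr h'

lemma toReduction_killNonvertices_eq_zero_iff {V K : Type*} [DecidableEq V] [Field K]
    (Δ : FinSimplicialComplex V) {d : ℕ} (M : Matrix (Fin d) Δ.Vert K) (p : MvPolynomial V K) :
    Δ.toReduction M (Δ.killNonvertices K p) = 0 ↔ p ∈ Δ.redIdeal Δ.verts (Δ.extMatrix M) := by
  rw [toReduction_eq_zero_iff]
  have h := sub_rename_killNonvertices_mem Δ Δ.verts (Δ.extMatrix M) p
  exact ⟨fun hp => by simpa using add_mem h hp, fun hp => by simpa using sub_mem hp h⟩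

lemma killNonvertices_isHomogeneous {V K : Type*} [DecidableEq V] [Field K]
    (Δ : FinSimplicialComplex V) {p : MvPolynomial V K} {i : ℕ} (hp : p.IsHomogeneous i) :
    (Δ.killNonvertices K p).IsHomogeneous i := by
  rw [← one_mul i]
  refine hp.aeval _ fun v => ?_
  split_ifs
  · exact isHomogeneous_X _ _
  · exact isHomogeneous_zero _ _ _

/-- Anisotropy in degrees `≤ d / 2` of the quotient by the ideal `I`. -/
def IsAnisotropicIdeal {V K : Type*} [Field K] (I : Ideal (MvPolynomial V K)) (d : ℕ) : Prop :=
  ∀ i : ℕ, 2 * i ≤ d → ∀ p : MvPolynomial V K, p.IsHomogeneous i → p ^ 2 ∈ I → p ∈ I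

lemma isAnisotropic_iff {V K : Type*} [DecidableEq V] [Field K] (Δ : FinSimplicialComplex V)
    {d : ℕ} {M : Matrix (Fin d) Δ.Vert K} (hM : Δ.IsLSOP M) :
    Δ.IsAnisotropic M ↔ IsAnisotropicIdeal (Δ.redIdeal Δ.verts (Δ.extMatrix M)) d := by
  constructor
  · intro h i hi p hp hp2
    by_contra hpn
    rw [← toReduction_killNonvertices_eq_zero_iff] at hpn hp2
    refine h.2 i hi _ ⟨_, Δ.killNonvertices_isHomogeneous hp, rfl⟩ hpn ?_
    rw [map_pow, map_pow] at hp2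
    exact hp2
  · refine fun h => ⟨hM, ?_⟩
    rintro i hi _ ⟨p, hp, rfl⟩ hu hu2
    refine hu ((toReduction_eq_zero_iff Δ M p).mpr (h i hi _ hp.rename_isHomogeneous ?_))
    rw [← map_pow, ← toReduction_eq_zero_iff, map_pow]
    exact hu2

/-! ### Generic matrices -/

/-- For each `j ∈ τ` some combination of the rows of `M` restricts to the indicator of `j` on
`τ`, i.e. the columns of `M` indexed by `τ` are linearly independent. -/
def HasDualRows {V K : Type*} [DecidableEq V] [Field K] {d : ℕ} (M : Fin d → V → K)
    (τ : Finset V) : Prop :=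
  ∀ j ∈ τ, ∃ r : Fin d → K, ∀ l ∈ τ, ∑ i, r i * M i l = if l = j then 1 else 0

/-- The generic matrix, extended by zero to all of `V`. -/
def genMatrix {V : Type*} [DecidableEq V] (F : Type*) [Field F] (Δ : FinSimplicialComplex V)
    (d : ℕ) : Fin d → V → GenericField F Δ d :=
  Δ.extMatrix (Δ.genericMatrix F d)

/-- An injection of `τ` into the rows picks out a square submatrix of distinct variables. Its
determinant is nonzero, and the rows of its inverse, padded by zeros, are the dual rows. -/
lemma hasDualRows_genMatrix {V : Type*} [DecidableEq V] (F : Type*) [Field F]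
    (Δ : FinSimplicialComplex V) {d : ℕ} {τ : Finset V} (hτ : τ ⊆ Δ.verts) (hc : τ.card ≤ d) :
    HasDualRows (Δ.genMatrix F d) τ := by
  intro j hj
  obtain ⟨e⟩ : Nonempty ({x // x ∈ τ} ↪ Fin d) := by
    rw [Function.Embedding.nonempty_iff_card_le]
    simpa using hc
  have hv : ∀ x : {x // x ∈ τ}, {x.1} ∈ Δ.faces := fun x => mem_verts.mp (hτ x.2)
  let ψ : MvPolynomial ({x // x ∈ τ} × {x // x ∈ τ}) F →+* GenericField F Δ d :=
    (algebraMap (MvPolynomial (Fin d × Δ.Vert) F) (GenericField F Δ d)).comp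
      (rename (R := F) fun x : {x // x ∈ τ} × {x // x ∈ τ} =>
        (e x.1, (⟨x.2.1, hv x.2⟩ : Δ.Vert))).toRingHom
  have hψ : Function.Injective ψ := by
    refine (IsFractionRing.injective (MvPolynomial (Fin d × Δ.Vert) F)
      (GenericField F Δ d)).comp (rename_injective (R := F) _ ?_)
    rintro ⟨a, b⟩ ⟨a', b'⟩ h
    simp only [Prod.mk.injEq, EmbeddingLike.apply_eq_iff_eq, Subtype.mk.injEq] at h
    exact Prod.ext h.1 (Subtype.ext h.2)
  let B : Matrix {x // x ∈ τ} {x // x ∈ τ} (GenericField F Δ d) :=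
    ψ.mapMatrix (Matrix.mvPolynomialX _ _ F)
  have hB : ∀ x y, B x y = Δ.genMatrix F d (e x) y.1 := by
    intro x y
    simp [B, ψ, genMatrix, extMatrix, genericMatrix, hv y]
  have hdet : IsUnit B.det := by
    rw [isUnit_iff_ne_zero, ← RingHom.map_det]
    exact fun h => Matrix.det_mvPolynomialX_ne_zero _ F
      ((injective_iff_map_eq_zero ψ).mp hψ _ h)
  have hinv := Matrix.nonsing_inv_mul B hdet
  refine ⟨fun i => ∑ x, if e x = i then B⁻¹ ⟨j, hj⟩ x else 0, fun l hl => ?_⟩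
  have h := congrFun (congrFun hinv ⟨j, hj⟩) ⟨l, hl⟩
  rw [Matrix.mul_apply, Matrix.one_apply] at h
  simp only [hB, Subtype.mk.injEq] at h
  simp only [Finset.sum_mul, ite_mul, zero_mul]
  rw [Finset.sum_comm]
  simpa [eq_comm] using h

/-! ### Squarefree monomials span -/

/-- A repeated variable can be traded: the dual row of `i` on the support expresses `X i` through
variables outside the support, so every new term has one more vertex in its support. A support
larger than the rank is a non-face. -/
lemma monomial_mem_span {V K : Type*} [DecidableEq V] [Field K] (Δ : FinSimplicialComplex V)
    {U : Finset V} {d : ℕ} {M : Fin d → V → K} (hU : Δ.verts ⊆ U)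
    (hM : ∀ τ ∈ Δ.faces, HasDualRows M τ) (n : V →₀ ℕ) :
    (monomial n 1 : MvPolynomial V K) ∈ (Δ.redIdeal U M).restrictScalars K ⊔
      Submodule.span K {p | ∃ τ ∈ Δ.faces, τ.card = n.degree ∧ p = ∏ v ∈ τ, X v} := by
  -- `m` bounds how much further the support has to grow before it exceeds the rank.
  suffices h : ∀ (m e : ℕ) (n : V →₀ ℕ), n.degree = e → Δ.rank < n.support.card + m →
      (monomial n 1 : MvPolynomial V K) ∈ (Δ.redIdeal U M).restrictScalars K ⊔
      Submodule.span K {p | ∃ τ ∈ Δ.faces, τ.card = e ∧ p = ∏ v ∈ τ, X v} from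
    h (Δ.rank + 1) _ n rfl (by omega)
  intro m e
  induction m with
  | zero =>
    intro n _ hn
    refine Submodule.mem_sup_left (monomial_mem_redIdeal (fun h => ?_) 1)
    have := card_le_rank h
    omega
  | succ m ih =>
    intro n he hn
    by_cases hface : n.support ∈ Δ.faces
    swap
    · exact Submodule.mem_sup_left (monomial_mem_redIdeal hface 1)
    by_cases h2 : ∃ i ∈ n.support, 2 ≤ n i
    · obtain ⟨i, hi, hi2⟩ := h2
      obtain ⟨r, hr⟩ := hM _ hface i hi
      obtain ⟨n', rfl⟩ : ∃ n', n = n' + Finsupp.single i 1 :=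
        ⟨n - Finsupp.single i 1, (tsub_add_cancel_of_le (by
          rw [Finsupp.single_le_iff]; omega)).symm⟩
      have hsupp : (n' + Finsupp.single i 1).support = n'.support := by
        ext j
        by_cases hj : j = i
        · subst hj
          simp at hi2 ⊢
          omega
        · simp [Ne.symm hj]
      rw [hsupp] at hi hface hn hr
      have hiU : i ∈ U := hU (subset_verts hface hi)
      have key : (monomial (n' + Finsupp.single i 1) 1 : MvPolynomial V K) =
          monomial n' 1 * ∑ j ∈ U, C (∑ i, r i * M i j) * X j -
          ∑ j ∈ U.erase i, (∑ i, r i * M i j) • monomial (n' + Finsupp.single j 1) 1 := by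
        rw [← Finset.add_sum_erase U _ hiU, hr i hi, if_pos rfl, mul_add, Finset.mul_sum,
          C_1, one_mul, X, monomial_mul, one_mul, add_sub_assoc]
        rw [left_eq_add, sub_eq_zero]
        refine Finset.sum_congr rfl fun j _ => ?_
        rw [C_mul', X, mul_smul_comm, monomial_mul, one_mul]
      rw [key]
      refine sub_mem (Submodule.mem_sup_left
        (Ideal.mul_mem_left _ _ (combination_mem_redIdeal Δ U M r)))
        (Submodule.sum_mem _ fun j hj => ?_)
      by_cases hjn : j ∈ n'.support
      · rw [hr j hjn, if_neg (Finset.ne_of_mem_erase hj), zero_smul]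
        exact zero_mem _
      · refine Submodule.smul_mem _ _ (ih _ ?_ ?_)
        · rw [← he]
          simp
        · have : (n' + Finsupp.single j 1).support = insert j n'.support := by
            ext l
            by_cases hl : l = j
            · subst hl
              simp
            · simp [hl, eq_comm]
          rw [this, Finset.card_insert_of_notMem hjn]
          omega
    · push Not at h2
      have h1 : ∀ i ∈ n.support, n i = 1 := fun i hi => by
        have := h2 i hi
        have := Finsupp.mem_support_iff.mp hi
        omega
      refine Submodule.mem_sup_right (Submodule.subset_span ⟨n.support, hface, ?_, ?_⟩)
      · rw [← he, Finsupp.degree_apply, Finset.card_eq_sum_ones]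
        exact (Finset.sum_congr rfl h1).symm
      · rw [monomial_eq, Finsupp.prod, C_1, one_mul]
        exact Finset.prod_congr rfl fun i hi => by rw [h1 i hi, pow_one]

/-! ### Finiteness of the generic reduction and the ideal form of generic anisotropy -/

lemma finite_reduction {V K : Type*} [DecidableEq V] [Field K] (Δ : FinSimplicialComplex V)
    {d : ℕ} (M : Matrix (Fin d) Δ.Vert K)
    (hM : ∀ τ ∈ Δ.faces, HasDualRows (Δ.extMatrix M) τ) : Module.Finite K (Δ.Reduction M) := by
  let f : MvPolynomial V K →ₗ[K] Δ.Reduction M :=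
    ((Δ.toReduction M).comp (Δ.killNonvertices K)).toLinearMap
  have hf : Function.Surjective f := fun u => by
    obtain ⟨p, rfl⟩ := Δ.toReduction_surjective M u
    exact ⟨rename Subtype.val p, congrArg (Δ.toReduction M) (killNonvertices_rename Δ p)⟩
  let W : Submodule K (MvPolynomial V K) :=
    Submodule.span K ((fun τ : Finset V => ∏ v ∈ τ, X v) '' (Δ.faces : Set (Finset V)))
  have htop : (Δ.redIdeal Δ.verts (Δ.extMatrix M)).restrictScalars K ⊔ W = ⊤ := by
    rw [eq_top_iff]
    rintro p -
    rw [p.as_sum]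
    refine Submodule.sum_mem _ fun n _ => ?_
    rw [show monomial n (coeff n p) = coeff n p • monomial n (1 : K) by
      rw [smul_monomial, smul_eq_mul, mul_one]]
    refine Submodule.smul_mem _ _ ((sup_le_sup_left (Submodule.span_mono ?_) _ :
      _ ≤ (Δ.redIdeal Δ.verts (Δ.extMatrix M)).restrictScalars K ⊔ W)
      (monomial_mem_span Δ le_rfl hM n))
    rintro _ ⟨τ, hτ, -, rfl⟩
    exact ⟨τ, hτ, rfl⟩
  have hW : W.map f = ⊤ := by
    have h0 : ((Δ.redIdeal Δ.verts (Δ.extMatrix M)).restrictScalars K).map f = ⊥ := by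
      rw [eq_bot_iff]
      rintro _ ⟨p, hp, rfl⟩
      exact (toReduction_killNonvertices_eq_zero_iff Δ M p).mpr hp
    have := congrArg (Submodule.map f) htop
    rwa [Submodule.map_sup, h0, bot_sup_eq, Submodule.map_top, LinearMap.range_eq_top.mpr hf]
      at this
  refine ⟨?_⟩
  rw [← hW]
  exact Submodule.FG.map f (Submodule.fg_span (Δ.faces.finite_toSet.image _))

lemma isLSOP_genericMatrix {V : Type*} [DecidableEq V] (F : Type*) [Field F]
    (Δ : FinSimplicialComplex V) : Δ.IsLSOP (Δ.genericMatrix F Δ.rank) :=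
  ⟨rfl, finite_reduction Δ _ fun _ hτ =>
    hasDualRows_genMatrix F Δ (subset_verts hτ) (card_le_rank hτ)⟩

/-- The defining ideal of the generic Artinian reduction. -/
def genIdeal {V : Type*} [DecidableEq V] (F : Type*) [Field F] (Δ : FinSimplicialComplex V)
    (d : ℕ) : Ideal (MvPolynomial V (GenericField F Δ d)) :=
  Δ.redIdeal Δ.verts (Δ.genMatrix F d)

lemma genericallyAnisotropic_iff {V : Type*} [DecidableEq V] (F : Type*) [Field F]
    (Δ : FinSimplicialComplex V) {d : ℕ} (hd : Δ.rank = d) :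
    Δ.GenericallyAnisotropic F ↔ IsAnisotropicIdeal (Δ.genIdeal F d) d := by
  subst hd
  exact isAnisotropic_iff Δ (isLSOP_genericMatrix F Δ)

lemma mem_of_sq_mem_of_isHomogeneous_zero {V K : Type*} [Field K] {I : Ideal (MvPolynomial V K)}
    {p : MvPolynomial V K} (hp : p.IsHomogeneous 0) (h : p ^ 2 ∈ I) : p ∈ I := by
  obtain ⟨c, rfl⟩ : ∃ c, p = C c :=
    ⟨_, totalDegree_eq_zero_iff_eq_C.mp ((totalDegree_zero_iff_isHomogeneous (p := p)).mpr hp)⟩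
  by_cases hc : c = 0
  · simp [hc]
  · have := I.mul_mem_left (C c⁻¹) h
    rwa [pow_two, ← mul_assoc, ← C_mul, inv_mul_cancel₀ hc, C_1, one_mul] at this

/-- Only degree zero is tested. This settles the ranks in which a bistellar `0`-move can delete a
vertex and so is not a facet subdivision in the sense used below. -/
lemma genericallyAnisotropic_of_rank_le_one {V : Type*} [DecidableEq V] (F : Type*) [Field F]
    (Δ : FinSimplicialComplex V) (hd : Δ.rank ≤ 1) : Δ.GenericallyAnisotropic F := by
  rw [genericallyAnisotropic_iff F Δ rfl]
  intro i hi p hp h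
  obtain rfl : i = 0 := by omega
  exact mem_of_sq_mem_of_isHomogeneous_zero hp h

end FinSimplicialComplex
end

noncomputable section
namespace FinSimplicialComplex

/-! ### Extension of scalars to Hahn series -/

/-- The ring homomorphism of Hahn series that applies `f` to all coefficients. -/
def hahnMap {Γ R S : Type*} [AddCommGroup Γ] [LinearOrder Γ] [IsOrderedAddMonoid Γ] [CommRing R]
    [CommRing S] (f : R →+* S) : HahnSeries Γ R →+* HahnSeries Γ S where
  toFun x := x.map f
  map_one' := HahnSeries.map_one f.toMonoidWithZeroHom
  map_zero' := by ext; simp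
  map_add' x y := by ext; simp
  map_mul' x y := by
    have h : ∀ z : HahnSeries Γ R, (z.map f).support ⊆ z.support := fun z γ hγ hz =>
      hγ (by simp [hz])
    ext γ
    rw [HahnSeries.map_coeff, HahnSeries.coeff_mul, map_sum, HahnSeries.coeff_mul]
    -- `f` may kill coefficients, so the index pairs for the images form a subset of those for `x`
    -- and `y`; the missing pairs contribute zero.
    refine (Finset.sum_subset_zero_on_sdiff (fun ij hij => ?_) (fun ij hij => ?_)
      fun ij _ => ?_).symm
    · simp only [Finset.mem_antidiagonal] at hij ⊢
      exact ⟨h x hij.1, h y hij.2.1, hij.2.2⟩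
    · simp only [Finset.mem_sdiff, Finset.mem_antidiagonal, HahnSeries.mem_support,
        HahnSeries.map_coeff] at hij
      rw [map_mul]
      by_contra h0
      exact hij.2 ⟨left_ne_zero_of_mul h0, right_ne_zero_of_mul h0, hij.1.2.2⟩
    · simp

lemma coeff_hahnMap {Γ R S : Type*} [AddCommGroup Γ] [LinearOrder Γ] [IsOrderedAddMonoid Γ]
    [CommRing R] [CommRing S] (f : R →+* S) (x : HahnSeries Γ R) (γ : Γ) :
    (hahnMap f x).coeff γ = f (x.coeff γ) := rfl

lemma hahnMap_C {Γ R S : Type*} [AddCommGroup Γ] [LinearOrder Γ] [IsOrderedAddMonoid Γ]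
    [CommRing R] [CommRing S] (f : R →+* S) (r : R) :
    hahnMap f (HahnSeries.C r : HahnSeries Γ R) = HahnSeries.C (f r) := by
  ext γ
  rw [coeff_hahnMap, HahnSeries.C_apply, HahnSeries.C_apply, HahnSeries.coeff_single,
    HahnSeries.coeff_single]
  split_ifs <;> simp

/-- Extension of scalars `K[V] → A⟦Γ⟧` of an algebra `k[V] → A` along an embedding `K → k⟦Γ⟧`. -/
def scalarExt {Γ V k K A : Type*} [AddCommGroup Γ] [LinearOrder Γ] [IsOrderedAddMonoid Γ] [Field k]
    [Field K] [CommRing A] [Algebra k A] (g : K →+* HahnSeries Γ k) (π : MvPolynomial V k →ₐ[k] A) :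
    MvPolynomial V K →+* HahnSeries Γ A :=
  eval₂Hom ((hahnMap (algebraMap k A)).comp g) fun v => HahnSeries.C (π (X v))

section

variable {Γ V k K A : Type*} [AddCommGroup Γ] [LinearOrder Γ] [IsOrderedAddMonoid Γ] [Field k]
  [Field K] [CommRing A] [Algebra k A] (g : K →+* HahnSeries Γ k) (π : MvPolynomial V k →ₐ[k] A)
  {inc : k →+* K}

lemma scalarExt_C (s : K) : scalarExt g π (C s) = hahnMap (algebraMap k A) (g s) := by
  simp [scalarExt]

lemma scalarExt_map (hg : ∀ a, g (inc a) = HahnSeries.C a) (p : MvPolynomial V k) :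
    scalarExt g π (map inc p) = HahnSeries.C (π p) := by
  have h : (scalarExt g π).comp (map inc) = (HahnSeries.C (Γ := Γ)).comp (π : _ →+* A) := by
    refine ringHom_ext (fun a => ?_) fun v => ?_
    · rw [RingHom.comp_apply, map_C, scalarExt_C, hg, hahnMap_C]
      simp
    · simp [scalarExt]
  exact congrArg (fun f => f p) h

lemma coeff_scalarExt (p : MvPolynomial V K) (γ : Γ) :
    (scalarExt g π p).coeff γ =
      π (∑ n ∈ p.support, monomial n ((g (coeff n p)).coeff γ)) := by
  conv_lhs => rw [p.as_sum, map_sum, HahnSeries.coeff_sum]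
  rw [map_sum]
  refine Finset.sum_congr rfl fun n _ => ?_
  have h : (monomial n (coeff n p) : MvPolynomial V K) = C (coeff n p) * monomial n 1 := by
    rw [C_mul_monomial, mul_one]
  have h' : scalarExt g π (monomial n (1 : K)) = HahnSeries.C (π (monomial n 1)) := by
    rw [monomial_eq, monomial_eq, C_1, C_1, one_mul, one_mul, Finsupp.prod, Finsupp.prod,
      map_prod, map_prod, map_prod]
    simp only [map_pow]
    simp [scalarExt]
  rw [h, map_mul, h', scalarExt_C, HahnSeries.C_apply, HahnSeries.coeff_mul_single_zero,
    coeff_hahnMap, ← Algebra.smul_def, ← map_smul, smul_monomial, smul_eq_mul, mul_one]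

/-- Makes the hypothesis of anisotropy over `k` applicable to leading coefficients. -/
lemma exists_isHomogeneous_coeff_scalarExt {p : MvPolynomial V K} {i : ℕ}
    (hp : p.IsHomogeneous i) (γ : Γ) : ∃ q : MvPolynomial V k, q.IsHomogeneous i ∧
      (scalarExt g π p).coeff γ = π q := by
  refine ⟨∑ n ∈ p.support, monomial n ((g (coeff n p)).coeff γ), ?_, coeff_scalarExt g π p γ⟩
  refine IsHomogeneous.sum _ _ _ fun n hn => isHomogeneous_monomial _ ?_
  by_contra h
  exact (mem_support_iff.mp hn) (hp.coeff_eq_zero h)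

/-- This is injectivity of `K ⊗ A → A⟦Γ⟧`: a `k`-basis of `A` remains independent over `K`, as one
sees by comparing Hahn coefficients one exponent at a time. -/
lemma scalarExt_eq_zero_iff (hg : ∀ a, g (inc a) = HahnSeries.C a) {I : Ideal (MvPolynomial V k)}
    (hπ : Function.Surjective π) (hI : ∀ q, π q = 0 ↔ q ∈ I) (p : MvPolynomial V K) :
    scalarExt g π p = 0 ↔ p ∈ I.map (map inc) := by
  have hle : I.map (map inc) ≤ RingHom.ker (scalarExt g π) := by
    refine Ideal.map_le_iff_le_comap.mpr fun q hq => ?_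
    rw [Ideal.mem_comap, RingHom.mem_ker, scalarExt_map g π hg, (hI q).mpr hq, map_zero]
  refine ⟨fun hp => ?_, fun hp => hle hp⟩
  let b := Module.Basis.ofVectorSpace k A
  choose q hq using fun i => hπ (b i)
  -- Lifts `q i` of a `k`-basis of `A` span the extended quotient over `K`.
  have htop : (I.map (map inc)).restrictScalars K ⊔
      Submodule.span K (Set.range fun i => map inc (q i)) = ⊤ := by
    rw [eq_top_iff]
    rintro p -
    rw [p.as_sum]
    refine Submodule.sum_mem _ fun n _ => ?_
    have h1 : (monomial n (coeff n p) : MvPolynomial V K) =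
        coeff n p • map inc (monomial n 1) := by
      rw [map_monomial, map_one, smul_monomial, smul_eq_mul, mul_one]
    rw [h1]
    refine Submodule.smul_mem _ _ ?_
    set m : MvPolynomial V k := monomial n 1
    let c := b.repr (π m)
    have h2 : m - ∑ i ∈ c.support, c i • q i ∈ I := by
      rw [← hI, map_sub, sub_eq_zero, map_sum]
      conv_lhs => rw [← b.linearCombination_repr (π m)]
      rw [Finsupp.linearCombination_apply, Finsupp.sum]
      refine Finset.sum_congr rfl fun i _ => ?_
      rw [map_smul, hq]
    rw [← sub_add_cancel m (∑ i ∈ c.support, c i • q i), map_add]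
    refine Submodule.add_mem_sup (Ideal.mem_map_of_mem _ h2) ?_
    rw [map_sum]
    refine Submodule.sum_mem _ fun i _ => ?_
    rw [smul_eq_C_mul, map_mul, map_C, C_mul']
    exact Submodule.smul_mem _ _ (Submodule.subset_span ⟨i, rfl⟩)
  obtain ⟨y, hy, z, hz, rfl⟩ := Submodule.mem_sup.mp (htop ▸ Submodule.mem_top : p ∈ _)
  obtain ⟨c, rfl⟩ := (Finsupp.mem_span_range_iff_exists_finsupp).mp hz
  rw [map_add, show scalarExt g π y = 0 from hle hy, zero_add] at hp
  suffices h : c = 0 by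
    rw [h, Finsupp.sum_zero_index, add_zero]
    exact hy
  ext i
  -- For each exponent `γ` the coefficients at `γ` give a `k`-linear relation between basis vectors
  -- of `A`.
  refine (map_eq_zero g).mp (HahnSeries.ext (funext fun γ => ?_))
  have h := congrArg (fun x => HahnSeries.coeff x γ) hp
  simp only [Finsupp.sum, map_sum, HahnSeries.coeff_sum, smul_eq_C_mul, map_mul, scalarExt_C,
    scalarExt_map g π hg, hq, HahnSeries.C_apply, HahnSeries.coeff_mul_single_zero,
    coeff_hahnMap, HahnSeries.coeff_zero, ← Algebra.smul_def] at h
  by_cases hi : i ∈ c.support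
  · exact linearIndependent_iff'.mp b.linearIndependent _ _ h i hi
  · simp [Finsupp.notMem_support_iff.mp hi]

/-- Extension of the field creates no new relations: polynomials over `k` go to constant Hahn
series, and constants embed. -/
lemma mem_of_map_mem_map (hg : ∀ a, g (inc a) = HahnSeries.C a) {I : Ideal (MvPolynomial V k)}
    {p : MvPolynomial V k} (hp : map inc p ∈ I.map (map inc)) : p ∈ I := by
  have hI : ∀ q, Ideal.Quotient.mkₐ k I q = 0 ↔ q ∈ I := fun q => Ideal.Quotient.eq_zero_iff_mem
  rw [← scalarExt_eq_zero_iff g _ hg (Ideal.Quotient.mkₐ_surjective k I) hI,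
    scalarExt_map g _ hg] at hp
  exact (hI p).mp (HahnSeries.C_injective (hp.trans (map_zero _).symm))

/-- Anisotropy is preserved under extension of scalars. -/
theorem mem_map_of_sq_mem (hg : ∀ a, g (inc a) = HahnSeries.C a) {I : Ideal (MvPolynomial V k)}
    {d i : ℕ} (hani : IsAnisotropicIdeal I d) (hi : 2 * i ≤ d) {p : MvPolynomial V K}
    (hp : p.IsHomogeneous i) (h : p ^ 2 ∈ I.map (map inc)) : p ∈ I.map (map inc) := by
  have hI : ∀ q, Ideal.Quotient.mkₐ k I q = 0 ↔ q ∈ I := fun q => Ideal.Quotient.eq_zero_iff_mem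
  have hπ := Ideal.Quotient.mkₐ_surjective k I
  generalize Ideal.Quotient.mkₐ k I = π at hI hπ
  rw [← scalarExt_eq_zero_iff g π hg hπ hI] at h ⊢
  by_contra h0
  obtain ⟨q, hq, hqc⟩ := exists_isHomogeneous_coeff_scalarExt g π hp (scalarExt g π p).order
  have hne : π q ≠ 0 := by
    rw [← hqc]
    exact mt HahnSeries.coeff_order_eq_zero.mp h0
  -- The square of the leading coefficient is the coefficient of the square at twice the order,
  -- hence zero; anisotropy then kills the leading coefficient.
  have hco := HahnSeries.coeff_mul_order_add_order (scalarExt g π p) (scalarExt g π p)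
  rw [HahnSeries.leadingCoeff_eq, hqc, ← pow_two, ← pow_two, ← map_pow, ← map_pow, h] at hco
  exact hne ((hI q).mpr (hani i hi q hq ((hI _).mp hco.symm)))

/-- Compare orders in `p² = s q`. By anisotropy the leading coefficient of `p` has nonzero square,
so the left side has order twice that of `p`. The right side has the order of `g s`, because `q` is
a nonzero constant series. -/
lemma exists_order_eq_add_self_of_ker (hg : ∀ a, g (inc a) = HahnSeries.C a)
    {I : Ideal (MvPolynomial V k)} (hπ : Function.Surjective π) (hI : ∀ q, π q = 0 ↔ q ∈ I) {d i : ℕ}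
    (hani : IsAnisotropicIdeal I d) (hi : 2 * i ≤ d) {p : MvPolynomial V K}
    (hp : p.IsHomogeneous i) {q : MvPolynomial V k} (hq : q ∉ I) {s : K} (hs : s ≠ 0)
    (h : p ^ 2 - C s * map inc q ∈ I.map (map inc)) : ∃ γ, (g s).order = γ + γ := by
  rw [← scalarExt_eq_zero_iff g π hg hπ hI, map_sub, sub_eq_zero, map_mul, scalarExt_C,
    scalarExt_map g π hg, map_pow] at h
  have hq0 : π q ≠ 0 := mt (hI q).mp hq
  have hs0 : g s ≠ 0 := (map_ne_zero g).mpr hs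
  have hco : ∀ γ, ((scalarExt g π p) ^ 2).coeff γ = (g s).coeff γ • π q := fun γ => by
    rw [h, HahnSeries.C_apply, HahnSeries.coeff_mul_single_zero, coeff_hahnMap, Algebra.smul_def]
  have hp0 : scalarExt g π p ≠ 0 := fun h0 => by
    have := hco (g s).order
    rw [h0, pow_two, mul_zero, HahnSeries.coeff_zero, eq_comm, smul_eq_zero] at this
    exact this.elim (mt HahnSeries.coeff_order_eq_zero.mp hs0) hq0
  obtain ⟨q', hq', hqc⟩ := exists_isHomogeneous_coeff_scalarExt g π hp (scalarExt g π p).order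
  have hne : π q' ≠ 0 := by
    rw [← hqc]
    exact mt HahnSeries.coeff_order_eq_zero.mp hp0
  have hl : (scalarExt g π p).leadingCoeff * (scalarExt g π p).leadingCoeff ≠ 0 := by
    rw [HahnSeries.leadingCoeff_eq, hqc, ← pow_two, ← map_pow]
    exact fun h0 => hne ((hI q').mpr (hani i hi q' hq' ((hI _).mp h0)))
  have ho : ((scalarExt g π p) ^ 2).order = (scalarExt g π p).order + (scalarExt g π p).order := by
    rw [pow_two, HahnSeries.order_mul_of_ne_zero hl]
  refine ⟨(scalarExt g π p).order, ?_⟩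
  rw [← ho]
  refine le_antisymm (HahnSeries.order_le_of_coeff_ne_zero fun h0 => ?_)
    (HahnSeries.order_le_of_coeff_ne_zero fun h0 => ?_)
  · have h1 := hco ((scalarExt g π p) ^ 2).order
    rw [h0, zero_smul, ho, pow_two, HahnSeries.coeff_mul_order_add_order] at h1
    exact hl h1
  · rw [hco, smul_eq_zero] at h0
    exact h0.elim (mt HahnSeries.coeff_order_eq_zero.mp hs0) hq0

/-- If `p² = s q` modulo an anisotropic ideal, with `q ≠ 0` defined over the ground field, then `s`
has even order. -/
theorem exists_order_eq_add_self (hg : ∀ a, g (inc a) = HahnSeries.C a)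
    {I : Ideal (MvPolynomial V k)} {d i : ℕ} (hani : IsAnisotropicIdeal I d) (hi : 2 * i ≤ d)
    {p : MvPolynomial V K} (hp : p.IsHomogeneous i) {q : MvPolynomial V k} (hq : q ∉ I) {s : K}
    (hs : s ≠ 0) (h : p ^ 2 - C s * map inc q ∈ I.map (map inc)) :
    ∃ γ, (g s).order = γ + γ := by
  have hI : ∀ q, Ideal.Quotient.mkₐ k I q = 0 ↔ q ∈ I := fun q => Ideal.Quotient.eq_zero_iff_mem
  exact exists_order_eq_add_self_of_ker g _ hg (Ideal.Quotient.mkₐ_surjective k I) hI hani hi hp hq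
    hs h

end

/-- The embedding of a polynomial ring into Hahn series with lexicographically ordered
exponents. -/
def polyToHahn (ι k : Type*) [LinearOrder ι] [Fintype ι] [Field k] :
    MvPolynomial ι k →ₐ[k] HahnSeries (Lex (ι → ℤ)) k :=
  aeval fun j => HahnSeries.single (toLex (Pi.single j 1)) 1

lemma polyToHahn_monomial {ι k : Type*} [LinearOrder ι] [Fintype ι] [Field k] (n : ι →₀ ℕ)
    (r : k) : polyToHahn ι k (monomial n r) =
      HahnSeries.single (toLex fun j => (n j : ℤ)) r := by
  induction n using Finsupp.induction_linear generalizing r with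
  | zero =>
    rw [← C_apply, polyToHahn, aeval_C]
    rfl
  | add m n hm hn =>
    rw [← mul_one r, ← monomial_mul, map_mul, hm, hn, HahnSeries.single_mul_single]
    congr 1
  | single j e =>
    rw [polyToHahn, aeval_monomial, Finsupp.prod_single_index (by simp), HahnSeries.single_pow,
      one_pow, HahnSeries.algebraMap_apply, HahnSeries.C_apply, HahnSeries.single_mul_single]
    have h : e • toLex (Pi.single j (1 : ℤ)) =
        toLex fun l => ((Finsupp.single j e : ι →₀ ℕ) l : ℤ) := by
      change toLex (e • (Pi.single j 1 : ι → ℤ)) = _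
      congr 1
      ext l
      by_cases hl : l = j
      · subst hl
        simp
      · simp [hl]
    rw [zero_add, h, mul_one]
    rfl

lemma coeff_polyToHahn {ι k : Type*} [LinearOrder ι] [Fintype ι] [Field k] (p : MvPolynomial ι k)
    (n : ι →₀ ℕ) : (polyToHahn ι k p).coeff (toLex fun j => (n j : ℤ)) = coeff n p := by
  induction p using MvPolynomial.induction_on' with
  | monomial m r =>
    rw [polyToHahn_monomial, HahnSeries.coeff_single, coeff_monomial]
    have h : ((toLex fun j => (n j : ℤ)) = toLex fun j => (m j : ℤ)) ↔ m = n := by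
      simp [funext_iff, Finsupp.ext_iff, eq_comm]
    simp only [h]
  | add p q hp hq => rw [map_add, HahnSeries.coeff_add, hp, hq, coeff_add]

lemma polyToHahn_injective (ι k : Type*) [LinearOrder ι] [Fintype ι] [Field k] :
    Function.Injective (polyToHahn ι k) :=
  (injective_iff_map_eq_zero _).mpr fun p hp => by
    ext n
    rw [← coeff_polyToHahn, hp]
    rfl

end FinSimplicialComplex
end

noncomputable section
namespace FinSimplicialComplex

/-! ### Stellar subdivision of a facet -/

/-- `Δ'` is the stellar subdivision of `Δ` at the facet `σ` with new vertex `v`. -/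
structure IsFacetSubdivision {V : Type*} [DecidableEq V] (Δ Δ' : FinSimplicialComplex V)
    (σ : Finset V) (v : V) : Prop where
  mem : σ ∈ Δ.faces
  facet : ∀ s ∈ Δ.faces, σ ⊆ s → s = σ
  notMem : {v} ∉ Δ.faces
  two_le : 2 ≤ σ.card
  mem_iff : ∀ s, v ∉ s → (s ∈ Δ'.faces ↔ s ∈ Δ.faces ∧ s ≠ σ)
  insert_mem_iff : ∀ s, v ∉ s → (insert v s ∈ Δ'.faces ↔ s ⊂ σ)

/-- The homomorphism to `K[t]` that restricts polynomials to the line through `c`. -/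
def lineMap {V K : Type*} [Field K] (c : V → K) : MvPolynomial V K →ₐ[K] Polynomial K :=
  aeval fun w => Polynomial.C (c w) * Polynomial.X

lemma lineMap_X {V K : Type*} [Field K] (c : V → K) (w : V) :
    lineMap c (X w) = Polynomial.C (c w) * Polynomial.X := by
  simp [lineMap]

lemma lineMap_C {V K : Type*} [Field K] (c : V → K) (a : K) :
    lineMap c (C a) = Polynomial.C a := by
  simp [lineMap]

lemma lineMap_prod_X {V K : Type*} [Field K] (c : V → K) (s : Finset V) :
    lineMap c (∏ w ∈ s, X w) = Polynomial.C (∏ w ∈ s, c w) * Polynomial.X ^ s.card := by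
  simp [lineMap_X, Finset.prod_mul_distrib]

lemma lineMap_form {V K : Type*} [Field K] (c : V → K) (U : Finset V) (m : V → K) :
    lineMap c (∑ j ∈ U, C (m j) * X j) = Polynomial.C (∑ j ∈ U, m j * c j) * Polynomial.X := by
  rw [map_sum, map_sum, Finset.sum_mul]
  refine Finset.sum_congr rfl fun j _ => ?_
  rw [map_mul, lineMap_X, lineMap_C, map_mul, mul_assoc]

lemma lineMap_of_isHomogeneous {V K : Type*} [Field K] (c : V → K) {p : MvPolynomial V K} {i : ℕ}
    (hp : p.IsHomogeneous i) : lineMap c p = Polynomial.C (eval c p) * Polynomial.X ^ i := by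
  rw [p.as_sum, map_sum, map_sum, map_sum, Finset.sum_mul]
  refine Finset.sum_congr rfl fun n hn => ?_
  have hdeg : n.degree = i := by
    by_contra h
    exact mem_support_iff.mp hn (hp.coeff_eq_zero h)
  rw [lineMap, aeval_monomial, eval_monomial, ← hdeg, Finsupp.degree_apply, map_mul,
    Finsupp.prod, Finsupp.prod, map_prod, ← Finset.prod_pow_eq_pow_sum, mul_assoc,
    ← Finset.prod_mul_distrib]
  simp [mul_pow]

lemma X_dvd_lineMap_sub {V K : Type*} [Field K] (c : V → K) (p : MvPolynomial V K) :
    Polynomial.X ∣ lineMap c p - Polynomial.C (constantCoeff p) := by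
  induction p using MvPolynomial.induction_on with
  | C a => simp
  | add p q hp hq =>
    have := dvd_add hp hq
    rwa [sub_add_sub_comm, ← map_add, ← map_add, ← map_add] at this
  | mul_X p w hp =>
    simp only [map_mul, lineMap_X, constantCoeff_X, mul_zero, map_zero, sub_zero]
    exact Dvd.intro_left _ (by rw [mul_assoc])

/-- The map that sets the variable `v` to zero. -/
def killVar {V : Type*} [DecidableEq V] (K : Type*) [Field K] (v : V) :
    MvPolynomial V K →ₐ[K] MvPolynomial V K :=
  aeval fun w => if w = v then 0 else X w

lemma killVar_X_self {V : Type*} [DecidableEq V] (K : Type*) [Field K] (v : V) :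
    killVar K v (X v) = 0 := by
  simp [killVar]

lemma killVar_X_of_ne {V : Type*} [DecidableEq V] (K : Type*) [Field K] {v w : V} (h : w ≠ v) :
    killVar K v (X w) = X w := by
  simp [killVar, h]

lemma killVar_prod_X {V : Type*} [DecidableEq V] (K : Type*) [Field K] {v : V} {s : Finset V}
    (h : v ∉ s) : killVar K v (∏ w ∈ s, X w) = ∏ w ∈ s, X w := by
  rw [map_prod]
  exact Finset.prod_congr rfl fun w hw => killVar_X_of_ne K fun h' => h (h' ▸ hw)

lemma killVar_prod_X_of_mem {V : Type*} [DecidableEq V] (K : Type*) [Field K] {v : V}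
    {s : Finset V} (h : v ∈ s) : killVar K v (∏ w ∈ s, X w) = 0 := by
  rw [map_prod]
  exact Finset.prod_eq_zero h (killVar_X_self K v)

lemma killVar_isHomogeneous {V K : Type*} [DecidableEq V] [Field K] (v : V)
    {p : MvPolynomial V K} {i : ℕ} (hp : p.IsHomogeneous i) :
    (killVar K v p).IsHomogeneous i := by
  rw [← one_mul i]
  refine hp.aeval _ fun w => ?_
  split_ifs
  · exact isHomogeneous_zero _ _ _
  · exact isHomogeneous_X _ _

lemma X_dvd_sub_killVar {V K : Type*} [DecidableEq V] [Field K] (v : V) (p : MvPolynomial V K) :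
    X v ∣ p - killVar K v p := by
  induction p using MvPolynomial.induction_on with
  | C a => simp [killVar]
  | add p q hp hq =>
    have := dvd_add hp hq
    rwa [sub_add_sub_comm, ← map_add] at this
  | mul_X p w hp =>
    by_cases h : w = v
    · subst h
      rw [map_mul, killVar_X_self, mul_zero, sub_zero]
      exact Dvd.intro_left _ rfl
    · rw [map_mul, killVar_X_of_ne K h, ← sub_mul]
      exact hp.mul_right _

/-- The linear relation between the columns of `M` in `σ` and the column of `v`. -/
structure IsColumnRelation {V K : Type*} [DecidableEq V] [Field K] {d : ℕ} (M : Fin d → V → K)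
    (U σ : Finset V) (v : V) (c : V → K) : Prop where
  apply_self : c v = 1
  apply_of_notMem : ∀ w ∉ σ, w ≠ v → c w = 0
  apply_ne_zero : ∀ w ∈ σ, c w ≠ 0
  sum_eq_zero : ∀ i, ∑ j ∈ insert v U, M i j * c j = 0

/-- The facet monomial lies in the socle. For `w ∉ σ` the product is a non-face; for `w ∈ σ` the
dual row of `w` expresses `X w` through variables outside `σ`. -/
lemma X_mul_prod_X_mem {V K : Type*} [DecidableEq V] [Field K] {Δ : FinSimplicialComplex V}
    {U : Finset V} {d : ℕ} {M : Fin d → V → K} {σ : Finset V} (hσU : σ ⊆ U)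
    (hσ : ∀ s ∈ Δ.faces, σ ⊆ s → s = σ) (hM : HasDualRows M σ) (w : V) :
    (X w * ∏ j ∈ σ, X j : MvPolynomial V K) ∈ Δ.redIdeal U M := by
  have h1 : ∀ w ∉ σ, (X w * ∏ j ∈ σ, X j : MvPolynomial V K) ∈ Δ.redIdeal U M := by
    intro w hw
    rw [← Finset.prod_insert hw]
    refine prod_X_mem_redIdeal fun h => hw ?_
    rw [← hσ _ h (Finset.subset_insert _ _)]
    exact Finset.mem_insert_self _ _
  by_cases hw : w ∈ σ
  swap
  · exact h1 w hw
  obtain ⟨r, hr⟩ := hM w hw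
  have h2 := Ideal.mul_mem_right (∏ j ∈ σ, X j) _ (combination_mem_redIdeal Δ U M r)
  rw [← Finset.add_sum_erase U _ (hσU hw), hr w hw, if_pos rfl, C_1, one_mul, add_mul] at h2
  refine (Ideal.add_mem_iff_left _ ?_).mp h2
  rw [Finset.sum_mul]
  refine Ideal.sum_mem _ fun j hj => ?_
  by_cases hjσ : j ∈ σ
  · rw [hr j hjσ, if_neg (Finset.ne_of_mem_erase hj), C_0, zero_mul, zero_mul]
    exact zero_mem _
  · rw [mul_assoc]
    exact Ideal.mul_mem_left _ _ (h1 j hjσ)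

section

variable {V K : Type*} [DecidableEq V] [Field K] {Δ Δ' : FinSimplicialComplex V}
  {σ U : Finset V} {v : V} {d : ℕ} {M : Fin d → V → K} {c : V → K}

lemma prod_eq_zero_of_not_subset (hc : IsColumnRelation M U σ v c) {s : Finset V} (hv : v ∉ s)
    (hs : ¬ s ⊆ σ) : ∏ w ∈ s, c w = 0 := by
  obtain ⟨w, hw, hwσ⟩ := Finset.not_subset.mp hs
  exact Finset.prod_eq_zero hw (hc.apply_of_notMem w hwσ fun h => hv (h ▸ hw))

/-- It suffices to follow the generators: both `x_σ` and `t^d` are annihilated by everything of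
positive degree, so multiplication by a polynomial only scales `s` by its constant term. -/
theorem IsFacetSubdivision.exists_of_mem (h : IsFacetSubdivision Δ Δ' σ v) (hd : σ.card = d)
    (hσU : σ ⊆ U) (hvU : v ∉ U) (hM : HasDualRows M σ) (hc : IsColumnRelation M U σ v c)
    {p : MvPolynomial V K} (hp : p ∈ Δ'.redIdeal (insert v U) M) :
    ∃ s : K, killVar K v p - C s * ∏ w ∈ σ, X w ∈ Δ.redIdeal U M ∧
      Polynomial.X ^ (d + 1) ∣
        lineMap c p - Polynomial.C (s * ∏ w ∈ σ, c w) * Polynomial.X ^ d := by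
  have hvσ : v ∉ σ := fun hv => hvU (hσU hv)
  induction hp using Submodule.span_induction with
  | mem p hp =>
    obtain ⟨s, hs, rfl⟩ | ⟨i, rfl⟩ := hp
    · by_cases hv : v ∈ s
      · refine ⟨0, ?_, ?_⟩
        · simp [killVar_prod_X_of_mem K hv]
        · rw [zero_mul, map_zero, zero_mul, sub_zero, lineMap_prod_X]
          -- The only non-face of `Δ'` that contains `v` and lies in `σ ∪ {v}` is `σ ∪ {v}` itself,
          -- of degree `d + 1`. All others contain a vertex where `c` vanishes.
          by_cases hsub : s.erase v ⊆ σ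
          · have heq : s.erase v = σ := by
              by_contra hne
              refine hs ?_
              rw [← Finset.insert_erase hv, h.insert_mem_iff _ (Finset.notMem_erase v s)]
              exact lt_of_le_of_ne hsub hne
            rw [← Finset.card_erase_add_one hv, heq, hd]
            exact Dvd.intro_left _ rfl
          · rw [← Finset.mul_prod_erase s _ hv,
              prod_eq_zero_of_not_subset hc (Finset.notMem_erase v s) hsub]
            simp
      · by_cases hsσ : s = σ
        · subst hsσ
          -- The lost facet `σ` is the only generator with `s ≠ 0`.
          refine ⟨1, ?_, ?_⟩
          · simp [killVar_prod_X K hv]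
          · rw [lineMap_prod_X, hd]
            simp
        · have hsΔ : s ∉ Δ.faces := fun hsΔ => hs ((h.mem_iff s hv).mpr ⟨hsΔ, hsσ⟩)
          refine ⟨0, ?_, ?_⟩
          · simpa [killVar_prod_X K hv] using prod_X_mem_redIdeal hsΔ
          · rw [lineMap_prod_X, prod_eq_zero_of_not_subset hc hv
              fun hsub => hsΔ (Δ.down_closed _ h.mem _ hsub)]
            simp
    · refine ⟨0, ?_, ?_⟩
      · beta_reduce
        rw [C_0, zero_mul, sub_zero, Finset.sum_insert hvU, map_add, map_mul, killVar_X_self,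
          mul_zero, zero_add]
        convert form_mem_redIdeal Δ U M i using 1
        rw [map_sum]
        refine Finset.sum_congr rfl fun j hj => ?_
        rw [map_mul, killVar_X_of_ne K (v := v) (w := j) fun hjv => hvU (hjv ▸ hj)]
        simp [killVar]
      · rw [lineMap_form, hc.sum_eq_zero]
        simp
  | zero => exact ⟨0, by simp, by simp⟩
  | add p q _ _ hp hq =>
    obtain ⟨s, hs1, hs2⟩ := hp
    obtain ⟨t, ht1, ht2⟩ := hq
    refine ⟨s + t, ?_, ?_⟩
    · convert add_mem hs1 ht1 using 1
      rw [map_add, map_add]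
      ring
    · convert dvd_add hs2 ht2 using 1
      rw [map_add, add_mul, map_add]
      ring
  | smul a p _ hp =>
    obtain ⟨s, hs1, hs2⟩ := hp
    refine ⟨constantCoeff a * s, ?_, ?_⟩
    · have h1 : (killVar K v a - C (constantCoeff a)) * ∏ w ∈ σ, X w ∈ Δ.redIdeal U M := by
        induction a using MvPolynomial.induction_on with
        | C a => simp [killVar]
        | add p q hp hq =>
          convert add_mem hp hq using 1
          rw [map_add, map_add, map_add]
          ring
        | mul_X p w hp =>
          rw [map_mul, map_mul, constantCoeff_X, mul_zero, C_0, sub_zero, mul_assoc]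
          refine Ideal.mul_mem_left _ _ ?_
          by_cases hw : w = v
          · rw [hw, killVar_X_self, zero_mul]
            exact zero_mem _
          · rw [killVar_X_of_ne K hw]
            exact X_mul_prod_X_mem hσU h.facet hM w
      convert add_mem (Ideal.mul_mem_left _ (killVar K v a) hs1) (Ideal.mul_mem_left _ (C s) h1)
        using 1
      rw [smul_eq_mul, map_mul, map_mul]
      ring
    · obtain ⟨u, hu⟩ := X_dvd_lineMap_sub c a
      convert dvd_add (hs2.mul_left (lineMap c a)) (Dvd.intro
        (u * Polynomial.C (s * ∏ w ∈ σ, c w)) rfl : Polynomial.X ^ (d + 1) ∣ _) using 1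
      have hu' : lineMap c a = Polynomial.X * u + Polynomial.C (constantCoeff a) := by
        rw [← hu, sub_add_cancel]
      rw [smul_eq_mul, map_mul, hu', mul_assoc, map_mul Polynomial.C]
      ring

/-- Modulo the ideal of `Δ'`, multiples of `x_v` depend only on their restriction to the line,
because `x_v x_w = c_w x_v²`. After a lift of the relation `killVar K v p = 0` with zero line
component is subtracted from `p`, only a multiple of `x_v` remains. -/
theorem IsFacetSubdivision.mem_of_killVar_mem (h : IsFacetSubdivision Δ Δ' σ v)
    (hd : σ.card = d) (hσU : σ ⊆ U) (hvU : v ∉ U) (hM : HasDualRows M σ)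
    (hc : IsColumnRelation M U σ v c) {p : MvPolynomial V K}
    (h1 : killVar K v p ∈ Δ.redIdeal U M) (h2 : Polynomial.X ^ (d + 1) ∣ lineMap c p) :
    p ∈ Δ'.redIdeal (insert v U) M := by
  have hvσ : v ∉ σ := fun hv => hvU (hσU hv)
  set J' := Δ'.redIdeal (insert v U) M with hJ'
  let ψ : Polynomial K →ₐ[K] MvPolynomial V K := Polynomial.aeval (X v)
  have hψX : ψ Polynomial.X = X v := Polynomial.aeval_X _
  have hψC : ∀ a, ψ (Polynomial.C a) = C a := fun a => Polynomial.aeval_C _ _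
  have hoff : ∀ w ∉ σ, w ≠ v → (X v * X w : MvPolynomial V K) ∈ J' := by
    intro w hw hwv
    have hvw : v ∉ ({w} : Finset V) := by simpa using hwv.symm
    have := prod_X_mem_redIdeal (K := K) (U := insert v U) (M := M) (Δ := Δ') (s := insert v {w})
      fun hf => hw (((h.insert_mem_iff {w} hvw).mp hf).1 (Finset.mem_singleton_self w))
    rwa [Finset.prod_insert hvw, Finset.prod_singleton] at this
  -- For `w ∈ σ` the dual row of `w` has the value `-c w` on the column of `v`; times `X v`, all
  -- other variables disappear by `hoff`.
  have hX : ∀ w, (X v * (X w - C (c w) * X v) : MvPolynomial V K) ∈ J' := by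
    intro w
    by_cases hwv : w = v
    · rw [hwv, hc.apply_self]
      simp
    by_cases hw : w ∈ σ
    swap
    · rw [hc.apply_of_notMem w hw hwv, C_0, zero_mul, sub_zero]
      exact hoff w hw hwv
    obtain ⟨r, hr⟩ := hM w hw
    have hrv : ∑ i, r i * M i v = - c w := by
      have h0 : ∑ j ∈ insert v U, (∑ i, r i * M i j) * c j = 0 := by
        simp only [Finset.sum_mul]
        rw [Finset.sum_comm]
        refine Finset.sum_eq_zero fun i _ => ?_
        simp only [mul_assoc, ← Finset.mul_sum, hc.sum_eq_zero, mul_zero]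
      have h1 : ∑ j ∈ U.erase w, (∑ i, r i * M i j) * c j = 0 := by
        refine Finset.sum_eq_zero fun j hj => ?_
        by_cases hjσ : j ∈ σ
        · rw [hr j hjσ, if_neg (Finset.ne_of_mem_erase hj), zero_mul]
        · rw [hc.apply_of_notMem j hjσ fun hjv => hvU (hjv ▸ Finset.mem_of_mem_erase hj),
            mul_zero]
      rw [Finset.sum_insert hvU, hc.apply_self, mul_one, ← Finset.add_sum_erase U _ (hσU hw),
        hr w hw, if_pos rfl, one_mul, h1, add_zero] at h0
      exact eq_neg_of_add_eq_zero_left h0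
    have hcomb := Ideal.mul_mem_left _ (X v) (combination_mem_redIdeal Δ' (insert v U) M r)
    rw [Finset.sum_insert hvU, hrv, ← Finset.add_sum_erase U _ (hσU hw), hr w hw, if_pos rfl,
      C_1, one_mul, ← add_assoc, mul_add] at hcomb
    have hsum : X v * ∑ j ∈ U.erase w, C (∑ i, r i * M i j) * X j ∈ J' := by
      rw [Finset.mul_sum]
      refine Ideal.sum_mem _ fun j hj => ?_
      by_cases hjσ : j ∈ σ
      · rw [hr j hjσ, if_neg (Finset.ne_of_mem_erase hj), C_0, zero_mul, mul_zero]
        exact zero_mem _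
      · rw [mul_left_comm]
        exact Ideal.mul_mem_left _ _ (hoff j hjσ fun hjv =>
          hvU (hjv ▸ Finset.mem_of_mem_erase hj))
    convert (Ideal.add_mem_iff_left _ hsum).mp hcomb using 1
    rw [C_neg]
    ring
  have hline : ∀ q, X v * (q - ψ (lineMap c q)) ∈ J' := by
    intro q
    induction q using MvPolynomial.induction_on with
    | C a => simp [hψC]
    | add p q hp hq =>
      convert add_mem hp hq using 1
      rw [map_add, map_add]
      ring
    | mul_X p w hp =>
      convert add_mem (Ideal.mul_mem_left _ (X w) hp)
        (Ideal.mul_mem_left _ (ψ (lineMap c p)) (hX w)) using 1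
      rw [map_mul, map_mul, lineMap_X, map_mul, hψX, hψC]
      ring
  -- On the line, the non-face `σ ∪ {v}` becomes `∏ c_w` times this power, and `∏ c_w` is
  -- invertible.
  have hpow : (X v ^ (d + 1) : MvPolynomial V K) ∈ J' := by
    have hnf := prod_X_mem_redIdeal (K := K) (U := insert v U) (M := M) (Δ := Δ')
      (s := insert v σ) fun hf => ssubset_irrefl σ ((h.insert_mem_iff σ hvσ).mp hf)
    rw [Finset.prod_insert hvσ] at hnf
    have hl := sub_mem hnf (hline (∏ w ∈ σ, X w))
    rw [lineMap_prod_X, map_mul, hψC, map_pow, hψX, hd] at hl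
    have hne : ∏ w ∈ σ, c w ≠ 0 := Finset.prod_ne_zero_iff.mpr hc.apply_ne_zero
    convert Ideal.mul_mem_left _ (C (∏ w ∈ σ, c w)⁻¹) hl using 1
    have hC : (C (∏ w ∈ σ, c w)⁻¹ * C (∏ w ∈ σ, c w) : MvPolynomial V K) = 1 := by
      rw [← C_mul, inv_mul_cancel₀ hne, C_1]
    linear_combination (-(X v : MvPolynomial V K) ^ (d + 1)) * hC
  -- Modulo `X v`, generators of the ideal of `Δ` lift to elements of `J'` that vanish on the line.
  have hlift : ∀ q ∈ Δ.redIdeal U M, ∃ j ∈ J', lineMap c j = 0 ∧ X v ∣ q - j := by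
    intro q hq
    induction hq using Submodule.span_induction with
    | mem q hq =>
      obtain ⟨s, hs, rfl⟩ | ⟨i, rfl⟩ := hq
      · by_cases hv : v ∈ s
        · exact ⟨0, zero_mem _, map_zero _, by
            rw [sub_zero]
            exact Finset.dvd_prod_of_mem _ hv⟩
        · refine ⟨_, prod_X_mem_redIdeal fun hf => hs ((h.mem_iff s hv).mp hf).1, ?_, by simp⟩
          rw [lineMap_prod_X, prod_eq_zero_of_not_subset hc hv
            fun hsub => hs (Δ.down_closed _ h.mem _ hsub)]
          simp
      · refine ⟨_, form_mem_redIdeal Δ' (insert v U) M i, ?_, ?_⟩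
        · rw [lineMap_form, hc.sum_eq_zero]
          simp
        · rw [Finset.sum_insert hvU]
          exact ⟨- C (M i v), by ring⟩
    | zero => exact ⟨0, zero_mem _, map_zero _, by simp⟩
    | add p q _ _ hp hq =>
      obtain ⟨j, hj, hj0, hjd⟩ := hp
      obtain ⟨l, hl, hl0, hld⟩ := hq
      exact ⟨j + l, add_mem hj hl, by rw [map_add, hj0, hl0, add_zero], by
        convert dvd_add hjd hld using 1
        ring⟩
    | smul a p _ hp =>
      obtain ⟨j, hj, hj0, hjd⟩ := hp
      exact ⟨a * j, Ideal.mul_mem_left _ _ hj, by rw [map_mul, hj0, mul_zero], by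
        convert hjd.mul_left a using 1
        rw [smul_eq_mul]
        ring⟩
  obtain ⟨j, hj, hj0, hjd⟩ := hlift _ h1
  obtain ⟨t, ht⟩ : X v ∣ p - j := by
    convert dvd_add (X_dvd_sub_killVar v p) hjd using 1
    ring
  obtain rfl : p = j + X v * t := by rw [← ht]; ring
  refine add_mem hj ?_
  rw [map_add, hj0, zero_add, map_mul, lineMap_X, hc.apply_self, Polynomial.C_1, one_mul] at h2
  obtain ⟨u, hu⟩ := h2
  have h3 : X v * ψ (lineMap c t) ∈ J' := by
    rw [← hψX, ← map_mul, hu, map_mul, map_pow, hψX]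
    exact Ideal.mul_mem_right _ _ hpow
  convert add_mem (hline t) h3 using 1
  ring

end

end FinSimplicialComplex
end

/-! ### Column relations and the embedding of the generic field into Hahn series -/

noncomputable section
namespace FinSimplicialComplex

/-- Cramer's rule: the columns of `σ` form a basis of the column space, and the dual rows give the
coordinates of the column of `v`. -/
lemma exists_isColumnRelation {V K : Type*} [DecidableEq V] [Field K] {d : ℕ} {M : Fin d → V → K}
    {U σ : Finset V} {v : V} (hd : σ.card = d) (hσU : σ ⊆ U) (hvU : v ∉ U)
    (hM : ∀ τ ⊆ insert v σ, τ.card ≤ d → HasDualRows M τ) :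
    ∃ c, IsColumnRelation M U σ v c := by
  have hvσ : v ∉ σ := fun hv => hvU (hσU hv)
  choose! r hr using hM σ (Finset.subset_insert _ _) hd.le
  let R : Matrix {x // x ∈ σ} (Fin d) K := Matrix.of fun j i => r j.1 i
  let B : Matrix (Fin d) {x // x ∈ σ} K := Matrix.of fun i j => M i j.1
  have hRB : R * B = 1 := by
    ext j l
    rw [Matrix.mul_apply, Matrix.one_apply]
    refine (hr j.1 j.2 l.1 l.2).trans ?_
    rcases eq_or_ne j l with rfl | hne
    · rw [if_pos rfl, if_pos rfl]
    · rw [if_neg fun h => hne (Subtype.ext h).symm, if_neg hne]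
  -- Both matrices are square because `σ` has `d` elements, so the left inverse is also a right
  -- inverse.
  have hBR : B * R = 1 :=
    (Matrix.mul_eq_one_comm_of_card_eq _ _ _ (by simpa using hd)).mp hRB
  let c : V → K := fun w => if w = v then 1 else if w ∈ σ then - ∑ i, r w i * M i v else 0
  have hcv : c v = 1 := if_pos rfl
  have hcσ : ∀ w ∈ σ, c w = - ∑ i, r w i * M i v := fun w hw => by
    simp only [c, if_pos hw, if_neg (ne_of_mem_of_not_mem hw hvσ)]
  have hc0 : ∀ w ∉ σ, w ≠ v → c w = 0 := fun w hw hwv => by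
    simp only [c, if_neg hw, if_neg hwv]
  have hsum : ∀ i, ∑ j ∈ insert v U, M i j * c j = 0 := by
    intro i
    have h1 : ∑ j ∈ U, M i j * c j = ∑ j ∈ σ, M i j * c j :=
      (Finset.sum_subset hσU fun j hj hjσ => by
        rw [hc0 j hjσ fun h => hvU (h ▸ hj), mul_zero]).symm
    have h2 : ∑ j ∈ σ, M i j * c j = - ∑ l, (B * R) i l * M l v := by
      rw [← Finset.sum_coe_sort]
      simp only [Matrix.mul_apply, Finset.sum_mul]
      rw [Finset.sum_comm, ← Finset.sum_neg_distrib]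
      refine Finset.sum_congr rfl fun j _ => ?_
      rw [hcσ j.1 j.2, mul_neg, Finset.mul_sum]
      simp [B, R, mul_assoc]
    rw [Finset.sum_insert hvU, hcv, mul_one, h1, h2, hBR]
    simp [Matrix.one_apply]
  refine ⟨c, hcv, hc0, fun w hw hcw => ?_, hsum⟩
  -- If `c w = 0`, the relation would live on the `d` columns of `v` and `σ \ {w}`, which are
  -- independent.
  obtain ⟨r', hr'⟩ := hM (insert v (σ.erase w)) (Finset.insert_subset_insert _
    (Finset.erase_subset _ _)) (by
      rw [Finset.card_insert_of_notMem fun h => hvσ (Finset.mem_of_mem_erase h),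
        Finset.card_erase_add_one hw, hd]) v (Finset.mem_insert_self _ _)
  have h0 : ∑ j ∈ insert v U, (∑ i, r' i * M i j) * c j = 0 := by
    simp only [Finset.sum_mul]
    rw [Finset.sum_comm]
    refine Finset.sum_eq_zero fun i _ => ?_
    simp only [mul_assoc, ← Finset.mul_sum, hsum, mul_zero]
  rw [Finset.sum_insert hvU, hcv, hr' v (Finset.mem_insert_self _ _), if_pos rfl,
    Finset.sum_eq_zero, add_zero, one_mul] at h0
  · exact one_ne_zero h0
  · intro j hj
    have hjv : j ≠ v := fun h => hvU (h ▸ hj)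
    by_cases hjw : j = w
    · rw [hjw, hcw, mul_zero]
    by_cases hjσ : j ∈ σ
    · rw [hr' j (Finset.mem_insert_of_mem (Finset.mem_erase.mpr ⟨hjw, hjσ⟩)), if_neg hjv, zero_mul]
    · rw [hc0 j hjσ hjv, mul_zero]

section

variable {V : Type*} [DecidableEq V] {Δ Δ' : FinSimplicialComplex V} {σ : Finset V} {v : V}

namespace IsFacetSubdivision

lemma notMem_verts (h : IsFacetSubdivision Δ Δ' σ v) : v ∉ Δ.verts :=
  fun hv => h.notMem (mem_verts.mp hv)

lemma notMem_facet (h : IsFacetSubdivision Δ Δ' σ v) : v ∉ σ :=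
  fun hv => h.notMem_verts (subset_verts h.mem hv)

lemma ne_of_vert (h : IsFacetSubdivision Δ Δ' σ v) (w : Δ.Vert) : w.1 ≠ v :=
  fun hw => h.notMem (hw ▸ w.2)

lemma singleton_mem (h : IsFacetSubdivision Δ Δ' σ v) {w : V} (hw : {w} ∈ Δ.faces) :
    {w} ∈ Δ'.faces := by
  refine (h.mem_iff _ ?_).mpr ⟨hw, fun hs => ?_⟩
  · exact fun hv => h.ne_of_vert ⟨w, hw⟩ (Finset.mem_singleton.mp hv).symm
  · have := h.two_le
    rw [← hs, Finset.card_singleton] at this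
    omega

lemma new_mem (h : IsFacetSubdivision Δ Δ' σ v) : {v} ∈ Δ'.faces := by
  have := (h.insert_mem_iff ∅ (Finset.notMem_empty v)).mpr
    (Finset.ssubset_iff_subset_ne.mpr ⟨Finset.empty_subset _, fun he => by
      have := h.two_le
      rw [← he, Finset.card_empty] at this
      omega⟩)
  rwa [insert_empty_eq] at this

lemma verts_eq (h : IsFacetSubdivision Δ Δ' σ v) : Δ'.verts = insert v Δ.verts := by
  ext w
  rw [Finset.mem_insert, mem_verts, mem_verts]
  constructor
  · intro hw
    by_cases hwv : w = v
    · exact Or.inl hwv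
    · exact Or.inr ((h.mem_iff _ (by simpa using Ne.symm hwv)).mp hw).1
  · rintro (rfl | hw)
    · exact h.new_mem
    · exact h.singleton_mem hw

lemma rank_eq (h : IsFacetSubdivision Δ Δ' σ v) (hd : Δ.rank = σ.card) : Δ'.rank = σ.card := by
  have h2 := h.two_le
  refine le_antisymm (Finset.sup_le fun s hs => ?_) ?_
  · by_cases hv : v ∈ s
    · rw [← Finset.insert_erase hv, h.insert_mem_iff _ (Finset.notMem_erase v s)] at hs
      have := Finset.card_lt_card hs
      rw [← Finset.card_erase_add_one hv]
      omega
    · rw [← hd]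
      exact card_le_rank ((h.mem_iff s hv).mp hs).1
  · obtain ⟨w, hw⟩ : σ.Nonempty := Finset.card_pos.mp (by omega)
    have hvw : v ∉ σ.erase w := fun hv => h.notMem_facet (Finset.mem_of_mem_erase hv)
    have := card_le_rank ((h.insert_mem_iff (σ.erase w) hvw).mpr (Finset.erase_ssubset hw))
    rwa [Finset.card_insert_of_notMem hvw, Finset.card_erase_add_one hw] at this

/-- The inclusion of vertex sets. -/
def vertMap (h : IsFacetSubdivision Δ Δ' σ v) (w : Δ.Vert) : Δ'.Vert :=
  ⟨w.1, h.singleton_mem w.2⟩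

lemma polyInclusion_injective (h : IsFacetSubdivision Δ Δ' σ v) (F : Type*) [Field F] (d : ℕ) :
    Function.Injective (((algebraMap (MvPolynomial (Fin d × Δ'.Vert) F) (GenericField F Δ' d)).comp
      (rename (R := F) (Prod.map id h.vertMap)).toRingHom)) := by
  refine (IsFractionRing.injective (MvPolynomial (Fin d × Δ'.Vert) F)
      (GenericField F Δ' d)).comp (rename_injective (R := F) _ ?_)
  exact Function.injective_id.prodMap fun a b hab => Subtype.ext (congrArg Subtype.val hab :)

/-- The inclusion of the fields of rational functions. -/
def fieldInclusion (h : IsFacetSubdivision Δ Δ' σ v) (F : Type*) [Field F] (d : ℕ) :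
    GenericField F Δ d →+* GenericField F Δ' d :=
  IsFractionRing.lift (h.polyInclusion_injective F d)

lemma fieldInclusion_algebraMap (h : IsFacetSubdivision Δ Δ' σ v) (F : Type*) [Field F] (d : ℕ)
    (p : MvPolynomial (Fin d × Δ.Vert) F) :
    h.fieldInclusion F d (algebraMap _ _ p) =
      algebraMap _ (GenericField F Δ' d) (rename (Prod.map id h.vertMap) p) :=
  IsFractionRing.lift_algebraMap (h.polyInclusion_injective F d) p

lemma fieldInclusion_genMatrix (h : IsFacetSubdivision Δ Δ' σ v) (F : Type*) [Field F] (d : ℕ)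
    (i : Fin d) {j : V} (hj : j ∈ Δ.verts) :
    h.fieldInclusion F d (Δ.genMatrix F d i j) = Δ'.genMatrix F d i j := by
  rw [mem_verts] at hj
  refine (congrArg _ (extMatrix_apply_vert Δ (Δ.genericMatrix F d) i ⟨j, hj⟩)).trans
    ((h.fieldInclusion_algebraMap F d (X (i, ⟨j, hj⟩))).trans ?_)
  rw [rename_X]
  exact (extMatrix_apply_vert Δ' (Δ'.genericMatrix F d) i (h.vertMap ⟨j, hj⟩)).symm

lemma map_genIdeal (h : IsFacetSubdivision Δ Δ' σ v) (F : Type*) [Field F] (d : ℕ) :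
    (Δ.genIdeal F d).map (map (h.fieldInclusion F d)) =
      Δ.redIdeal Δ.verts (Δ'.genMatrix F d) := by
  rw [genIdeal, redIdeal_map]
  exact redIdeal_congr _ _ fun i j hj => h.fieldInclusion_genMatrix F d i hj

end IsFacetSubdivision

end

section

variable {V : Type*} [LinearOrder V] {Δ Δ' : FinSimplicialComplex V} {σ : Finset V} {v : V}

/-- The embedding of the larger field of rational functions into Hahn series over the smaller one
that turns the coefficients of the column relation into independent monomials. -/
theorem IsFacetSubdivision.exists_hahn_embedding (h : IsFacetSubdivision Δ Δ' σ v) (F : Type*)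
    [Field F] {d : ℕ} (hd : σ.card = d) {c : V → GenericField F Δ' d}
    (hc : IsColumnRelation (Δ'.genMatrix F d) Δ.verts σ v c) :
    ∃ g : GenericField F Δ' d →+* HahnSeries (Lex ({x // x ∈ σ} → ℤ)) (GenericField F Δ d),
      (∀ a, g (h.fieldInclusion F d a) = HahnSeries.C a) ∧
      ∀ l : {x // x ∈ σ}, g (c l.1) = HahnSeries.single (toLex (Pi.single l 1)) 1 := by
  let k := GenericField F Δ d
  let K := GenericField F Δ' d
  let m : Fin d → {x // x ∈ σ} → k := fun i l => Δ.genMatrix F d i l.1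
  -- Replaces the column of `v` by minus the combination of the columns of `σ` with free
  -- coefficients `X l`.
  let f₀ : MvPolynomial (Fin d × Δ'.Vert) F →+* MvPolynomial {x // x ∈ σ} k :=
    eval₂Hom ((C : k →+* _).comp ((algebraMap (MvPolynomial (Fin d × Δ.Vert) F) k).comp C))
      fun x => if x.2.1 = v then - ∑ l, C (m x.1 l) * X l else C (Δ.genMatrix F d x.1 x.2.1)
  -- Specialising the free coefficients to `c` recovers the original matrix, so `b ∘ f₀` is the
  -- canonical embedding and `f₀` is injective.
  let b : MvPolynomial {x // x ∈ σ} k →+* K := eval₂Hom (h.fieldInclusion F d) fun l => c l.1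
  have hσU : σ ⊆ Δ.verts := subset_verts h.mem
  have hrel : ∀ i, ∑ l : {x // x ∈ σ}, Δ'.genMatrix F d i l.1 * c l.1 =
      - Δ'.genMatrix F d i v := by
    intro i
    have h1 := hc.sum_eq_zero i
    rw [Finset.sum_insert h.notMem_verts, hc.apply_self, mul_one,
      ← Finset.sum_subset hσU fun j hj hjσ => by
        rw [hc.apply_of_notMem j hjσ fun hjv => h.notMem_verts (hjv ▸ hj), mul_zero],
      ← Finset.sum_coe_sort] at h1
    exact eq_neg_of_add_eq_zero_right h1
  have hf₀v : ∀ i, f₀ (X (i, ⟨v, h.new_mem⟩)) = - ∑ l, C (m i l) * X l := fun i => by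
    simp [f₀]
  have hf₀ : ∀ i (w : Δ'.Vert), w.1 ≠ v → f₀ (X (i, w)) = C (Δ.genMatrix F d i w.1) :=
    fun i w hw => by simp [f₀, hw]
  have hf₀C : ∀ a : F, f₀ (C a) = C (algebraMap (MvPolynomial (Fin d × Δ.Vert) F) k (C a)) :=
    fun a => by simp [f₀]
  have hgen : ∀ i (w : Δ'.Vert), Δ'.genMatrix F d i w.1 =
      algebraMap (MvPolynomial (Fin d × Δ'.Vert) F) K (X (i, w)) := fun i w => by
    rw [genMatrix, extMatrix_apply_vert, genericMatrix]
  have hbf : b.comp f₀ = algebraMap (MvPolynomial (Fin d × Δ'.Vert) F) K := by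
    refine ringHom_ext (fun a => ?_) fun x => ?_
    · rw [RingHom.comp_apply, hf₀C, coe_eval₂Hom, eval₂_C, h.fieldInclusion_algebraMap, rename_C]
    · obtain ⟨i, w, hw⟩ := x
      rw [RingHom.comp_apply]
      by_cases hwv : w = v
      · subst hwv
        rw [hf₀v, map_neg, map_sum, ← hgen i ⟨w, hw⟩, neg_eq_iff_eq_neg, ← hrel i]
        refine Finset.sum_congr rfl fun l _ => ?_
        rw [map_mul, coe_eval₂Hom, eval₂_C, eval₂_X,
          h.fieldInclusion_genMatrix F d i (hσU l.2)]
      · rw [hf₀ i ⟨w, hw⟩ hwv, coe_eval₂Hom, eval₂_C, ← hgen i ⟨w, hw⟩]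
        refine h.fieldInclusion_genMatrix F d i ?_
        have := (h.verts_eq ▸ mem_verts.mpr hw : w ∈ insert v Δ.verts)
        exact (Finset.mem_insert.mp this).resolve_left hwv
  have hf₀inj : Function.Injective f₀ := by
    refine Function.Injective.of_comp (f := b) ?_
    rw [← RingHom.coe_comp, hbf]
    exact IsFractionRing.injective _ _
  let e : MvPolynomial {x // x ∈ σ} k →+* HahnSeries (Lex ({x // x ∈ σ} → ℤ)) k :=
    (polyToHahn {x // x ∈ σ} k).toRingHom
  have heC : ∀ a, e (C a) = HahnSeries.C a := fun a => (polyToHahn {x // x ∈ σ} k).commutes a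
  have heX : ∀ l, e (X l) = HahnSeries.single (toLex (Pi.single l 1)) 1 := fun l => aeval_X _ l
  have hinj : Function.Injective (e.comp f₀) := (polyToHahn_injective _ _).comp hf₀inj
  let g : K →+* HahnSeries (Lex ({x // x ∈ σ} → ℤ)) k := IsFractionRing.lift hinj
  have hg : ∀ p, g (algebraMap _ _ p) = e (f₀ p) := fun p => IsFractionRing.lift_algebraMap hinj p
  have hginc : ∀ a, g (h.fieldInclusion F d a) = HahnSeries.C a := by
    suffices hh : g.comp (h.fieldInclusion F d) = HahnSeries.C from fun a =>
      congrArg (fun f => f a) hh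
    refine IsLocalization.ringHom_ext (nonZeroDivisors (MvPolynomial (Fin d × Δ.Vert) F)) ?_
    refine ringHom_ext (fun a => ?_) fun x => ?_
    · rw [RingHom.comp_apply, RingHom.comp_apply, RingHom.comp_apply,
        h.fieldInclusion_algebraMap, hg, rename_C, hf₀C, heC]
    · rw [RingHom.comp_apply, RingHom.comp_apply, RingHom.comp_apply,
        h.fieldInclusion_algebraMap, hg, rename_X]
      have := hf₀ x.1 (h.vertMap x.2) (h.ne_of_vert x.2)
      rw [show Prod.map id h.vertMap x = (x.1, h.vertMap x.2) from rfl, this, heC]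
      congr 1
      exact extMatrix_apply_vert Δ _ x.1 x.2
  refine ⟨g, hginc, fun l₀ => ?_⟩
  have hsum : ∀ i, ∑ l : {x // x ∈ σ}, (HahnSeries.C (m i l) : HahnSeries _ k) *
      (g (c l.1) - HahnSeries.single (toLex (Pi.single l 1)) 1) = 0 := by
    intro i
    have h1 := congrArg g (hrel i)
    rw [map_sum, map_neg, hgen i ⟨v, h.new_mem⟩, hg, hf₀v, map_neg, neg_neg, map_sum] at h1
    simp only [mul_sub, Finset.sum_sub_distrib]
    rw [sub_eq_zero]
    refine Eq.trans (Finset.sum_congr rfl fun l _ => ?_) (h1.trans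
      (Finset.sum_congr rfl fun l _ => ?_))
    · rw [map_mul, ← hginc, h.fieldInclusion_genMatrix F d i (hσU l.2)]
    · rw [map_mul, heC, heX]
  -- The images of the `c l` and the monomials solve the same linear system; the dual row of `l₀`
  -- over `k` separates the unknown at `l₀`.
  obtain ⟨r, hr⟩ := hasDualRows_genMatrix F Δ hσU hd.le l₀.1 l₀.2
  have h2 : ∑ i, (HahnSeries.C (r i) : HahnSeries _ k) * ∑ l : {x // x ∈ σ},
      (HahnSeries.C (m i l) : HahnSeries _ k) *
      (g (c l.1) - HahnSeries.single (toLex (Pi.single l 1)) 1) = 0 :=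
    Finset.sum_eq_zero fun i _ => by rw [hsum, mul_zero]
  simp only [Finset.mul_sum, ← mul_assoc, ← map_mul] at h2
  rw [Finset.sum_comm] at h2
  simp only [← Finset.sum_mul, ← map_sum] at h2
  have h3 : ∀ l : {x // x ∈ σ}, ∑ i, r i * m i l = if l = l₀ then 1 else 0 := fun l => by
    rw [hr l.1 l.2]
    simp only [Subtype.ext_iff]
  simp only [h3, apply_ite HahnSeries.C, map_one, map_zero, ite_mul, one_mul, zero_mul,
    Finset.sum_ite_eq', Finset.mem_univ, if_true] at h2
  exact sub_eq_zero.mp h2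

end

end FinSimplicialComplex
end

/-! ### Anisotropy before and after a facet subdivision -/

noncomputable section
namespace FinSimplicialComplex

lemma coeff_eq_zero_of_X_pow_dvd {K : Type*} [Field K] {d i : ℕ} {a b : K} (hi : i < d)
    (h : Polynomial.X ^ (d + 1) ∣
      Polynomial.C a * Polynomial.X ^ i - Polynomial.C b * Polynomial.X ^ d) : a = 0 ∧ b = 0 := by
  rw [Polynomial.X_pow_dvd_iff] at h
  have h1 := h i (by omega)
  have h2 := h d (by omega)
  rw [Polynomial.coeff_sub, Polynomial.coeff_C_mul_X_pow, Polynomial.coeff_C_mul_X_pow] at h1 h2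
  rw [if_pos rfl, if_neg hi.ne, sub_zero] at h1
  rw [if_neg hi.ne', if_pos rfl, zero_sub, neg_eq_zero] at h2
  exact ⟨h1, h2⟩

lemma eq_of_X_pow_dvd {K : Type*} [Field K] {d : ℕ} {a b : K}
    (h : Polynomial.X ^ (d + 1) ∣
      Polynomial.C a * Polynomial.X ^ d - Polynomial.C b * Polynomial.X ^ d) : a = b := by
  rw [Polynomial.X_pow_dvd_iff] at h
  have h1 := h d (by omega)
  rwa [Polynomial.coeff_sub, Polynomial.coeff_C_mul_X_pow, Polynomial.coeff_C_mul_X_pow,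
    if_pos rfl, if_pos rfl, sub_eq_zero] at h1

/-- The facet monomials of `Δ` are nonzero in the generic Artinian reduction. -/
def FacetsNeZero {V : Type*} [DecidableEq V] (F : Type*) [Field F] (Δ : FinSimplicialComplex V)
    (d : ℕ) : Prop :=
  ∀ s ∈ Δ.faces, s.card = d → ∏ w ∈ s, X w ∉ Δ.genIdeal F d

namespace IsFacetSubdivision

variable {V : Type*} [LinearOrder V] {Δ Δ' : FinSimplicialComplex V} {σ : Finset V} {v : V}

lemma hasDualRows (h : IsFacetSubdivision Δ Δ' σ v) (F : Type*) [Field F] {d : ℕ} :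
    ∀ τ ⊆ insert v σ, τ.card ≤ d → HasDualRows (Δ'.genMatrix F d) τ := fun _ hτ hc =>
  hasDualRows_genMatrix F Δ' (hτ.trans (h.verts_eq ▸
    Finset.insert_subset_insert v (subset_verts h.mem))) hc

lemma exists_columnRelation (h : IsFacetSubdivision Δ Δ' σ v) (F : Type*) [Field F] {d : ℕ}
    (hd : σ.card = d) : ∃ c, IsColumnRelation (Δ'.genMatrix F d) Δ.verts σ v c :=
  exists_isColumnRelation hd (subset_verts h.mem) h.notMem_verts (h.hasDualRows F)

/-- Both components of a form with zero square vanish. Below the middle degree this is immediate; in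
the middle degree a common scalar `s ≠ 0` is excluded by the parity of orders of Hahn series. -/
theorem isAnisotropicIdeal (h : IsFacetSubdivision Δ Δ' σ v) (F : Type*) [Field F] {d : ℕ}
    (hd : σ.card = d) (hani : IsAnisotropicIdeal (Δ.genIdeal F d) d)
    (hσ : Even d → ∏ w ∈ σ, X w ∉ Δ.genIdeal F d) :
    IsAnisotropicIdeal (Δ'.genIdeal F d) d := by
  intro i hi p hp hp2
  obtain rfl | hi0 := Nat.eq_zero_or_pos i
  · exact mem_of_sq_mem_of_isHomogeneous_zero hp hp2
  have hσU : σ ⊆ Δ.verts := subset_verts h.mem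
  have hM := h.hasDualRows F σ (Finset.subset_insert _ _) hd.le
  obtain ⟨c, hc⟩ := h.exists_columnRelation F hd
  obtain ⟨g, hg, hgc⟩ := h.exists_hahn_embedding F hd hc
  have hprod : ∏ w ∈ σ, c w ≠ 0 := Finset.prod_ne_zero_iff.mpr hc.apply_ne_zero
  rw [genIdeal, h.verts_eq] at hp2 ⊢
  obtain ⟨s, hs1, hs2⟩ := h.exists_of_mem hd hσU h.notMem_verts hM hc hp2
  rw [map_pow, lineMap_of_isHomogeneous c hp, mul_pow, ← map_pow, ← pow_mul] at hs2
  rw [map_pow, ← h.map_genIdeal] at hs1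
  -- If `2i < d`, the powers `t^(2i)` and `t^d` separate. If `2i = d`, they coincide and only `(eval
  -- c p)² = s ∏ c_w` is known.
  have key : eval c p = 0 ∧ s = 0 := by
    obtain hlt | heq := lt_or_eq_of_le hi
    · rw [mul_comm] at hlt
      obtain ⟨h1, h2⟩ := coeff_eq_zero_of_X_pow_dvd hlt hs2
      exact ⟨pow_eq_zero_iff two_ne_zero |>.mp h1, (mul_eq_zero.mp h2).resolve_right hprod⟩
    · rw [mul_comm i, heq] at hs2
      have hts := eq_of_X_pow_dvd hs2
      by_cases hs0 : s = 0
      · rw [hs0, zero_mul] at hts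
        exact ⟨pow_eq_zero_iff two_ne_zero |>.mp hts, hs0⟩
      exfalso
      have hmap : (∏ w ∈ σ, X w : MvPolynomial V (GenericField F Δ' d)) =
          map (h.fieldInclusion F d) (∏ w ∈ σ, X w) := by simp
      rw [hmap] at hs1
      obtain ⟨γ, hγ⟩ := exists_order_eq_add_self g hg hani hi (killVar_isHomogeneous v hp)
        (hσ ⟨i, by omega⟩) hs0 hs1
      have ht : eval c p ≠ 0 := fun ht => by
        rw [ht, zero_pow two_ne_zero, eq_comm, mul_eq_zero] at hts
        exact hts.elim hs0 hprod
      have hord := congrArg (fun x => (g x).order) hts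
      have hgprod : g (∏ w ∈ σ, c w) =
          HahnSeries.single (toLex fun _ => 1) 1 := by
        rw [map_prod, ← Finset.prod_coe_sort, Finset.prod_congr rfl fun l _ => hgc l]
        have : ∀ S : Finset {x // x ∈ σ}, ∏ l ∈ S, (HahnSeries.single (toLex (Pi.single l 1)) 1 :
            HahnSeries (Lex ({x // x ∈ σ} → ℤ)) (GenericField F Δ d)) =
            HahnSeries.single (toLex (∑ l ∈ S, Pi.single l 1)) 1 := by
          intro S
          induction S using Finset.induction_on with
          | empty => rfl
          | insert a S ha ih =>
            rw [Finset.prod_insert ha, ih, Finset.sum_insert ha, HahnSeries.single_mul_single,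
              mul_one]
            rfl
        rw [this, Finset.univ_sum_single]
      have hgt : g (eval c p) ≠ 0 := (map_ne_zero g).mpr ht
      have hgs : g s ≠ 0 := (map_ne_zero g).mpr hs0
      simp only [pow_two, map_mul] at hord
      rw [hgprod, HahnSeries.order_mul hgt hgt,
        HahnSeries.order_mul hgs (HahnSeries.single_ne_zero one_ne_zero), hγ,
        HahnSeries.order_single one_ne_zero] at hord
      obtain ⟨w, hw⟩ : σ.Nonempty := Finset.card_pos.mp (by have := h.two_le; omega)
      -- At any coordinate the equality of orders reads `2a = 2b + 1`.
      have h1 : ofLex (g (eval c p)).order ⟨w, hw⟩ + ofLex (g (eval c p)).order ⟨w, hw⟩ =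
          ofLex γ ⟨w, hw⟩ + ofLex γ ⟨w, hw⟩ + 1 :=
        congrFun (congrArg ofLex hord) ⟨w, hw⟩
      omega
  refine h.mem_of_killVar_mem hd hσU h.notMem_verts hM hc ?_ ?_
  · rw [← h.map_genIdeal]
    rw [key.2, C_0, zero_mul, sub_zero] at hs1
    exact mem_map_of_sq_mem g hg hani hi (killVar_isHomogeneous v hp) hs1
  · rw [lineMap_of_isHomogeneous c hp, key.1]
    simp

/-- A form on `Δ` is corrected by a multiple of `x_v^i` so that it vanishes on the line; its square
then vanishes for `Δ'` as soon as it does for `Δ`. No nonvanishing of `x_σ` is involved. -/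
theorem isAnisotropicIdeal_of_subdivision (h : IsFacetSubdivision Δ Δ' σ v) (F : Type*) [Field F]
    {d : ℕ} (hd : σ.card = d) (hani : IsAnisotropicIdeal (Δ'.genIdeal F d) d) :
    IsAnisotropicIdeal (Δ.genIdeal F d) d := by
  intro i hi p hp hp2
  obtain rfl | hi0 := Nat.eq_zero_or_pos i
  · exact mem_of_sq_mem_of_isHomogeneous_zero hp hp2
  have hσU : σ ⊆ Δ.verts := subset_verts h.mem
  have hM := h.hasDualRows F σ (Finset.subset_insert _ _) hd.le
  obtain ⟨c, hc⟩ := h.exists_columnRelation F hd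
  obtain ⟨g, hg, -⟩ := h.exists_hahn_embedding F hd hc
  have hprod : ∏ w ∈ σ, c w ≠ 0 := Finset.prod_ne_zero_iff.mpr hc.apply_ne_zero
  let J := Δ.redIdeal Δ.verts (Δ'.genMatrix F d)
  let P := map (h.fieldInclusion F d) p
  -- `v` is not a vertex of `Δ`, so `X v ∈ J` and removing it changes nothing modulo `J`.
  let R := killVar (GenericField F Δ' d) v P
  let Q := R - C (eval c R) * X v ^ i
  have hR : R.IsHomogeneous i := killVar_isHomogeneous v (hp.map _)
  have hkill : ∀ q : MvPolynomial V (GenericField F Δ' d), q - killVar _ v q ∈ J := fun q => by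
    refine Ideal.mem_of_dvd _ (X_dvd_sub_killVar v q) ?_
    simpa using prod_X_mem_redIdeal (U := Δ.verts) (M := Δ'.genMatrix F d) h.notMem
  have hkR : killVar _ v R = R := by
    change ((killVar (GenericField F Δ' d) v).comp (killVar _ v)) P = killVar _ v P
    congr 1
    refine algHom_ext fun w => ?_
    by_cases hw : w = v
    · simp [killVar, hw]
    · simp [killVar, hw]
  have hkQ : killVar _ v Q = R := by
    rw [map_sub, map_mul, map_pow, killVar_X_self, zero_pow hi0.ne', mul_zero, sub_zero, hkR]
  have hlQ : lineMap c Q = 0 := by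
    rw [map_sub, lineMap_of_isHomogeneous c hR, map_mul, map_pow, lineMap_X, lineMap_C,
      hc.apply_self, Polynomial.C_1, one_mul, sub_self]
  have hQ : Q.IsHomogeneous i := by
    refine hR.sub ?_
    have := (isHomogeneous_X_pow (R := GenericField F Δ' d) v i).C_mul (eval c R)
    exact this
  have hP2 : P ^ 2 ∈ J := by
    have := Ideal.mem_map_of_mem (map (h.fieldInclusion F d)) hp2
    rwa [h.map_genIdeal, map_pow] at this
  have hR2 : R ^ 2 ∈ J := by
    have := sub_mem hP2 (hkill (P ^ 2))
    rwa [sub_sub_cancel, map_pow] at this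
  have hQ2 : Q ^ 2 ∈ Δ'.genIdeal F d := by
    rw [genIdeal, h.verts_eq]
    refine h.mem_of_killVar_mem hd hσU h.notMem_verts hM hc ?_ ?_
    · rwa [map_pow, hkQ]
    · rw [map_pow, hlQ, zero_pow two_ne_zero]
      exact dvd_zero _
  have hQJ := hani i hi Q hQ hQ2
  rw [genIdeal, h.verts_eq] at hQJ
  obtain ⟨s, hs1, hs2⟩ := h.exists_of_mem hd hσU h.notMem_verts hM hc hQJ
  -- The line component of `Q` is zero by construction, and `s` is read off from it since `∏ c_w ≠
  -- 0`.
  have hs : s = 0 := by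
    rw [hlQ] at hs2
    have := eq_of_X_pow_dvd (a := 0) (b := s * ∏ w ∈ σ, c w) (by simpa using hs2)
    exact (mul_eq_zero.mp this.symm).resolve_right hprod
  rw [hs, C_0, zero_mul, sub_zero, hkQ] at hs1
  have hPJ : P ∈ J := by
    have := add_mem (hkill P) hs1
    rwa [sub_add_cancel] at this
  change P ∈ Δ.redIdeal Δ.verts (Δ'.genMatrix F d) at hPJ
  rw [← h.map_genIdeal] at hPJ
  exact mem_of_map_mem_map g hg hPJ

/-- If a facet monomial of `Δ'` vanished, the line component would determine the scalar `t`. For a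
facet through `v` it is nonzero, which forces `x_σ = 0` in `A_K`. For an old facet other than `σ` it
is zero, which forces that monomial to vanish in `A_K`. -/
theorem facetsNeZero (h : IsFacetSubdivision Δ Δ' σ v) (F : Type*) [Field F] {d : ℕ}
    (hd : σ.card = d) (hΔ : FacetsNeZero F Δ d) : FacetsNeZero F Δ' d := by
  intro s hs hsd hmem
  have hσU : σ ⊆ Δ.verts := subset_verts h.mem
  have hM := h.hasDualRows F σ (Finset.subset_insert _ _) hd.le
  obtain ⟨c, hc⟩ := h.exists_columnRelation F hd
  obtain ⟨g, hg, -⟩ := h.exists_hahn_embedding F hd hc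
  have hprod : ∏ w ∈ σ, c w ≠ 0 := Finset.prod_ne_zero_iff.mpr hc.apply_ne_zero
  rw [genIdeal, h.verts_eq] at hmem
  obtain ⟨t, ht1, ht2⟩ := h.exists_of_mem hd hσU h.notMem_verts hM hc hmem
  rw [lineMap_prod_X, hsd] at ht2
  have ht := eq_of_X_pow_dvd ht2
  have hne : ∀ s ∈ Δ.faces, s.card = d →
      (∏ w ∈ s, X w : MvPolynomial V (GenericField F Δ' d)) ∉
      Δ.redIdeal Δ.verts (Δ'.genMatrix F d) := by
    intro s hs hsd hmem
    refine hΔ s hs hsd (mem_of_map_mem_map g hg ?_)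
    rw [h.map_genIdeal]
    simpa using hmem
  by_cases hv : v ∈ s
  · rw [killVar_prod_X_of_mem _ hv, zero_sub, neg_mem_iff] at ht1
    have hsub : s.erase v ⊂ σ := by
      rwa [← Finset.insert_erase hv, h.insert_mem_iff _ (Finset.notMem_erase v s)] at hs
    have ht0 : t ≠ 0 := by
      rintro rfl
      rw [zero_mul, ← Finset.mul_prod_erase s _ hv, hc.apply_self, one_mul,
        Finset.prod_eq_zero_iff] at ht
      obtain ⟨w, hw, hw0⟩ := ht
      exact hc.apply_ne_zero w (hsub.1 hw) hw0
    have := Ideal.mul_mem_left _ (C t⁻¹) ht1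
    rw [← mul_assoc, ← C_mul, inv_mul_cancel₀ ht0, C_1, one_mul] at this
    exact hne σ h.mem hd this
  · obtain ⟨hsΔ, hsσ⟩ := (h.mem_iff s hv).mp hs
    rw [prod_eq_zero_of_not_subset hc hv fun hsub => hsσ
      (Finset.eq_of_subset_of_card_le hsub (by omega)), eq_comm, mul_eq_zero] at ht
    rw [killVar_prod_X _ hv, ht.resolve_right hprod, C_0, zero_mul, sub_zero] at ht1
    exact hne s hsΔ hsd ht1

end IsFacetSubdivision

/-! ### The boundary of a simplex -/

section

variable {V : Type*} [LinearOrder V]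

lemma rank_simplexBoundary {S : Finset V} (hS : S.Nonempty) {d : ℕ} (hd : S.card = d + 1) :
    (simplexBoundary S hS).rank = d := by
  refine le_antisymm (Finset.sup_le fun s hs => ?_) ?_
  · have := Finset.card_lt_card (Finset.mem_ssubsets.mp hs)
    omega
  · obtain ⟨v, hv⟩ := hS
    have := card_le_rank (Δ := simplexBoundary S ⟨v, hv⟩) (s := S.erase v)
      (Finset.mem_ssubsets.mpr (Finset.erase_ssubset hv))
    rwa [Finset.card_erase_of_mem hv, hd] at this

/-- The reduction is `K[t]/(t^(d+1))`: the `d` generic forms in `d + 1` variables leave the line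
spanned by the column relation, and the only relation left is the non-face `S`. -/
lemma exists_mem_genIdeal_simplexBoundary_iff (F : Type*) [Field F] {S : Finset V}
    (hS : S.Nonempty) {d : ℕ} (hd : S.card = d + 1) (hd0 : d ≠ 0) :
    ∃ c : V → GenericField F (simplexBoundary S hS) d, (∀ w ∈ S, c w ≠ 0) ∧
      ∀ p, p ∈ (simplexBoundary S hS).genIdeal F d ↔ Polynomial.X ^ (d + 1) ∣ lineMap c p := by
  set Δ := simplexBoundary S hS with hΔ
  have hfaces : ∀ s, s ∈ Δ.faces ↔ s ⊂ S := fun s => Finset.mem_ssubsets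
  obtain ⟨v, hv⟩ := id hS
  set σ := S.erase v with hσ
  have hvσ : v ∉ σ := Finset.notMem_erase v S
  have hσd : σ.card = d := by rw [hσ, Finset.card_erase_of_mem hv, hd]; rfl
  have hins : insert v σ = S := Finset.insert_erase hv
  -- For `d = 0` this fails: the boundary of a point has no vertices.
  have hverts : Δ.verts = S := by
    ext w
    rw [mem_verts, hfaces]
    refine ⟨fun h => Finset.singleton_subset_iff.mp h.1, fun h =>
      Finset.ssubset_iff_subset_ne.mpr ⟨Finset.singleton_subset_iff.mpr h, fun he => hd0 ?_⟩⟩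
    rw [← he, Finset.card_singleton] at hd
    omega
  have hM : ∀ τ ⊆ insert v σ, τ.card ≤ d → HasDualRows (Δ.genMatrix F d) τ := fun τ hτ hc =>
    hasDualRows_genMatrix F Δ (by rwa [hverts, ← hins]) hc
  obtain ⟨c, hc⟩ := exists_isColumnRelation hσd le_rfl hvσ hM
  have hc0 : ∀ w ∈ S, c w ≠ 0 := fun w hw => by
    by_cases hwv : w = v
    · rw [hwv, hc.apply_self]
      exact one_ne_zero
    · exact hc.apply_ne_zero w (Finset.mem_erase.mpr ⟨hwv, hw⟩)
  have hcS : ∀ w ∉ S, c w = 0 := fun w hw =>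
    hc.apply_of_notMem w (fun h => hw (Finset.mem_of_mem_erase h)) fun h => hw (h ▸ hv)
  refine ⟨c, hc0, fun p => ?_⟩
  rw [genIdeal, hverts]
  have hsum := hc.sum_eq_zero
  rw [hins] at hsum
  constructor
  · suffices hle : Δ.redIdeal S (Δ.genMatrix F d) ≤
        (Ideal.span {Polynomial.X ^ (d + 1)}).comap (lineMap c) from fun hp =>
      Ideal.mem_span_singleton.mp (hle hp)
    refine redIdeal_le (fun s hs => ?_) fun i => ?_
    · rw [Ideal.mem_comap, Ideal.mem_span_singleton, lineMap_prod_X]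
      by_cases hsS : s ⊆ S
      · have : s = S := by
          by_contra hne
          exact hs ((hfaces s).mpr (lt_of_le_of_ne hsS hne))
        rw [this, hd]
        exact Dvd.intro_left _ rfl
      · obtain ⟨w, hw, hwS⟩ := Finset.not_subset.mp hsS
        rw [Finset.prod_eq_zero hw (hcS w hwS)]
        simp
    · rw [Ideal.mem_comap, lineMap_form, hsum, map_zero, zero_mul]
      exact zero_mem _
  · intro hp
    set J := Δ.redIdeal S (Δ.genMatrix F d)
    let ψ : Polynomial (GenericField F Δ d) →ₐ[GenericField F Δ d]
      MvPolynomial V (GenericField F Δ d) := Polynomial.aeval (X v)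
    have hψX : ψ Polynomial.X = X v := Polynomial.aeval_X _
    have hψC : ∀ a, ψ (Polynomial.C a) = C a := fun a => Polynomial.aeval_C _ _
    have hX : ∀ w, X w - C (c w) * X v ∈ J := by
      intro w
      by_cases hwv : w = v
      · rw [hwv, hc.apply_self]
        simp
      by_cases hw : w ∈ S
      swap
      · rw [hcS w hw, C_0, zero_mul, sub_zero]
        simpa using prod_X_mem_redIdeal (s := {w}) (U := S) (M := Δ.genMatrix F d) fun hf =>
          hw (Finset.singleton_subset_iff.mp ((hfaces _).mp hf).1)
      have hwσ : w ∈ σ := Finset.mem_erase.mpr ⟨hwv, hw⟩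
      obtain ⟨r, hr⟩ := hM σ (Finset.subset_insert _ _) hσd.le w hwσ
      have hrv : ∑ i, r i * Δ.genMatrix F d i v = - c w := by
        have h0 : ∑ j ∈ S, (∑ i, r i * Δ.genMatrix F d i j) * c j = 0 := by
          simp only [Finset.sum_mul]
          rw [Finset.sum_comm]
          refine Finset.sum_eq_zero fun i _ => ?_
          simp only [mul_assoc, ← Finset.mul_sum, hsum, mul_zero]
        rw [← hins, Finset.sum_insert hvσ, hc.apply_self, mul_one,
          Finset.sum_congr (s₁ := σ) rfl fun j hj => by rw [hr j hj]] at h0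
        simp only [ite_mul, one_mul, zero_mul, Finset.sum_ite_eq', hwσ, if_true] at h0
        exact eq_neg_of_add_eq_zero_left h0
      have hcomb := combination_mem_redIdeal Δ S (Δ.genMatrix F d) r
      rw [← hins, Finset.sum_insert hvσ, hrv,
        Finset.sum_congr (s₁ := σ) rfl fun j hj => by rw [hr j hj]] at hcomb
      simp only [apply_ite C, C_0, C_1, ite_mul, one_mul, zero_mul, Finset.sum_ite_eq', hwσ,
        if_true, hins] at hcomb
      convert hcomb using 1
      rw [C_neg]
      ring
    have hline : ∀ q, q - ψ (lineMap c q) ∈ J := by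
      intro q
      induction q using MvPolynomial.induction_on with
      | C a => simp [hψC]
      | add p q hp hq =>
        convert add_mem hp hq using 1
        rw [map_add, map_add]
        ring
      | mul_X p w hp =>
        convert add_mem (Ideal.mul_mem_left _ (X w) hp)
          (Ideal.mul_mem_left _ (ψ (lineMap c p)) (hX w)) using 1
        rw [map_mul, map_mul, lineMap_X, map_mul, hψX, hψC]
        ring
    have hpow : (X v ^ (d + 1) : MvPolynomial V (GenericField F Δ d)) ∈ J := by
      have hl := sub_mem (prod_X_mem_redIdeal (U := S) (M := Δ.genMatrix F d) (s := S)
        fun hf => ssubset_irrefl S ((hfaces S).mp hf)) (hline (∏ w ∈ S, X w))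
      rw [sub_sub_cancel, lineMap_prod_X, map_mul, hψC, map_pow, hψX, hd] at hl
      have hne : ∏ w ∈ S, c w ≠ 0 := Finset.prod_ne_zero_iff.mpr hc0
      have := Ideal.mul_mem_left _ (C (∏ w ∈ S, c w)⁻¹) hl
      rwa [← mul_assoc, ← C_mul, inv_mul_cancel₀ hne, C_1, one_mul] at this
    obtain ⟨u, hu⟩ := hp
    have h3 : ψ (lineMap c p) ∈ J := by
      rw [hu, map_mul, map_pow, hψX]
      exact Ideal.mul_mem_right _ _ hpow
    have := add_mem (hline p) h3
    rwa [sub_add_cancel] at this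

lemma isAnisotropicIdeal_simplexBoundary (F : Type*) [Field F] {S : Finset V}
    (hS : S.Nonempty) {d : ℕ} (hd : S.card = d + 1) (hd0 : d ≠ 0) :
    IsAnisotropicIdeal ((simplexBoundary S hS).genIdeal F d) d := by
  obtain ⟨c, -, hc⟩ := exists_mem_genIdeal_simplexBoundary_iff F hS hd hd0
  intro i hi p hp hp2
  rw [hc, lineMap_of_isHomogeneous c hp] at *
  rw [map_pow, lineMap_of_isHomogeneous c hp, mul_pow, ← map_pow, ← pow_mul,
    Polynomial.X_pow_dvd_iff] at hp2
  have h := hp2 (i * 2) (by omega)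
  rw [Polynomial.coeff_C_mul_X_pow, if_pos rfl, pow_eq_zero_iff two_ne_zero] at h
  rw [h]
  simp

lemma facetsNeZero_simplexBoundary (F : Type*) [Field F] {S : Finset V}
    (hS : S.Nonempty) {d : ℕ} (hd : S.card = d + 1) (hd0 : d ≠ 0) :
    FacetsNeZero F (simplexBoundary S hS) d := by
  obtain ⟨c, hc0, hc⟩ := exists_mem_genIdeal_simplexBoundary_iff F hS hd hd0
  intro s hs hsd hmem
  rw [hc, lineMap_prod_X, Polynomial.X_pow_dvd_iff] at hmem
  have h := hmem d (by omega)
  rw [hsd, Polynomial.coeff_C_mul_X_pow, if_pos rfl, Finset.prod_eq_zero_iff] at h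
  obtain ⟨w, hw, h0⟩ := h
  exact hc0 w ((Finset.mem_ssubsets.mp hs).1 hw) h0

/-! ### Bistellar moves and stacked spheres -/

/-- A bistellar `0`-move on a complex of rank at least two is the subdivision of a facet. -/
lemma IsBistellarMove.exists_isFacetSubdivision {Δ Δ' : FinSimplicialComplex V}
    (h : IsBistellarMove 0 Δ Δ') (h2 : 2 ≤ Δ.rank) :
    ∃ σ v, σ.card = Δ.rank ∧ IsFacetSubdivision Δ Δ' σ v := by
  obtain ⟨-, σ, τ, hσ, -, hcard, hτ, hτΔ, hlink, hmem⟩ := h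
  rw [zero_add, Finset.card_eq_one] at hτ
  obtain ⟨v, rfl⟩ := hτ
  rw [add_zero] at hcard
  have hfacet : ∀ s ∈ Δ.faces, σ ⊆ s → s = σ := fun s hs hsub =>
    (Finset.eq_of_subset_of_card_le hsub ((card_le_rank hs).trans hcard.ge)).symm
  have hun : ∀ s, s ∪ σ ∈ Δ.faces ↔ s ⊆ σ := fun s =>
    ⟨fun hs => by
      rw [← hfacet _ hs Finset.subset_union_right]
      exact Finset.subset_union_left,
    fun hs => by rwa [Finset.union_eq_right.mpr hs]⟩
  have hvσ : v ∉ σ := fun hv => hτΔ (Δ.down_closed σ hσ _ (Finset.singleton_subset_iff.mpr hv))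
  refine ⟨σ, v, hcard, hσ, hfacet, hτΔ, by omega, fun s hv => ?_, fun s hv => ?_⟩
  · rw [hmem, hun]
    constructor
    · rintro (⟨hs, hsσ⟩ | ⟨a, b, ha, hb, rfl⟩)
      · exact ⟨hs, fun he => hsσ he.subset⟩
      · obtain rfl | rfl := Finset.subset_singleton_iff.mp hb
        · rw [Finset.union_empty]
          exact ⟨Δ.down_closed σ hσ _ ha.1, ha.ne⟩
        · exact absurd (Finset.mem_union_right _ (Finset.mem_singleton_self v)) hv
    · rintro ⟨hs, hsσ⟩
      by_cases hsub : s ⊆ σ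
      · exact Or.inr ⟨s, ∅, lt_of_le_of_ne hsub hsσ, Finset.empty_subset _, by simp⟩
      · exact Or.inl ⟨hs, hsub⟩
  · rw [hmem]
    constructor
    · rintro (⟨hs, -⟩ | ⟨a, b, ha, hb, hab⟩)
      · exact absurd (Δ.down_closed _ hs _ (Finset.singleton_subset_iff.mpr
          (Finset.mem_insert_self v s))) hτΔ
      · have hva : v ∉ a := fun h => hvσ (ha.1 h)
        have : s = a := by
          rw [← Finset.erase_insert hv, hab]
          ext w
          obtain rfl | rfl := Finset.subset_singleton_iff.mp hb
          · simp only [Finset.union_empty, Finset.mem_erase, and_iff_right_iff_imp]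
            exact fun hw h => hva (h ▸ hw)
          · simp only [Finset.mem_erase, Finset.mem_union, Finset.mem_singleton]
            constructor
            · rintro ⟨h1, h2 | h2⟩
              · exact h2
              · exact absurd h2 h1
            · exact fun hw => ⟨fun h => hva (h ▸ hw), Or.inl hw⟩
        rwa [this]
    · intro hs
      exact Or.inr ⟨s, {v}, hs, le_rfl, by rw [Finset.union_comm]; rfl⟩

lemma IsBistellarMove.rank_le {Δ Δ' : FinSimplicialComplex V}
    (h : IsBistellarMove 0 Δ Δ') : Δ'.rank ≤ Δ.rank := by
  obtain ⟨-, σ, τ, hσ, -, hcard, hτ, -, -, hmem⟩ := h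
  refine Finset.sup_le fun s hs => ?_
  obtain ⟨hs, -⟩ | ⟨a, b, ha, hb, rfl⟩ := (hmem s).mp hs
  · exact card_le_rank hs
  · have h1 := Finset.card_union_le a b
    have h2 := Finset.card_lt_card ha
    have h3 := Finset.card_le_card hb
    omega

/-- Nonvanishing of the facet monomials is part of the induction because the even case of each
subdivision consumes it. It takes the place of the homology of `Δ`. -/
theorem IsStackedSphere.isAnisotropicIdeal (F : Type*) [Field F] {d : ℕ} (hd : 2 ≤ d)
    {Δ : FinSimplicialComplex V} (h : IsStackedSphere d Δ) :
    Δ.rank = d ∧ IsAnisotropicIdeal (Δ.genIdeal F d) d ∧ FacetsNeZero F Δ d := by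
  induction h with
  | boundary S hS hSd =>
    exact ⟨rank_simplexBoundary hS hSd, isAnisotropicIdeal_simplexBoundary F hS hSd (by omega),
      facetsNeZero_simplexBoundary F hS hSd (by omega)⟩
  | move Δ Δ' _ hm ih =>
    obtain ⟨hr, hani, hf⟩ := ih
    obtain ⟨σ, v, hσ, hs⟩ := IsBistellarMove.exists_isFacetSubdivision hm (by omega)
    rw [hr] at hσ
    exact ⟨(hs.rank_eq (by omega)).trans hσ,
      hs.isAnisotropicIdeal F hσ hani fun _ => hf σ hs.mem hσ, hs.facetsNeZero F hσ hf⟩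

lemma IsStackedSphere.rank_le {d : ℕ} {Δ : FinSimplicialComplex V} (h : IsStackedSphere d Δ) :
    Δ.rank ≤ d := by
  induction h with
  | boundary S hS hSd => exact (rank_simplexBoundary hS hSd).le
  | move Δ Δ' _ hm ih => exact (IsBistellarMove.rank_le hm).trans ih

theorem IsStackedSphere.genericallyAnisotropic (F : Type*) [Field F] {d : ℕ}
    {Δ : FinSimplicialComplex V} (h : IsStackedSphere d Δ) : Δ.GenericallyAnisotropic F := by
  by_cases hd : 2 ≤ d
  · obtain ⟨hr, hani, -⟩ := h.isAnisotropicIdeal F hd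
    exact (genericallyAnisotropic_iff F Δ hr).mpr hani
  · exact genericallyAnisotropic_of_rank_le_one F Δ (h.rank_le.trans (by omega))

end

end FinSimplicialComplex
end

noncomputable section
namespace FinSimplicialComplex

/-! ### Low-degree homology -/

section

variable {V : Type*} [LinearOrder V] {K : Type*} [Field K]

/-- The face given by a vertex. -/
def vertFace {W : Type*} {Δ : FinSimplicialComplex W} {a : W} (ha : {a} ∈ Δ.faces) : Δ.Face 1 :=
  ⟨{a}, Finset.mem_filter.mpr ⟨ha, Finset.card_singleton a⟩⟩

lemma vertFace_ne {W : Type*} {Δ : FinSimplicialComplex W} {a b : W} (ha : {a} ∈ Δ.faces)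
    (hb : {b} ∈ Δ.faces) (hab : a ≠ b) : vertFace ha ≠ vertFace hb := fun h =>
  hab (Finset.singleton_injective (congrArg Subtype.val h))

lemma boundary_apply (Δ : FinSimplicialComplex V) (n : ℕ) (c : Δ.Chain K (n + 1)) :
    Δ.boundary K n c = ∑ s, c s • ∑ v : {v // v ∈ s.1},
      (Pi.single (s.erase v) ((-1 : K) ^ (s.1.filter (fun w => w < v.1)).card) : Δ.Chain K n) := by
  rw [boundary, Fintype.linearCombination_apply]

lemma boundary_zero_apply (Δ : FinSimplicialComplex V) (c : Δ.Chain K 1) (e : Δ.Face 0) :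
    Δ.boundary K 0 c e = ∑ s, c s := by
  rw [boundary_apply, Finset.sum_apply]
  refine Finset.sum_congr rfl fun s _ => ?_
  obtain ⟨a, ha⟩ := Finset.card_eq_one.mp (Finset.mem_filter.mp s.2).2
  have hmem : ∀ x ∈ s.1, x = a := fun x hx => Finset.mem_singleton.mp (ha ▸ hx)
  have : Unique {v // v ∈ s.1} :=
    { default := ⟨a, by rw [ha]; exact Finset.mem_singleton_self a⟩
      uniq := fun x => Subtype.ext (hmem x.1 x.2) }
  rw [Fintype.sum_unique, Pi.smul_apply, smul_eq_mul]
  have he : e = s.erase default := by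
    have h0 : ∀ f : Δ.Face 0, f.1 = ∅ := fun f =>
      Finset.card_eq_zero.mp (Finset.mem_filter.mp f.2).2
    exact Subtype.ext ((h0 _).trans (h0 _).symm)
  rw [he, Pi.single_eq_same, Finset.filter_eq_empty_iff.mpr, Finset.card_empty, pow_zero, mul_one]
  intro w hw
  rw [hmem w hw, hmem _ (default : {v // v ∈ s.1}).2]
  exact lt_irrefl a

lemma single_sub_single_mem_cycles {Δ : FinSimplicialComplex V} {a b : V} (ha : {a} ∈ Δ.faces)
    (hb : {b} ∈ Δ.faces) :
    (Pi.single (vertFace ha) 1 - Pi.single (vertFace hb) 1 : Δ.Chain K 1) ∈ Δ.cycles K 1 := by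
  change _ ∈ LinearMap.ker (Δ.boundary K 0)
  rw [LinearMap.mem_ker]
  ext e
  rw [boundary_zero_apply]
  simp

lemma sum_sign_pair {s : Finset V} (hs : s.card = 2) :
    ∑ v : {v // v ∈ s}, (-1 : K) ^ (s.filter (fun w => w < v.1)).card = 0 := by
  rw [Finset.sum_coe_sort s fun v => (-1 : K) ^ (s.filter (fun w => w < v)).card]
  obtain ⟨x, y, hxy, rfl⟩ : ∃ x y, x < y ∧ s = {x, y} := by
    obtain ⟨x, y, hne, rfl⟩ := Finset.card_eq_two.mp hs
    rcases lt_or_gt_of_ne hne with h | h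
    · exact ⟨x, y, h, rfl⟩
    · exact ⟨y, x, h, Finset.pair_comm x y⟩
  rw [Finset.sum_pair hxy.ne]
  have h1 : ({x, y} : Finset V).filter (fun w => w < x) = ∅ := by
    ext w
    simp only [Finset.mem_filter, Finset.mem_insert, Finset.mem_singleton, Finset.notMem_empty,
      iff_false, not_and, not_lt]
    rintro (rfl | rfl)
    exacts [le_rfl, hxy.le]
  have h2 : ({x, y} : Finset V).filter (fun w => w < y) = {x} := by
    ext w
    simp only [Finset.mem_filter, Finset.mem_insert, Finset.mem_singleton]
    constructor
    · rintro ⟨rfl | rfl, h⟩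
      exacts [rfl, absurd h (lt_irrefl _)]
    · rintro rfl
      exact ⟨Or.inl rfl, hxy⟩
  rw [h1, h2]
  simp

/-- If the reduced homology in dimension `0` vanishes, a property of vertices that is propagated by
the edges holds for all vertices if it holds for one. -/
lemma of_finrank_eq_zero {Δ : FinSimplicialComplex V}
    (h : Module.finrank K (Δ.ReducedHomology K 1) = 0) {P : V → Prop}
    (hP : ∀ x y, x ≠ y → {x, y} ∈ Δ.faces → P x → P y) {a b : V} (ha : {a} ∈ Δ.faces)
    (hb : {b} ∈ Δ.faces) (hPa : P a) : P b := by
  classical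
  have hsub := Module.finrank_zero_iff.mp h
  have hmem := single_sub_single_mem_cycles (K := K) ha hb
  obtain ⟨c, hc⟩ : (Pi.single (vertFace ha) 1 - Pi.single (vertFace hb) 1 : Δ.Chain K 1) ∈
      LinearMap.range (Δ.boundary K 1) := by
    have := (Submodule.Quotient.mk_eq_zero _ (x := ⟨_, hmem⟩)).mp
      (Subsingleton.elim (α := Δ.ReducedHomology K 1) _ _)
    exact this
  -- The functional that sums coefficients over the vertices with `P` kills boundaries of edges:
  -- both ends of an edge count or neither does. On the cycle `a - b` it detects whether `P`
  -- separates `a` from `b`.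
  let ind : Δ.Face 1 → K := fun s => if ∃ x ∈ s.1, P x then 1 else 0
  have hb0 : ∑ s, Δ.boundary K 1 c s * ind s = 0 := by
    rw [boundary_apply]
    simp only [Finset.sum_apply, Finset.sum_mul, Pi.smul_apply, smul_eq_mul]
    rw [Finset.sum_comm]
    refine Finset.sum_eq_zero fun e _ => ?_
    have hcard := (Finset.mem_filter.mp e.2).2
    have hind : ∀ v : {v // v ∈ e.1}, ind (e.erase v) = if ∃ x ∈ e.1, P x then 1 else 0 := by
      intro v
      obtain ⟨x, y, hne, he⟩ := Finset.card_eq_two.mp hcard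
      have hxy : {x, y} ∈ Δ.faces := he ▸ (Finset.mem_filter.mp e.2).1
      have hyx : {y, x} ∈ Δ.faces := Finset.pair_comm x y ▸ hxy
      simp only [ind]
      congr 1
      rw [eq_iff_iff]
      constructor
      · rintro ⟨w, hw, hPw⟩
        exact ⟨w, Finset.mem_of_mem_erase hw, hPw⟩
      · rintro ⟨w, hw, hPw⟩
        by_cases hwv : w = v.1
        · rw [he, Finset.mem_insert, Finset.mem_singleton] at hw
          rcases hw with rfl | rfl
          · exact ⟨y, Finset.mem_erase.mpr ⟨fun h => hne (hwv.trans h.symm), by simp [he]⟩,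
              hP _ _ hne hxy hPw⟩
          · exact ⟨x, Finset.mem_erase.mpr ⟨fun h => hne (h.trans hwv.symm), by simp [he]⟩,
              hP _ _ hne.symm hyx hPw⟩
        · exact ⟨w, Finset.mem_erase.mpr ⟨hwv, hw⟩, hPw⟩
    simp only [mul_assoc, ← Finset.mul_sum]
    convert mul_zero (c e)
    simp only [Finset.sum_mul]
    rw [Finset.sum_comm]
    have : ∀ v : {v // v ∈ e.1}, ∑ s, (Pi.single (e.erase v)
        ((-1 : K) ^ (e.1.filter (fun w => w < v.1)).card) : Δ.Chain K 1) s * ind s =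
        (-1 : K) ^ (e.1.filter (fun w => w < v.1)).card * if ∃ x ∈ e.1, P x then 1 else 0 := by
      intro v
      rw [Finset.sum_eq_single (e.erase v), Pi.single_eq_same, hind v]
      · intro s _ hs
        rw [Pi.single_eq_of_ne hs, zero_mul]
      · exact fun h => absurd (Finset.mem_univ _) h
    rw [Finset.sum_congr rfl fun v _ => this v, ← Finset.sum_mul, sum_sign_pair hcard, zero_mul]
  rw [hc] at hb0
  simp only [Pi.sub_apply, sub_mul, Finset.sum_sub_distrib, Pi.single_apply, ite_mul, one_mul,
    zero_mul, Finset.sum_ite_eq', Finset.mem_univ, if_true] at hb0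
  have h1 : ind (vertFace ha) = 1 := if_pos ⟨a, Finset.mem_singleton_self a, hPa⟩
  by_contra hPb
  have h2 : ind (vertFace hb) = 0 := if_neg fun ⟨x, hx, hPx⟩ =>
    hPb (Finset.mem_singleton.mp hx ▸ hPx)
  rw [h1, h2, sub_zero] at hb0
  exact one_ne_zero hb0

lemma range_boundary_eq_bot {Δ : FinSimplicialComplex V} {n : ℕ}
    (h : ∀ s ∈ Δ.faces, s.card ≠ n + 1) : LinearMap.range (Δ.boundary K n) = ⊥ := by
  have : IsEmpty (Δ.Face (n + 1)) := ⟨fun s => h _ (Finset.mem_filter.mp s.2).1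
    (Finset.mem_filter.mp s.2).2⟩
  rw [LinearMap.range_eq_bot]
  ext s
  exact isEmptyElim s

/-- A complex without edges with the reduced homology of the `0`-sphere has at most two
vertices. -/
lemma eq_or_eq_of_finrank_eq_one {Δ : FinSimplicialComplex V}
    (h : Module.finrank K (Δ.ReducedHomology K 1) = 1) (h2 : ∀ s ∈ Δ.faces, s.card ≠ 2)
    {a b j : V} (ha : {a} ∈ Δ.faces) (hb : {b} ∈ Δ.faces) (hj : {j} ∈ Δ.faces) (hab : a ≠ b) :
    j = a ∨ j = b := by
  by_contra! hne
  obtain ⟨hja, hjb⟩ := hne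
  obtain ⟨w, hw⟩ := finrank_le_one_iff.mp h.le
  -- `a - b` and `a - j` are independent cycles. Without edges there are no boundaries, so they stay
  -- independent in homology.
  let z₁ : Δ.cycles K 1 := ⟨_, single_sub_single_mem_cycles (K := K) ha hb⟩
  let z₂ : Δ.cycles K 1 := ⟨_, single_sub_single_mem_cycles (K := K) ha hj⟩
  let π := ((LinearMap.range (Δ.boundary K 1)).submoduleOf (Δ.cycles K 1)).mkQ
  obtain ⟨c₁, h₁⟩ := hw (π z₁)
  obtain ⟨c₂, h₂⟩ := hw (π z₂)
  have hπ : ∀ z : Δ.cycles K 1, π z = 0 → z.1 = 0 := by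
    intro z hz
    have := (Submodule.Quotient.mk_eq_zero _).mp hz
    rw [range_boundary_eq_bot h2] at this
    exact this
  have h3 : π (c₂ • z₁ - c₁ • z₂) = 0 := by
    rw [map_sub, map_smul, map_smul, ← h₁, ← h₂, smul_comm, sub_self]
  have h4 := hπ _ h3
  have hb' := congrFun h4 (vertFace hb)
  have hj' := congrFun h4 (vertFace hj)
  have hab' := vertFace_ne ha hb hab
  have haj' := vertFace_ne ha hj hja.symm
  have hbj' := vertFace_ne hb hj hjb.symm
  simp [z₁, z₂, hab'.symm, hbj'] at hb'
  simp [z₁, z₂, haj'.symm, hbj'.symm] at hj'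
  have h5 := hπ z₁ (by rw [← h₁, hj', zero_smul])
  have h6 := congrFun h5 (vertFace ha)
  simp [z₁, hab'] at h6

/-- If `a` were the only possible vertex, the augmentation would be injective and there would be no
nonzero cycle. -/
lemma exists_ne_of_finrank_eq_one {Δ : FinSimplicialComplex V}
    (h : Module.finrank K (Δ.ReducedHomology K 1) = 1) (a : V) : ∃ b ≠ a, {b} ∈ Δ.faces := by
  by_contra! hne
  have : Subsingleton (Δ.cycles K 1) := by
    refine ⟨fun x y => Subtype.ext (sub_eq_zero.mp ?_)⟩
    have hxy : x.1 - y.1 ∈ LinearMap.ker (Δ.boundary K 0) := sub_mem x.2 y.2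
    ext s
    have h0 := congrFun (LinearMap.mem_ker.mp hxy)
      ⟨∅, Finset.mem_filter.mpr ⟨Δ.empty_mem, Finset.card_empty⟩⟩
    rw [boundary_zero_apply, Finset.sum_eq_single s] at h0
    · exact h0
    · intro t _ hts
      refine absurd (Subtype.ext ?_) hts
      have h1 : ∀ u : Δ.Face 1, u.1 = {a} := fun u => by
        obtain ⟨b, hb⟩ := Finset.card_eq_one.mp (Finset.mem_filter.mp u.2).2
        by_contra hu
        exact hne b (fun hba => hu (by rw [hb, hba])) (hb ▸ (Finset.mem_filter.mp u.2).1)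
      rw [h1, h1]
    · exact fun h => absurd (Finset.mem_univ _) h
  have : Subsingleton (Δ.ReducedHomology K 1) :=
    (Submodule.Quotient.mk_surjective _).subsingleton
  rw [Module.finrank_zero_of_subsingleton] at h
  exact zero_ne_one h

lemma mem_link_singleton {Δ : FinSimplicialComplex V} {σ : Finset V} (hσ : σ ∈ Δ.faces) {a : V} :
    {a} ∈ (Δ.link σ hσ).faces ↔ insert a σ ∈ Δ.faces ∧ a ∉ σ := by
  simp only [link, Finset.mem_filter, Finset.disjoint_singleton_left]
  refine ⟨fun h => h.2, fun h => ⟨?_, h⟩⟩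
  exact Δ.down_closed _ h.1 _ (Finset.singleton_subset_iff.mpr (Finset.mem_insert_self a σ))

/-- The link of a face of maximal size is `{∅}`, whose homology sits in dimension `-1`. -/
lemma IsHomologySphere.eq_rank {d : ℕ} {Δ : FinSimplicialComplex V} (h : Δ.IsHomologySphere K d) :
    d = Δ.rank := by
  obtain ⟨σ, hσ, hr⟩ := Δ.exists_card_eq_rank
  by_contra hne
  have h0 := h σ hσ 0
  rw [if_neg (by omega)] at h0
  have hempty : ∀ s ∈ (Δ.link σ hσ).faces, s.card ≠ 0 + 1 := by
    intro s hs hc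
    obtain ⟨a, rfl⟩ := Finset.card_eq_one.mp hc
    obtain ⟨h1, h2⟩ := (mem_link_singleton hσ).mp hs
    have := card_le_rank h1
    rw [Finset.card_insert_of_notMem h2] at this
    omega
  have hsub := Module.finrank_zero_iff.mp h0
  let e : (Δ.link σ hσ).Face 0 :=
    ⟨∅, Finset.mem_filter.mpr ⟨(Δ.link σ hσ).empty_mem, Finset.card_empty⟩⟩
  have hz : (⟨Pi.single e 1, Submodule.mem_top⟩ : (Δ.link σ hσ).cycles K 0) ∈
      (LinearMap.range ((Δ.link σ hσ).boundary K 0)).submoduleOf ((Δ.link σ hσ).cycles K 0) :=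
    (Submodule.Quotient.mk_eq_zero _).mp
      (Subsingleton.elim (α := (Δ.link σ hσ).ReducedHomology K 0) _ _)
  rw [range_boundary_eq_bot hempty] at hz
  have h1 : (Pi.single e 1 : (Δ.link σ hσ).Chain K 0) = 0 := hz
  have h2 := congrFun h1 e
  rw [Pi.single_eq_same] at h2
  exact one_ne_zero h2

/-- The link of a codimension one face has no edges and the homology of the `0`-sphere. -/
lemma IsHomologySphere.eq_or_eq {d : ℕ} {Δ : FinSimplicialComplex V} (h : Δ.IsHomologySphere K d)
    {R : Finset V} (hR : R.card + 1 = d) {a b j : V} (ha : a ∉ R) (hb : b ∉ R) (hj : j ∉ R)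
    (haΔ : insert a R ∈ Δ.faces) (hbΔ : insert b R ∈ Δ.faces) (hjΔ : insert j R ∈ Δ.faces)
    (hab : a ≠ b) : j = a ∨ j = b := by
  have hRΔ : R ∈ Δ.faces := Δ.down_closed _ haΔ _ (Finset.subset_insert _ _)
  have h1 := h R hRΔ 1
  rw [if_pos (by omega)] at h1
  refine eq_or_eq_of_finrank_eq_one h1 (fun s hs hc => ?_) ((mem_link_singleton hRΔ).mpr ⟨haΔ, ha⟩)
    ((mem_link_singleton hRΔ).mpr ⟨hbΔ, hb⟩) ((mem_link_singleton hRΔ).mpr ⟨hjΔ, hj⟩) hab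
  simp only [link, Finset.mem_filter] at hs
  have := card_le_rank hs.2.1
  rw [Finset.card_union_of_disjoint hs.2.2, ← h.eq_rank] at this
  omega

lemma IsHomologySphere.exists_ne {d : ℕ} {Δ : FinSimplicialComplex V}
    (h : Δ.IsHomologySphere K d) {R : Finset V} (hR : R.card + 1 = d) (hRΔ : R ∈ Δ.faces) (a : V) :
    ∃ b ≠ a, b ∉ R ∧ insert b R ∈ Δ.faces := by
  have h1 := h R hRΔ 1
  rw [if_pos (by omega)] at h1
  obtain ⟨b, hba, hb⟩ := exists_ne_of_finrank_eq_one h1 a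
  obtain ⟨h2, h3⟩ := (mem_link_singleton hRΔ).mp hb
  exact ⟨b, hba, h3, h2⟩

/-- A homology sphere is strongly connected: a property of facets that is preserved when passing to
an adjacent facet holds for all facets if it holds for one. -/
theorem IsHomologySphere.of_adjacent {d : ℕ} {Δ : FinSimplicialComplex V}
    (h : Δ.IsHomologySphere K d) (hpure : Δ.IsPure) {P : Finset V → Prop}
    (hP : ∀ (R : Finset V) (a b : V), R.card + 1 = d → a ∉ R → b ∉ R → a ≠ b →
      insert a R ∈ Δ.faces → insert b R ∈ Δ.faces → P (insert a R) → P (insert b R))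
    {S T : Finset V} (hS : S ∈ Δ.faces) (hT : T ∈ Δ.faces) (hSd : S.card = d) (hTd : T.card = d)
    (hPS : P S) : P T := by
  have hrank := h.eq_rank
  have hfacet : ∀ s ∈ Δ.faces, ∃ t ∈ Δ.faces, s ⊆ t ∧ t.card = d := by
    intro s hs
    obtain ⟨t, hst, ht⟩ := Δ.faces.exists_le_maximal hs
    exact ⟨t, ht.prop, hst, hrank ▸ hpure t ht.prop fun u hu htu => (ht.eq_of_le hu htu).symm⟩
  -- Induction on the codimension `n` of a face `τ` common to both facets; for the empty face it is
  -- `d`.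
  suffices hh : ∀ (n : ℕ) (τ : Finset V), τ.card + n = d → ∀ S T : Finset V, S ∈ Δ.faces →
      T ∈ Δ.faces → S.card = d → T.card = d → τ ⊆ S → τ ⊆ T → P S → P T from
    hh d ∅ (by simp) S T hS hT hSd hTd (Finset.empty_subset _) (Finset.empty_subset _) hPS
  clear hS hT hSd hTd hPS S T
  intro n
  induction n with
  | zero =>
    intro τ hτ S T _ _ hSd hTd hτS hτT hPS
    rwa [← Finset.eq_of_subset_of_card_le hτT (by omega),
      Finset.eq_of_subset_of_card_le hτS (by omega)]
  | succ n ih =>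
    intro τ hτ S T hS hT hSd hTd hτS hτT hPS
    obtain ⟨a, haS, haτ⟩ : ∃ a ∈ S, a ∉ τ := by
      by_contra! hcon
      have := Finset.card_le_card (show S ⊆ τ from hcon)
      omega
    obtain ⟨b, hbT, hbτ⟩ : ∃ b ∈ T, b ∉ τ := by
      by_contra! hcon
      have := Finset.card_le_card (show T ⊆ τ from hcon)
      omega
    have haS' : insert a τ ⊆ S := Finset.insert_subset haS hτS
    have hbT' : insert b τ ⊆ T := Finset.insert_subset hbT hτT
    have hca := Finset.card_insert_of_notMem haτ
    have hcb := Finset.card_insert_of_notMem hbτ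
    obtain rfl | hn := Nat.eq_zero_or_pos n
    · have hSeq := Finset.eq_of_subset_of_card_le haS' (by omega)
      have hTeq := Finset.eq_of_subset_of_card_le hbT' (by omega)
      by_cases hab : a = b
      · rwa [← hTeq, ← hab, hSeq]
      · rw [← hTeq]
        rw [← hSeq] at hPS hS
        rw [← hTeq] at hT
        exact hP τ a b hτ haτ hbτ hab hS hT hPS
    · have hτΔ : τ ∈ Δ.faces := Δ.down_closed S hS τ hτS
      have h1 := h τ hτΔ 1
      rw [if_neg (by omega)] at h1
      -- The link of `τ` is connected. Along an edge `{x, y}` of it, a facet containing `τ`, `x` and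
      -- `y` passes the property on from `x` to `y`.
      have hQ := of_finrank_eq_zero h1 (P := fun x => x ∉ τ ∧ ∀ H ∈ Δ.faces, H.card = d →
        insert x τ ⊆ H → P H) (a := a) (b := b) ?_
        ((mem_link_singleton hτΔ).mpr ⟨Δ.down_closed S hS _ haS', haτ⟩)
        ((mem_link_singleton hτΔ).mpr ⟨Δ.down_closed T hT _ hbT', hbτ⟩)
        ⟨haτ, fun H hH hHd haH => ih (insert a τ) (by omega) S H hS hH hSd hHd haS' haH hPS⟩
      · exact hQ.2 T hT hTd hbT'
      · rintro x y - hxy ⟨hxτ, hx⟩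
        simp only [link, Finset.mem_filter, Finset.disjoint_insert_left,
          Finset.disjoint_singleton_left] at hxy
        obtain ⟨-, hun, -, hyτ⟩ := hxy
        obtain ⟨G, hG, hsub, hGd⟩ := hfacet _ hun
        have hcy := Finset.card_insert_of_notMem hyτ
        refine ⟨hyτ, fun H hH hHd hyH => ih (insert y τ) (by omega) G H hG hH hGd hHd ?_ hyH
          (hx G hG hGd ?_)⟩
        · exact fun z hz => hsub (by
            simp only [Finset.mem_insert, Finset.mem_union, Finset.mem_singleton] at hz ⊢
            tauto)
        · exact fun z hz => hsub (by
            simp only [Finset.mem_insert, Finset.mem_union, Finset.mem_singleton] at hz ⊢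
            tauto)

/-! ### Facet monomials of anisotropic homology spheres -/

/-- Multiply the dual row of `a` on `insert a R` by `x_R`. Only two facets contain `R`, so the
result expresses `x_a x_R` as a multiple of `x_b x_R`. -/
lemma mem_genIdeal_of_adjacent (F : Type*) [Field F] {d : ℕ} {Δ : FinSimplicialComplex V}
    (h : Δ.IsHomologySphere F d) {R : Finset V} {a b : V} (hR : R.card + 1 = d) (ha : a ∉ R)
    (hb : b ∉ R) (hab : a ≠ b) (haΔ : insert a R ∈ Δ.faces) (hbΔ : insert b R ∈ Δ.faces)
    (hmem : ∏ w ∈ insert b R, X w ∈ Δ.genIdeal F d) :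
    ∏ w ∈ insert a R, X w ∈ Δ.genIdeal F d := by
  obtain ⟨r, hr⟩ := hasDualRows_genMatrix F Δ (d := d) (subset_verts haΔ)
    (by rw [Finset.card_insert_of_notMem ha, hR]) a (Finset.mem_insert_self a R)
  have hav : a ∈ Δ.verts := subset_verts haΔ (Finset.mem_insert_self a R)
  have h2 := Ideal.mul_mem_right (∏ j ∈ R, X j) _
    (combination_mem_redIdeal Δ Δ.verts (Δ.genMatrix F d) r)
  rw [← Finset.add_sum_erase _ _ hav, hr a (Finset.mem_insert_self a R), if_pos rfl, C_1, one_mul,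
    add_mul] at h2
  rw [Finset.prod_insert ha]
  refine (Ideal.add_mem_iff_left _ ?_).mp h2
  rw [Finset.sum_mul]
  refine Ideal.sum_mem _ fun j hj => ?_
  by_cases hjR : j ∈ R
  · rw [hr j (Finset.mem_insert_of_mem hjR), if_neg (Finset.ne_of_mem_erase hj), C_0, zero_mul,
      zero_mul]
    exact zero_mem _
  · rw [mul_assoc, ← Finset.prod_insert hjR]
    refine Ideal.mul_mem_left _ _ ?_
    by_cases hjΔ : insert j R ∈ Δ.faces
    · rw [(h.eq_or_eq hR ha hb hjR haΔ hbΔ hjΔ hab).resolve_left (Finset.ne_of_mem_erase hj)]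
      exact hmem
    · exact prod_X_mem_redIdeal hjΔ

/-- Restriction to the line through the column relation on `σ ∪ {v}` kills the linear forms and
sends all non-faces to multiples of `t²`, but sends `X v` to `t`. -/
lemma X_notMem_genIdeal (F : Type*) [Field F] {d : ℕ} {Δ : FinSimplicialComplex V} {σ : Finset V}
    {v : V} (hσ : σ ∈ Δ.faces) (hd : σ.card = d) (hv : v ∈ Δ.verts) (hvσ : v ∉ σ) :
    X v ∉ Δ.genIdeal F d := by
  have hsub : insert v σ ⊆ Δ.verts := Finset.insert_subset hv (subset_verts hσ)
  obtain ⟨c, hc⟩ := exists_isColumnRelation (M := Δ.genMatrix F d) hd le_rfl hvσ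
    fun τ hτ hτd => hasDualRows_genMatrix F Δ (hτ.trans hsub) hτd
  have hle : Δ.genIdeal F d ≤ (Ideal.span {Polynomial.X ^ 2}).comap (lineMap c) := by
    refine redIdeal_le (fun s hs => ?_) fun i => ?_
    · rw [Ideal.mem_comap, Ideal.mem_span_singleton, lineMap_prod_X]
      by_cases h2 : 2 ≤ s.card
      · exact (pow_dvd_pow _ h2).mul_left _
      · have h0 : s.card ≠ 0 := fun h0 => hs (Finset.card_eq_zero.mp h0 ▸ Δ.empty_mem)
        have h1 : s.card = 1 := by omega
        obtain ⟨w, rfl⟩ := Finset.card_eq_one.mp h1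
        have hw : w ∉ insert v σ := fun hw => hs (mem_verts.mp (hsub hw))
        rw [Finset.mem_insert, not_or] at hw
        rw [Finset.prod_singleton, hc.apply_of_notMem w hw.2 hw.1]
        simp
    · rw [Ideal.mem_comap, lineMap_form, ← Finset.sum_subset hsub fun j _ hj => ?_,
        hc.sum_eq_zero, map_zero, zero_mul]
      · exact zero_mem _
      · rw [Finset.mem_insert, not_or] at hj
        rw [hc.apply_of_notMem j hj.2 hj.1, mul_zero]
  intro hmem
  have := Ideal.mem_span_singleton.mp (hle hmem)
  rw [lineMap_X, hc.apply_self, Polynomial.C_1, one_mul, Polynomial.X_pow_dvd_iff] at this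
  have h1 := this 1 one_lt_two
  rw [Polynomial.coeff_X_one] at h1
  exact one_ne_zero h1

/-- From a vanishing power `e`, anisotropy gives the vanishing power `⌈e / 2⌉`, and so on down to
the variable. Evenness of `d` ensures `2 ⌈e / 2⌉ ≤ d`. -/
lemma X_pow_notMem {W K' : Type*} [Field K'] {I : Ideal (MvPolynomial W K')} {d : ℕ}
    (hd : Even d) (hani : IsAnisotropicIdeal I d) {v : W} (hv : X v ∉ I) (e : ℕ) (he : e ≤ d) :
    X v ^ e ∉ I := by
  induction e using Nat.strong_induction_on with
  | _ e ih =>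
    intro hmem
    by_cases h1 : e ≤ 1
    · refine hv ?_
      have := Ideal.mul_mem_left _ (X v ^ (1 - e)) hmem
      rwa [← pow_add, Nat.sub_add_cancel h1, pow_one] at this
    · obtain ⟨k, hk⟩ := hd
      let f := (e + 1) / 2
      refine ih f (by omega) (by omega) (hani f (by omega) _ (isHomogeneous_X_pow v f) ?_)
      have := Ideal.mul_mem_left _ (X v ^ (f * 2 - e)) hmem
      rwa [← pow_add, Nat.sub_add_cancel (by omega), pow_mul] at this

/-- The degree `d` part is nonzero because it contains the `d`-th power of a nonzero variable. Facet
monomials span it, so one of them is nonzero, and strong connectedness spreads this to all facets.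
-/
theorem IsHomologySphere.facetsNeZero (F : Type*) [Field F] {d : ℕ} {Δ : FinSimplicialComplex V}
    (h : Δ.IsHomologySphere F d) (hpure : Δ.IsPure) (hd : Even d) (hd0 : d ≠ 0)
    (hani : IsAnisotropicIdeal (Δ.genIdeal F d) d) : FacetsNeZero F Δ d := by
  have hrank := h.eq_rank
  obtain ⟨σ, hσ, hσd⟩ := Δ.exists_card_eq_rank
  rw [← hrank] at hσd
  obtain ⟨a, ha⟩ : σ.Nonempty := Finset.card_pos.mp (by omega)
  have hcard := Finset.card_erase_add_one ha
  -- A vertex outside the facet `σ`, found across the ridge opposite to `a`.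
  obtain ⟨b, hba, hbR, hb⟩ := h.exists_ne (R := σ.erase a) (by omega)
    (Δ.down_closed σ hσ _ (Finset.erase_subset _ _)) a
  have hbσ : b ∉ σ := fun hbσ => hbR (Finset.mem_erase.mpr ⟨hba, hbσ⟩)
  have hX := X_notMem_genIdeal F hσ hσd (subset_verts hb (Finset.mem_insert_self _ _)) hbσ
  have hpow := X_pow_notMem hd hani hX d le_rfl
  obtain ⟨S, hS, hSd, hSmem⟩ : ∃ S ∈ Δ.faces, S.card = d ∧ ∏ w ∈ S, X w ∉ Δ.genIdeal F d := by
    by_contra! hcon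
    refine hpow ?_
    have hspan := monomial_mem_span Δ le_rfl (M := Δ.genMatrix F d) (fun τ hτ =>
      hasDualRows_genMatrix F Δ (subset_verts hτ) (hrank ▸ card_le_rank hτ)) (Finsupp.single b d)
    rw [X_pow_eq_monomial]
    have hle : (Δ.genIdeal F d).restrictScalars (GenericField F Δ d) ⊔
        Submodule.span (GenericField F Δ d) {p | ∃ τ ∈ Δ.faces,
          τ.card = (Finsupp.single b d).degree ∧ p = ∏ v ∈ τ, X v} ≤
        (Δ.genIdeal F d).restrictScalars (GenericField F Δ d) := by
      refine sup_le le_rfl (Submodule.span_le.mpr ?_)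
      rintro _ ⟨τ, hτ, hτd, rfl⟩
      exact hcon τ hτ (by simpa using hτd)
    exact hle hspan
  intro T hT hTd
  exact h.of_adjacent hpure (P := fun S => ∏ w ∈ S, X w ∉ Δ.genIdeal F d)
    (fun R a b hR ha hb hab haΔ hbΔ hPa hPb =>
      hPa (mem_genIdeal_of_adjacent F h hR ha hb hab haΔ hbΔ hPb)) hS hT hSd hTd hSmem

theorem genericallyAnisotropic_iff_of_isBistellarMove (F : Type*) [Field F] {d : ℕ}
    {Δ Δ' : FinSimplicialComplex V} (h : Δ.IsHomologySphere F d) (hm : IsBistellarMove 0 Δ Δ') :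
    Δ.GenericallyAnisotropic F ↔ Δ'.GenericallyAnisotropic F := by
  have hrank := h.eq_rank
  by_cases hd : 2 ≤ d
  · obtain ⟨σ, v, hσ, hs⟩ := IsBistellarMove.exists_isFacetSubdivision hm (by omega)
    rw [← hrank] at hσ
    rw [genericallyAnisotropic_iff F Δ hrank.symm,
      genericallyAnisotropic_iff F Δ' ((hs.rank_eq (by omega)).trans hσ)]
    exact ⟨fun hani => hs.isAnisotropicIdeal F hσ hani fun he =>
      h.facetsNeZero F hm.1 he (by omega) hani σ hs.mem hσ,
      fun hani => hs.isAnisotropicIdeal_of_subdivision F hσ hani⟩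
  · have := IsBistellarMove.rank_le hm
    exact iff_of_true (genericallyAnisotropic_of_rank_le_one F Δ (by omega))
      (genericallyAnisotropic_of_rank_le_one F Δ' (by omega))

end

end FinSimplicialComplex
end

noncomputable section
namespace FinSimplicialComplex

/-! ### Cycle graphs -/

/-- `A` is the adjacency relation of a cycle: all degrees are two, and it is minimal among the
nonempty relations without vertices of degree one. -/
structure IsCycleRel {V : Type*} (A : V → V → Prop) : Prop where
  symm : ∀ x y, A x y → A y x
  irrefl : ∀ x, ¬ A x x
  two : ∀ x y, A x y → ∃ z, z ≠ y ∧ A x z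
  le_two : ∀ x a b c, A x a → A x b → A x c → a = b ∨ a = c ∨ b = c
  minimal : ∀ E : V → V → Prop, (∀ x y, E x y → A x y) → (∀ x y, E x y → E y x) →
    (∃ x y, E x y) → (∀ x y, E x y → ∃ z, z ≠ y ∧ E x z) → ∀ x y, A x y → E x y

/-- Contracting a path of length two in a cycle. -/
lemma IsCycleRel.contract {V : Type*} {A : V → V → Prop} (h : IsCycleRel A) {v a b : V}
    (ha : A v a) (hb : A v b) (hab : a ≠ b) (hn : ¬ A a b) :
    IsCycleRel fun x y => (A x y ∧ x ≠ v ∧ y ≠ v) ∨ (x = a ∧ y = b) ∨ (x = b ∧ y = a) := by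
  have hs := h.symm
  have hi := h.irrefl
  have hva : a ≠ v := fun e => hi v (by rwa [e] at ha)
  have hvb : b ≠ v := fun e => hi v (by rwa [e] at hb)
  have hv : ∀ x, A x v → x = a ∨ x = b := fun x hx => by
    have := h.le_two v a b x ha hb (hs _ _ hx)
    tauto
  have hn' : ¬ A b a := fun e => hn (hs _ _ e)
  refine ⟨?_, ?_, ?_, ?_, ?_⟩
  · rintro x y (⟨h1, h2, h3⟩ | h1 | h1)
    · exact Or.inl ⟨hs _ _ h1, h3, h2⟩
    · exact Or.inr (Or.inr h1.symm)
    · exact Or.inr (Or.inl h1.symm)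
  · rintro x (⟨h1, -, -⟩ | ⟨h1, h2⟩ | ⟨h1, h2⟩)
    · exact hi x h1
    · exact hab (h1.symm.trans h2)
    · exact hab (h2.symm.trans h1)
  · rintro x y (⟨h1, h2, h3⟩ | ⟨rfl, rfl⟩ | ⟨rfl, rfl⟩)
    · obtain ⟨z, hzy, hz⟩ := h.two x y h1
      by_cases hzv : z = v
      · subst hzv
        rcases hv x hz with rfl | rfl
        · exact ⟨b, fun e => hn (e ▸ h1), by tauto⟩
        · exact ⟨a, fun e => hn' (e ▸ h1), by tauto⟩
      · exact ⟨z, hzy, by tauto⟩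
    · obtain ⟨z, hzv, hz⟩ := h.two x v (hs _ _ ha)
      exact ⟨z, fun e => hn (e ▸ hz), Or.inl ⟨hz, hva, hzv⟩⟩
    · obtain ⟨z, hzv, hz⟩ := h.two x v (hs _ _ hb)
      exact ⟨z, fun e => hn' (e ▸ hz), Or.inl ⟨hz, hvb, hzv⟩⟩
  · intro x p q r hp hq hr
    have h1 := h.le_two x
    grind
  · intro E hE hEs hEne hE2 x y hxy
    -- If `E` uses the new edge, replacing it by the path through `v` gives a subrelation of `A`.
    -- Otherwise `E` is itself one, hence all of `A` by minimality, although it avoids `v`.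
    by_cases hEab : E a b
    · have hEv : ∀ x y, E x y → y ≠ v := fun x y e => by
        rcases hE x y e with h1 | h1 | h1
        exacts [h1.2.2, h1.2 ▸ hvb, h1.2 ▸ hva]
      have hmin := h.minimal (fun x y => (E x y ∧ ¬ (x = a ∧ y = b) ∧ ¬ (x = b ∧ y = a)) ∨
        (x = v ∧ y = a) ∨ (x = a ∧ y = v) ∨ (x = v ∧ y = b) ∨ (x = b ∧ y = v)) ?_ ?_
        ⟨v, a, Or.inr (Or.inl ⟨rfl, rfl⟩)⟩ ?_
      · rcases hxy with ⟨h1, h2, h3⟩ | ⟨rfl, rfl⟩ | ⟨rfl, rfl⟩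
        · rcases hmin x y h1 with h4 | h4 | h4 | h4 | h4
          exacts [h4.1, absurd h4.1 h2, absurd h4.2 h3, absurd h4.1 h2, absurd h4.2 h3]
        · exact hEab
        · exact hEs _ _ hEab
      · rintro x y (⟨h1, h2, h3⟩ | ⟨rfl, rfl⟩ | ⟨rfl, rfl⟩ | ⟨rfl, rfl⟩ | ⟨rfl, rfl⟩)
        · rcases hE x y h1 with h4 | h4 | h4
          exacts [h4.1, absurd h4 h2, absurd h4 h3]
        · exact ha
        · exact hs _ _ ha
        · exact hb
        · exact hs _ _ hb
      · rintro x y (⟨h1, h2, h3⟩ | h1 | h1 | h1 | h1)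
        · exact Or.inl ⟨hEs _ _ h1, fun e => h3 e.symm, fun e => h2 e.symm⟩
        · exact Or.inr (Or.inr (Or.inl h1.symm))
        · exact Or.inr (Or.inl h1.symm)
        · exact Or.inr (Or.inr (Or.inr (Or.inr h1.symm)))
        · exact Or.inr (Or.inr (Or.inr (Or.inl h1.symm)))
      · rintro x y (⟨h1, h2, h3⟩ | ⟨rfl, rfl⟩ | ⟨rfl, rfl⟩ | ⟨rfl, rfl⟩ | ⟨rfl, rfl⟩)
        · obtain ⟨z, hzy, hz⟩ := hE2 x y h1
          by_cases h4 : x = a ∧ z = b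
          · exact ⟨v, (hEv x y h1).symm, Or.inr (Or.inr (Or.inl ⟨h4.1, rfl⟩))⟩
          by_cases h5 : x = b ∧ z = a
          · exact ⟨v, (hEv x y h1).symm, Or.inr (Or.inr (Or.inr (Or.inr ⟨h5.1, rfl⟩)))⟩
          · exact ⟨z, hzy, Or.inl ⟨hz, h4, h5⟩⟩
        · exact ⟨b, hab.symm, Or.inr (Or.inr (Or.inr (Or.inl ⟨rfl, rfl⟩)))⟩
        · obtain ⟨z, hzb, hz⟩ := hE2 _ _ hEab
          exact ⟨z, hEv _ _ hz, Or.inl ⟨hz, fun e => hzb e.2, fun e => hab e.1⟩⟩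
        · exact ⟨a, hab, Or.inr (Or.inl ⟨rfl, rfl⟩)⟩
        · obtain ⟨z, hzb, hz⟩ := hE2 _ _ (hEs _ _ hEab)
          exact ⟨z, hEv _ _ hz, Or.inl ⟨hz, fun e => hab e.1.symm, fun e => hzb e.2⟩⟩
    · have hEba : ¬ E b a := fun e => hEab (hEs _ _ e)
      have hEA : ∀ x y, E x y → A x y := fun x y e => by
        rcases hE x y e with h1 | ⟨rfl, rfl⟩ | ⟨rfl, rfl⟩
        exacts [h1.1, absurd e hEab, absurd e hEba]
      rcases hE _ _ (h.minimal E hEA hEs hEne hE2 _ _ ha) with h1 | h1 | h1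
      exacts [absurd rfl h1.2.1, absurd h1.1.symm hva, absurd h1.1.symm hvb]

/-- Two distinct vertices that span an edge. -/
def Adj {V : Type*} [DecidableEq V] (Δ : FinSimplicialComplex V) (x y : V) : Prop :=
  x ≠ y ∧ {x, y} ∈ Δ.faces

/-- `Δ` is a cycle graph. -/
structure IsCycle {V : Type*} [DecidableEq V] (Δ : FinSimplicialComplex V) : Prop where
  card_le : ∀ s ∈ Δ.faces, s.card ≤ 2
  exists_vert : ∃ v, {v} ∈ Δ.faces
  exists_adj : ∀ v, {v} ∈ Δ.faces → ∃ a, Δ.Adj v a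
  rel : IsCycleRel Δ.Adj

section

variable {V : Type*} [DecidableEq V]

lemma Adj.symm {Δ : FinSimplicialComplex V} {x y : V} (h : Δ.Adj x y) : Δ.Adj y x :=
  ⟨h.1.symm, Finset.pair_comm x y ▸ h.2⟩

lemma Adj.left_mem {Δ : FinSimplicialComplex V} {x y : V} (h : Δ.Adj x y) : {x} ∈ Δ.faces :=
  Δ.down_closed _ h.2 _ (by simp)

/-- By minimality, a cycle that contains a triangle is that triangle. -/
lemma IsCycle.eq_simplexBoundary {Δ : FinSimplicialComplex V} (h : Δ.IsCycle) {v a b : V}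
    (ha : Δ.Adj v a) (hb : Δ.Adj v b) (hab : Δ.Adj a b) :
    Δ = simplexBoundary {v, a, b} (Finset.insert_nonempty _ _) := by
  have hE := h.rel.minimal (fun x y => x ≠ y ∧ x ∈ ({v, a, b} : Finset V) ∧
    y ∈ ({v, a, b} : Finset V)) ?_ ?_ ⟨v, a, ha.1, by simp, by simp⟩ ?_
  · have hverts : ∀ s ∈ Δ.faces, s ⊆ {v, a, b} := fun s hs x hx => by
      obtain ⟨y, hy⟩ := h.exists_adj x
        (Δ.down_closed s hs _ (Finset.singleton_subset_iff.mpr hx))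
      exact (hE x y hy).2.1
    have hcard : ({v, a, b} : Finset V).card = 3 :=
      Finset.card_eq_three.mpr ⟨v, a, b, ha.1, hb.1, hab.1, rfl⟩
    ext s
    change s ∈ Δ.faces ↔ s ∈ Finset.ssubsets _
    rw [Finset.mem_ssubsets]
    constructor
    · intro hs
      refine Finset.ssubset_iff_subset_ne.mpr ⟨hverts s hs, fun he => ?_⟩
      have := h.card_le s hs
      rw [he, hcard] at this
      omega
    · intro hs
      obtain ⟨x, hx, hxs⟩ := Finset.exists_of_ssubset hs
      have hsub : s ⊆ ({v, a, b} : Finset V).erase x := fun y hy =>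
        Finset.mem_erase.mpr ⟨fun e => hxs (e ▸ hy), hs.1 hy⟩
      refine Δ.down_closed _ ?_ _ hsub
      have h1 := ha.1
      have h2 := hb.1
      have h3 := hab.1
      simp only [Finset.mem_insert, Finset.mem_singleton] at hx
      rcases hx with rfl | rfl | rfl
      · rw [Finset.erase_insert (by simp [h1, h2])]
        exact hab.2
      · rw [show ({v, x, b} : Finset V).erase x = {v, b} by ext; simp; grind]
        exact hb.2
      · rw [show ({v, a, x} : Finset V).erase x = {v, a} by ext; simp; grind]
        exact ha.2
  · rintro x y ⟨hxy, hx, hy⟩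
    have h1 := ha.symm
    have h2 := hb.symm
    have h3 := hab.symm
    simp only [Finset.mem_insert, Finset.mem_singleton] at hx hy
    rcases hx with rfl | rfl | rfl <;> rcases hy with rfl | rfl | rfl <;>
      first | exact absurd rfl hxy | assumption
  · rintro x y ⟨h1, h2, h3⟩
    exact ⟨h1.symm, h3, h2⟩
  · rintro x y ⟨hxy, hx, hy⟩
    have h1 := ha.1
    have h2 := hb.1
    have h3 := hab.1
    simp only [Finset.mem_insert, Finset.mem_singleton] at hx hy ⊢
    by_cases hv : v ≠ x ∧ v ≠ y
    · exact ⟨v, hv.2, hv.1.symm, hx, Or.inl rfl⟩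
    by_cases ha : a ≠ x ∧ a ≠ y
    · exact ⟨a, ha.2, ha.1.symm, hx, Or.inr (Or.inl rfl)⟩
    · exact ⟨b, by grind, by grind, hx, Or.inr (Or.inr rfl)⟩

/-- The complex obtained by removing the vertex `v` and adding the edge `{a, b}`. -/
def contractVert (Δ : FinSimplicialComplex V) (v a b : V) (ha : {a} ∈ Δ.faces)
    (hb : {b} ∈ Δ.faces) (hva : v ≠ a) (hvb : v ≠ b) : FinSimplicialComplex V where
  faces := insert {a, b} (Δ.faces.filter fun s => v ∉ s)
  empty_mem := by simp [Δ.empty_mem]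
  down_closed := by
    intro s hs t hts
    simp only [Finset.mem_insert, Finset.mem_filter] at hs ⊢
    rcases hs with rfl | ⟨hs, hv⟩
    · by_cases h : t = {a, b}
      · exact Or.inl h
      · right
        have hsub : t ⊆ {a} ∨ t ⊆ {b} := by
          obtain ⟨x, hx, hxt⟩ := Finset.exists_of_ssubset (lt_of_le_of_ne hts h)
          simp only [Finset.mem_insert, Finset.mem_singleton] at hx
          have hmem : ∀ y ∈ t, y = a ∨ y = b := fun y hy => by simpa using hts hy
          rcases hx with rfl | rfl
          · exact Or.inr fun y hy => by
              rcases hmem y hy with rfl | rfl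
              exacts [absurd hy hxt, Finset.mem_singleton_self _]
          · exact Or.inl fun y hy => by
              rcases hmem y hy with rfl | rfl
              exacts [Finset.mem_singleton_self _, absurd hy hxt]
        rcases hsub with h | h
        · exact ⟨Δ.down_closed _ ha _ h, fun hv => hva (Finset.mem_singleton.mp (h hv))⟩
        · exact ⟨Δ.down_closed _ hb _ h, fun hv => hvb (Finset.mem_singleton.mp (h hv))⟩
    · exact Or.inr ⟨Δ.down_closed s hs t hts, fun h => hv (hts h)⟩

/-- Removing `v` and joining its neighbours leaves a smaller cycle; subdividing the new edge by `v`
undoes this. -/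
lemma IsCycle.exists_contraction {Δ : FinSimplicialComplex V} (h : Δ.IsCycle) {v a b : V}
    (ha : Δ.Adj v a) (hb : Δ.Adj v b) (hne : a ≠ b) (hab : ¬ Δ.Adj a b) :
    ∃ Δ₀ : FinSimplicialComplex V, Δ₀.IsCycle ∧ Δ₀.verts.card < Δ.verts.card ∧
      IsBistellarMove 0 Δ₀ Δ := by
  have hva := ha.1
  have hvb := hb.1
  have habΔ : {a, b} ∉ Δ.faces := fun hf => hab ⟨hne, hf⟩
  set Δ₀ := Δ.contractVert v a b ha.symm.left_mem hb.symm.left_mem hva hvb with hΔ₀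
  have hmem : ∀ s, s ∈ Δ₀.faces ↔ s = {a, b} ∨ (s ∈ Δ.faces ∧ v ∉ s) := fun s => by
    simp [hΔ₀, contractVert]
  have hadj : ∀ x y, Δ₀.Adj x y ↔
      (Δ.Adj x y ∧ x ≠ v ∧ y ≠ v) ∨ (x = a ∧ y = b) ∨ (x = b ∧ y = a) := by
    intro x y
    simp only [Adj, hmem, Finset.mem_insert, Finset.mem_singleton, not_or]
    have hpair : ({x, y} : Finset V) = {a, b} ↔ (x = a ∧ y = b) ∨ (x = b ∧ y = a) := by
      constructor
      · intro e
        have h1 : a ∈ ({x, y} : Finset V) := e ▸ Finset.mem_insert_self a _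
        have h2 : b ∈ ({x, y} : Finset V) := e ▸ by simp
        simp only [Finset.mem_insert, Finset.mem_singleton] at h1 h2
        grind
      · rintro (⟨rfl, rfl⟩ | ⟨rfl, rfl⟩)
        exacts [rfl, Finset.pair_comm _ _]
    rw [hpair]
    grind
  have hrel : Δ₀.Adj = fun x y =>
      (Δ.Adj x y ∧ x ≠ v ∧ y ≠ v) ∨ (x = a ∧ y = b) ∨ (x = b ∧ y = a) := by
    ext x y
    exact hadj x y
  have hcycle : IsCycleRel Δ₀.Adj := hrel ▸ h.rel.contract ha hb hne hab
  have hcard : ∀ s ∈ Δ₀.faces, s.card ≤ 2 := fun s hs => by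
    rcases (hmem s).mp hs with rfl | ⟨hs, -⟩
    · exact Finset.card_le_two
    · exact h.card_le s hs
  have hvert : ∀ x, {x} ∈ Δ₀.faces ↔ {x} ∈ Δ.faces ∧ x ≠ v := by
    intro x
    rw [hmem]
    have : ({x} : Finset V) ≠ {a, b} := fun e => by
      have := congrArg Finset.card e
      rw [Finset.card_singleton, Finset.card_pair hne] at this
      omega
    simp [this, eq_comm]
  have hexists : ∀ x, {x} ∈ Δ₀.faces → ∃ y, Δ₀.Adj x y := by
    intro x hx
    obtain ⟨hx1, hx2⟩ := (hvert x).mp hx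
    obtain ⟨y, hy⟩ := h.exists_adj x hx1
    by_cases hyv : y = v
    · obtain ⟨z, hz1, hz2⟩ := h.rel.two x y hy
      exact ⟨z, (hadj x z).mpr (Or.inl ⟨hz2, hx2, hyv ▸ hz1⟩)⟩
    · exact ⟨y, (hadj x y).mpr (Or.inl ⟨hy, hx2, hyv⟩)⟩
  have habΔ₀ : {a, b} ∈ Δ₀.faces := (hmem _).mpr (Or.inl rfl)
  have hrank : Δ₀.rank = 2 := le_antisymm (Finset.sup_le hcard)
    (Finset.card_pair hne ▸ card_le_rank habΔ₀)
  have hun : ∀ s, s ∪ {a, b} ∈ Δ₀.faces ↔ s ⊆ {a, b} := fun s => by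
    constructor
    · intro hs
      have : ({a, b} : Finset V) = s ∪ {a, b} := Finset.eq_of_subset_of_card_le
        Finset.subset_union_right ((hcard _ hs).trans (Finset.card_pair hne).ge)
      rw [this]
      exact Finset.subset_union_left
    · intro hs
      rwa [Finset.union_eq_right.mpr hs]
  have hvΔ₀ : ∀ s ∈ Δ₀.faces, v ∉ s := fun s hs => by
    rcases (hmem s).mp hs with rfl | ⟨-, hs⟩
    · simp [hva, hvb]
    · exact hs
  refine ⟨Δ₀, ⟨hcard, ⟨a, (hvert a).mpr ⟨ha.symm.left_mem, hva.symm⟩⟩, hexists, hcycle⟩, ?_, ?_, ?_⟩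
  · refine Finset.card_lt_card (Finset.ssubset_iff_of_subset ?_ |>.mpr ⟨v, ?_, ?_⟩)
    · exact fun x hx => mem_verts.mpr ((hvert x).mp (mem_verts.mp hx)).1
    · exact mem_verts.mpr ha.left_mem
    · exact fun hv => ((hvert v).mp (mem_verts.mp hv)).2 rfl
  · intro s hs hmax
    rw [hrank]
    refine le_antisymm (hcard s hs) ?_
    by_contra! hlt
    have hxs : ∃ x, {x} ∈ Δ₀.faces ∧ s ⊆ {x} := by
      have : Nonempty V := ⟨a⟩
      rcases Finset.card_le_one_iff_subset_singleton (s := s) |>.mp (by omega) with ⟨x, hx⟩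
      rcases Finset.subset_singleton_iff.mp hx with rfl | rfl
      · exact ⟨a, (hvert a).mpr ⟨ha.symm.left_mem, hva.symm⟩, Finset.empty_subset _⟩
      · exact ⟨x, hs, le_rfl⟩
    obtain ⟨x, hx, hsx⟩ := hxs
    obtain ⟨y, hy⟩ := hexists x hx
    have := hmax _ hy.2 (hsx.trans (by simp))
    rw [← this, Finset.card_pair hy.1] at hlt
    omega
  · refine ⟨{a, b}, {v}, habΔ₀, ⟨a, by simp⟩, ?_, Finset.card_singleton v, ?_, ?_, ?_⟩
    · rw [hrank, Finset.card_pair hne]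
    · exact fun hv => hvΔ₀ _ hv (Finset.mem_singleton_self v)
    · intro s
      simp only [link, Finset.mem_filter, hun, Finset.ssubset_singleton_iff]
      constructor
      · rintro ⟨-, h1, h2⟩
        exact Finset.disjoint_self_iff_empty _ |>.mp (h2.mono_right h1)
      · rintro rfl
        exact ⟨Δ₀.empty_mem, Finset.empty_subset _, Finset.disjoint_empty_left _⟩
    · intro s
      rw [hun]
      constructor
      · intro hs
        by_cases hv : v ∈ s
        · right
          refine ⟨s.erase v, {v}, ?_, le_rfl, ?_⟩
          · have hc := h.card_le s hs
            have hc' := Finset.card_erase_add_one hv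
            refine Finset.ssubset_iff_subset_ne.mpr ⟨fun x hx => ?_, fun e => ?_⟩
            · have hxv := Finset.ne_of_mem_erase hx
              have hadjx : Δ.Adj v x := ⟨hxv.symm, Δ.down_closed s hs _
                (Finset.insert_subset hv (Finset.singleton_subset_iff.mpr
                  (Finset.mem_of_mem_erase hx)))⟩
              have := h.rel.le_two v a b x ha hb hadjx
              simp only [Finset.mem_insert, Finset.mem_singleton]
              tauto
            · rw [e, Finset.card_pair hne] at hc'
              omega
          · rw [Finset.union_comm]
            exact (Finset.insert_erase hv).symm
        · by_cases hsub : s ⊆ {a, b}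
          · exact Or.inr ⟨s, ∅, lt_of_le_of_ne hsub fun e => habΔ (e ▸ hs), Finset.empty_subset _,
              by simp⟩
          · exact Or.inl ⟨(hmem s).mpr (Or.inr ⟨hs, hv⟩), hsub⟩
      · rintro (⟨hs, hsub⟩ | ⟨c, e, hc, he, rfl⟩)
        · exact (((hmem s).mp hs).resolve_left fun e => hsub e.subset).1
        · have hce : c ∪ e ⊆ {v, a} ∨ c ∪ e ⊆ {v, b} := by
            obtain ⟨x, hx, hxc⟩ := Finset.exists_of_ssubset hc
            have h1 : ∀ y ∈ c, y = a ∨ y = b := fun y hy => by simpa using hc.1 hy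
            have h2 : ∀ y ∈ e, y = v := fun y hy => by simpa using he hy
            simp only [Finset.mem_insert, Finset.mem_singleton] at hx
            rcases hx with rfl | rfl
            · right
              intro y hy
              simp only [Finset.mem_union, Finset.mem_insert, Finset.mem_singleton] at hy ⊢
              grind
            · left
              intro y hy
              simp only [Finset.mem_union, Finset.mem_insert, Finset.mem_singleton] at hy ⊢
              grind
          rcases hce with h1 | h1
          · exact Δ.down_closed _ ha.2 _ h1
          · exact Δ.down_closed _ hb.2 _ h1

/-- Contract vertices until the two neighbours of some vertex are adjacent. -/
theorem IsCycle.isStackedSphere {Δ : FinSimplicialComplex V} (h : Δ.IsCycle) :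
    IsStackedSphere 2 Δ := by
  induction hn : Δ.verts.card using Nat.strong_induction_on generalizing Δ with
  | _ n ih =>
    obtain ⟨v, hv⟩ := h.exists_vert
    obtain ⟨a, ha⟩ := h.exists_adj v hv
    obtain ⟨b, hba, hb⟩ := h.rel.two v a ha
    by_cases hab : Δ.Adj a b
    · rw [h.eq_simplexBoundary ha hb hab]
      exact IsStackedSphere.boundary _ _
        (Finset.card_eq_three.mpr ⟨v, a, b, ha.1, hb.1, hab.1, rfl⟩)
    · obtain ⟨Δ₀, hc, hlt, hm⟩ := h.exists_contraction ha hb hba.symm hab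
      exact IsStackedSphere.move Δ₀ Δ (ih _ (hn ▸ hlt) hc rfl) hm

end

end FinSimplicialComplex
end

noncomputable section
namespace FinSimplicialComplex

/-! ### Simplicial circles -/

instance fact_finrank_euclideanSpace_two :
    Fact (Module.finrank ℝ (EuclideanSpace ℝ (Fin (1 + 1))) = 1 + 1) :=
  ⟨finrank_euclideanSpace_fin⟩

lemma exists_openPartialHomeomorph_circle
    (q : Metric.sphere (0 : EuclideanSpace ℝ (Fin (1 + 1))) 1) :
    ∃ φ : OpenPartialHomeomorph (Metric.sphere (0 : EuclideanSpace ℝ (Fin (1 + 1))) 1)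
      (EuclideanSpace ℝ (Fin 1)), φ.source = {q}ᶜ ∧ φ.target = Set.univ :=
  ⟨stereographic' 1 q, stereographic'_source q, stereographic'_target q⟩

/-- A punctured circle embeds onto the line. -/
lemma exists_bijOn_of_homeomorph_circle {E : Type*} [TopologicalSpace E] {X : Set E}
    (e : X ≃ₜ Metric.sphere (0 : EuclideanSpace ℝ (Fin (1 + 1))) 1) {p : E} (hp : p ∈ X) :
    ∃ F : E → ℝ, ContinuousOn F (X \ {p}) ∧ Set.BijOn F (X \ {p}) Set.univ := by
  classical
  obtain ⟨φ, hsource, htarget⟩ := exists_openPartialHomeomorph_circle (e ⟨p, hp⟩)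
  have hsrc : ∀ x (hx : x ∈ X \ {p}), e ⟨x, hx.1⟩ ∈ φ.source := fun x hx => by
    rw [hsource]
    exact fun h => hx.2 (congrArg Subtype.val (e.injective h))
  refine ⟨fun x => if hx : x ∈ X then φ (e ⟨x, hx⟩) 0 else 0, ?_, fun x _ => trivial, ?_, ?_⟩
  · rw [continuousOn_iff_continuous_domRestrict]
    have h1 : Continuous fun x : ↥(X \ {p}) => φ (e ⟨x.1, x.2.1⟩) := by
      refine φ.continuousOn.comp_continuous ?_ fun x => hsrc x.1 x.2
      fun_prop
    have h2 : Continuous fun y : EuclideanSpace ℝ (Fin 1) => y 0 := by fun_prop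
    refine (h2.comp h1).congr fun x => ?_
    rw [Set.domRestrict_apply, dif_pos x.2.1, Function.comp_apply]
  · intro x hx y hy hxy
    simp only [hx.1, hy.1, dite_true] at hxy
    have h1 : φ (e ⟨x, hx.1⟩) = φ (e ⟨y, hy.1⟩) := by
      ext i
      rw [Subsingleton.elim i 0]
      exact hxy
    exact congrArg Subtype.val (e.injective (φ.injOn (hsrc x hx) (hsrc y hy) h1))
  · intro r _
    have hr : (WithLp.toLp 2 fun _ => r : EuclideanSpace ℝ (Fin 1)) ∈ φ.target := by
      rw [htarget]
      trivial
    have hs := φ.map_target hr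
    refine ⟨(e.symm (φ.symm (WithLp.toLp 2 fun _ => r))).1, ⟨Subtype.coe_prop _, fun h => ?_⟩, ?_⟩
    · rw [hsource] at hs
      refine hs ?_
      have h' : e.symm (φ.symm (WithLp.toLp 2 fun _ => r)) = ⟨p, hp⟩ := Subtype.ext h
      rw [Set.mem_singleton_iff, ← e.symm_apply_eq, h']
    · simp [φ.right_inv hr]

/-- A circle remains connected if a point is removed. -/
lemma isPreconnected_diff_of_homeomorph_circle {E : Type*} [TopologicalSpace E] {X : Set E}
    (e : X ≃ₜ Metric.sphere (0 : EuclideanSpace ℝ (Fin (1 + 1))) 1) (p : E) :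
    IsPreconnected (X \ {p}) := by
  by_cases hp : p ∈ X
  · obtain ⟨φ, hsource, htarget⟩ := exists_openPartialHomeomorph_circle (e ⟨p, hp⟩)
    have hc : Continuous φ.symm := by
      have := φ.continuousOn_symm
      rw [htarget] at this
      exact continuousOn_univ.mp this
    have himage : X \ {p} = Set.range fun y => (e.symm (φ.symm y)).1 := by
      ext x
      constructor
      · intro hx
        have hs : e ⟨x, hx.1⟩ ∈ φ.source := by
          rw [hsource]
          exact fun h => hx.2 (congrArg Subtype.val (e.injective h))
        exact ⟨φ (e ⟨x, hx.1⟩), by simp [φ.left_inv hs]⟩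
      · rintro ⟨y, rfl⟩
        refine ⟨Subtype.coe_prop _, fun h => ?_⟩
        have hs : φ.symm y ∈ φ.source := φ.map_target (by rw [htarget]; trivial)
        rw [hsource] at hs
        refine hs ?_
        have h' : e.symm (φ.symm y) = ⟨p, hp⟩ := Subtype.ext h
        rw [Set.mem_singleton_iff, ← e.symm_apply_eq, h']
    rw [himage]
    exact isPreconnected_range (continuous_subtype_val.comp (e.symm.continuous.comp hc))
  · rw [Set.sdiff_singleton_eq_self hp]
    have hrank : 1 < Module.rank ℝ (EuclideanSpace ℝ (Fin (1 + 1))) := by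
      rw [← Module.finrank_eq_rank, finrank_euclideanSpace_fin]
      norm_num
    have : PreconnectedSpace (Metric.sphere (0 : EuclideanSpace ℝ (Fin (1 + 1))) 1) :=
      isPreconnected_iff_preconnectedSpace.mp (isPreconnected_sphere hrank 0 1)
    have h := isPreconnected_range (continuous_subtype_val.comp e.symm.continuous)
    rwa [Set.range_comp, e.symm.range_coe, Set.image_univ, Subtype.range_coe] at h

/-- Two arcs in the line that start at the same point, and neither of which contains the end of
the other, go in different directions. -/
lemma sub_mul_sub_neg_of_arcs {g h : ℝ → ℝ} (hg : ContinuousOn g (Set.Icc 0 1))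
    (hh : ContinuousOn h (Set.Icc 0 1)) (h0 : g 0 = h 0) (h1 : ∀ t ∈ Set.Icc (0 : ℝ) 1, g 1 ≠ h t)
    (h2 : ∀ t ∈ Set.Icc (0 : ℝ) 1, h 1 ≠ g t) : (g 1 - g 0) * (h 1 - g 0) < 0 := by
  -- By the intermediate value theorem each arc covers the interval between its end values, so
  -- neither end lies in the interval of the other arc.
  have key : ∀ f : ℝ → ℝ, ContinuousOn f (Set.Icc 0 1) → ∀ y, y ∈ Set.uIcc (f 0) (f 1) →
      ∃ t ∈ Set.Icc (0 : ℝ) 1, y = f t := fun f hf y hy => by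
    have := intermediate_value_uIcc (a := (0 : ℝ)) (b := 1) (f := f)
      (by rwa [Set.uIcc_of_le zero_le_one]) hy
    rw [Set.uIcc_of_le zero_le_one] at this
    obtain ⟨t, ht, rfl⟩ := this
    exact ⟨t, ht, rfl⟩
  have h1' : g 1 ∉ Set.uIcc (h 0) (h 1) := fun hy => by
    obtain ⟨t, ht, he⟩ := key h hh _ hy
    exact h1 t ht he
  have h2' : h 1 ∉ Set.uIcc (g 0) (g 1) := fun hy => by
    obtain ⟨t, ht, he⟩ := key g hg _ hy
    exact h2 t ht he
  rw [← h0] at h1'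
  rw [Set.mem_uIcc] at h1' h2'
  push Not at h1' h2'
  rcases lt_trichotomy (g 1) (g 0) with h3 | h3 | h3
  · have : g 0 < h 1 := by
      by_contra! h4
      rcases le_total (g 1) (h 1) with h5 | h5
      · exact absurd (h2'.2 h5) h4.not_gt
      · exact absurd (h1'.2 h5) h3.le.not_gt
    exact mul_neg_of_neg_of_pos (sub_neg.mpr h3) (sub_pos.mpr this)
  · rcases le_total (g 0) (h 1) with h4 | h4
    · exact absurd (h1'.1 h3.ge) (h3 ▸ h4).not_gt
    · exact absurd (h1'.2 (h3 ▸ h4)) h3.le.not_gt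
  · have : h 1 < g 0 := by
      by_contra! h4
      rcases le_total (g 1) (h 1) with h5 | h5
      · exact absurd (h1'.1 h3.le) h5.not_gt
      · exact absurd (h2'.1 h4) h5.not_gt
    exact mul_neg_of_pos_of_neg (sub_pos.mpr h3) (sub_neg.mpr this)

lemma sub_mul_sub_neg_of_injOn {E : Type*} [TopologicalSpace E] {D : Set E} {F : E → ℝ}
    (hF : ContinuousOn F D) (hi : Set.InjOn F D) {g h : ℝ → E} (hg : Continuous g)
    (hh : Continuous h) (hgD : ∀ t ∈ Set.Icc (0 : ℝ) 1, g t ∈ D)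
    (hhD : ∀ t ∈ Set.Icc (0 : ℝ) 1, h t ∈ D) (h0 : g 0 = h 0)
    (h1 : ∀ t ∈ Set.Icc (0 : ℝ) 1, g 1 ≠ h t) (h2 : ∀ t ∈ Set.Icc (0 : ℝ) 1, h 1 ≠ g t) :
    (F (g 1) - F (g 0)) * (F (h 1) - F (g 0)) < 0 := by
  have one_mem : (1 : ℝ) ∈ Set.Icc (0 : ℝ) 1 := by simp
  exact sub_mul_sub_neg_of_arcs (g := F ∘ g) (h := F ∘ h) (hF.comp hg.continuousOn hgD)
    (hF.comp hh.continuousOn hhD) (congrArg F h0)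
    (fun t ht he => h1 t ht (hi (hgD 1 one_mem) (hhD t ht) he))
    (fun t ht he => h2 t ht (hi (hhD 1 one_mem) (hgD t ht) he))

lemma IsSimplicialSphere.nontrivial {V : Type*} {Δ : FinSimplicialComplex V} (h : Δ.IsSimplicialSphere 1) :
    Δ.realization.Nontrivial := by
  obtain ⟨e⟩ := h
  have hne : Δ.realization.Nonempty := by
    obtain ⟨x, hx⟩ := NormedSpace.sphere_nonempty
      (x := (0 : EuclideanSpace ℝ (Fin (1 + 1)))) (r := 1) |>.mpr zero_le_one
    exact ⟨_, (e.symm ⟨x, hx⟩).2⟩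
  obtain ⟨p, hp⟩ := hne
  obtain ⟨F, -, hF⟩ := exists_bijOn_of_homeomorph_circle e hp
  obtain ⟨q, hq, -⟩ := hF.surjOn (Set.mem_univ 0)
  exact ⟨q, hq.1, p, hp, hq.2⟩

/-! ### Edges as segments of the realization, and the graph of a simplicial circle -/

section

variable {V : Type*} [DecidableEq V]

/-- The segment from the vertex `a` to the vertex `b`. -/
def seg (a b : V) (t : ℝ) : V → ℝ :=
  fun w => (1 - t) * (if w = a then 1 else 0) + t * (if w = b then 1 else 0)

lemma continuous_seg (a b : V) : Continuous (seg a b) := by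
  unfold seg
  fun_prop

lemma seg_apply_left {a b : V} (h : a ≠ b) (t : ℝ) : seg a b t a = 1 - t := by simp [seg, h]

lemma seg_apply_right {a b : V} (h : a ≠ b) (t : ℝ) : seg a b t b = t := by simp [seg, h.symm]

lemma seg_apply_of_ne {a b w : V} (ha : w ≠ a) (hb : w ≠ b) (t : ℝ) : seg a b t w = 0 := by
  simp [seg, ha, hb]

/-- At time zero the second vertex is irrelevant; `seg a a 0` serves as the point `a`. -/
lemma seg_zero (a b c : V) : seg a b 0 = seg a c 0 := by
  ext w
  simp [seg]

lemma seg_one (a b : V) : seg a b 1 = seg b a 0 := by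
  ext w
  simp [seg]

lemma Adj.seg_mem {Δ : FinSimplicialComplex V} {a b : V} (h : Δ.Adj a b) {t : ℝ}
    (ht : t ∈ Set.Icc (0 : ℝ) 1) : seg a b t ∈ Δ.realization := by
  refine ⟨fun w => ?_, {a, b}, h.2, fun w hw => ?_, ?_⟩
  · have := ht.1
    have := ht.2
    by_cases ha : w = a
    · subst ha
      rw [seg_apply_left h.1]
      linarith
    by_cases hb : w = b
    · subst hb
      rwa [seg_apply_right h.1]
    · rw [seg_apply_of_ne ha hb]
  · simp only [Finset.mem_insert, Finset.mem_singleton, not_or] at hw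
    exact seg_apply_of_ne hw.1 hw.2 t
  · rw [Finset.sum_pair h.1, seg_apply_left h.1, seg_apply_right h.1]
    ring

lemma seg_mem_of_vert {Δ : FinSimplicialComplex V} {a : V} (h : {a} ∈ Δ.faces) (b : V) :
    seg a b 0 ∈ Δ.realization :=
  ⟨fun w => by simp only [seg]; split_ifs <;> norm_num, {a}, h, fun w hw => by
    simp only [Finset.mem_singleton] at hw
    simp [seg, hw], by simp [seg]⟩

/-- A nonempty subgraph without vertices of degree one covers a simplicial circle. -/
lemma exists_eq_seg {Δ : FinSimplicialComplex V} (h : Δ.IsSimplicialSphere 1)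
    {A : V → V → Prop} (hA : ∀ x y, A x y → Δ.Adj x y) (hs : ∀ x y, A x y → A y x)
    (hne : ∃ x y, A x y) (h2 : ∀ x y, A x y → ∃ z, z ≠ y ∧ A x z) {p : V → ℝ}
    (hp : p ∈ Δ.realization) : ∃ x y, A x y ∧ ∃ t ∈ Set.Icc (0 : ℝ) 1, p = seg x y t := by
  by_contra! hcon
  obtain ⟨e⟩ := h
  obtain ⟨F, hF, hbij⟩ := exists_bijOn_of_homeomorph_circle e hp
  have hfin : {q : V × V | A q.1 q.2}.Finite := by
    refine (Δ.verts ×ˢ Δ.verts).finite_toSet.subset fun q hq => ?_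
    rw [Finset.mem_coe, Finset.mem_product, mem_verts, mem_verts]
    exact ⟨(hA _ _ hq).left_mem, (hA _ _ hq).symm.left_mem⟩
  -- The union of the edges of the subgraph: compact and contained in the circle punctured at the
  -- uncovered point `p`.
  set C : Set (V → ℝ) := ⋃ q ∈ {q : V × V | A q.1 q.2}, seg q.1 q.2 '' Set.Icc (0 : ℝ) 1 with hC
  have hmem : ∀ x y, A x y → ∀ t ∈ Set.Icc (0 : ℝ) 1, seg x y t ∈ C := fun x y hxy t ht =>
    Set.mem_biUnion (show (x, y) ∈ {q : V × V | A q.1 q.2} from hxy) ⟨t, ht, rfl⟩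
  have hsub : C ⊆ Δ.realization \ {p} := by
    refine Set.iUnion₂_subset fun q hq => ?_
    rintro _ ⟨t, ht, rfl⟩
    exact ⟨(hA _ _ hq).seg_mem ht, fun he => hcon _ _ hq t ht he.symm⟩
  have hcomp : IsCompact C := hfin.isCompact_biUnion fun q _ =>
    isCompact_Icc.image (continuous_seg q.1 q.2)
  obtain ⟨x, y, hxy⟩ := hne
  obtain ⟨m, hm, hmax⟩ := hcomp.exists_isMaxOn ⟨_, hmem x y hxy 0 (by simp)⟩ (hF.mono hsub)
  -- Two such arcs from `m` end on opposite sides of `F m`, which contradicts maximality.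
  have key : ∀ g h : ℝ → V → ℝ, Continuous g → Continuous h →
      (∀ t ∈ Set.Icc (0 : ℝ) 1, g t ∈ C) → (∀ t ∈ Set.Icc (0 : ℝ) 1, h t ∈ C) → g 0 = m →
      h 0 = m → (∀ t ∈ Set.Icc (0 : ℝ) 1, g 1 ≠ h t) → (∀ t ∈ Set.Icc (0 : ℝ) 1, h 1 ≠ g t) →
      False := by
    intro g h hg hh hgC hhC hg0 hh0 h3 h4
    have h5 := sub_mul_sub_neg_of_injOn (hF.mono hsub) (hbij.injOn.mono hsub) hg hh hgC hhC
      (hg0.trans hh0.symm) h3 h4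
    have h6 : F (g 1) ≤ F m := hmax (hgC 1 (by simp))
    have h7 : F (h 1) ≤ F m := hmax (hhC 1 (by simp))
    rw [hg0] at h5
    exact absurd (mul_nonneg_of_nonpos_of_nonpos (sub_nonpos.mpr h6) (sub_nonpos.mpr h7)) h5.not_ge
  -- At a vertex the two arcs are two edges of the subgraph.
  have hvert : ∀ x y, A x y → m ≠ seg x y 0 := by
    rintro x y hxy rfl
    obtain ⟨z, hzy, hxz⟩ := h2 x y hxy
    have h3 := (hA x y hxy).1
    have h4 := (hA x z hxz).1
    refine key _ _ (continuous_seg x y) (continuous_seg x z) (hmem x y hxy) (hmem x z hxz) rfl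
      (seg_zero x z y) (fun t _ he => ?_) (fun t _ he => ?_)
    · have := congrFun he y
      rw [seg_apply_right h3, seg_apply_of_ne h3.symm hzy.symm] at this
      exact one_ne_zero this
    · have := congrFun he z
      rw [seg_apply_right h4, seg_apply_of_ne h4.symm hzy] at this
      exact one_ne_zero this
  obtain ⟨⟨x, y⟩, hxy : A x y, t, ht, rfl⟩ := Set.mem_iUnion₂.mp hm
  have h3 := (hA x y hxy).1
  have ht0 : 0 < t := lt_of_le_of_ne ht.1 fun e => hvert x y hxy (by rw [← e])
  have ht1 : t < 1 := lt_of_le_of_ne ht.2 fun e => hvert y x (hs _ _ hxy) (by rw [e, seg_one])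
  -- In the interior of an edge the two arcs run to its two ends.
  refine key (fun s => seg x y (t * (1 - s))) (fun s => seg x y (t + (1 - t) * s))
    ((continuous_seg x y).comp (by fun_prop)) ((continuous_seg x y).comp (by fun_prop))
    (fun s hs => hmem x y hxy _ ⟨?_, ?_⟩) (fun s hs => hmem x y hxy _ ⟨?_, ?_⟩) (by simp) (by simp)
    (fun s hs he => ?_) (fun s hs he => ?_)
  · nlinarith [hs.1, hs.2]
  · nlinarith [hs.1, hs.2]
  · nlinarith [hs.1, hs.2]
  · nlinarith [hs.1, hs.2]
  · have := congrFun he y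
    simp only [seg_apply_right h3] at this
    nlinarith [hs.1, hs.2]
  · have := congrFun he y
    simp only [seg_apply_right h3] at this
    nlinarith [hs.1, hs.2]

/-- The complete graph on three vertices of a face would have to cover their barycentre, which lies
on no edge. -/
lemma IsSimplicialSphere.card_le_two {Δ : FinSimplicialComplex V} (h : Δ.IsSimplicialSphere 1)
    {s : Finset V} (hs : s ∈ Δ.faces) : s.card ≤ 2 := by
  by_contra! hcard
  obtain ⟨t, hts, ht⟩ := Finset.exists_subset_card_eq (show 3 ≤ s.card from hcard)
  have htΔ := Δ.down_closed s hs t hts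
  have hne : ∀ x y : V, ∃ z ∈ t, z ≠ x ∧ z ≠ y := fun x y => by
    obtain ⟨z, hz, hz'⟩ := Finset.exists_mem_notMem_of_card_lt_card
      (show ({x, y} : Finset V).card < t.card from ht ▸ Finset.card_le_two.trans_lt (by norm_num))
    simp only [Finset.mem_insert, Finset.mem_singleton, not_or] at hz'
    exact ⟨z, hz, hz'⟩
  obtain ⟨x, hx⟩ := Finset.card_pos.mp (ht ▸ (by norm_num : 0 < 3))
  obtain ⟨y, hy, hyx, -⟩ := hne x x
  obtain ⟨x, y, ⟨-, hx, hy⟩, r, -, he⟩ := exists_eq_seg h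
    (A := fun x y => x ≠ y ∧ x ∈ t ∧ y ∈ t)
    (fun x y ⟨hxy, hx, hy⟩ => ⟨hxy, Δ.down_closed t htΔ _
      (Finset.insert_subset hx (Finset.singleton_subset_iff.mpr hy))⟩)
    (fun x y ⟨hxy, hx, hy⟩ => ⟨hxy.symm, hy, hx⟩) ⟨x, y, hyx.symm, hx, hy⟩
    (fun x y ⟨hxy, hx, hy⟩ => by
      obtain ⟨z, hz, hzx, hzy⟩ := hne x y
      exact ⟨z, hzy, hzx.symm, hx, hz⟩)
    (p := fun v => if v ∈ t then 1 / 3 else 0)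
    ⟨fun v => by dsimp only; split_ifs <;> norm_num, t, htΔ, fun v hv => if_neg hv, by
      rw [Finset.sum_congr rfl fun v hv => if_pos hv, Finset.sum_const, ht]
      norm_num⟩
  obtain ⟨z, hz, hzx, hzy⟩ := hne x y
  have := congrFun he z
  rw [seg_apply_of_ne hzx hzy] at this
  simp [hz] at this

/-- Removing a single point from a simplicial circle does not separate a vertex. -/
lemma IsSimplicialSphere.exists_apply_eq_half {Δ : FinSimplicialComplex V}
    (h : Δ.IsSimplicialSphere 1) {v : V} (hv : {v} ∈ Δ.faces) {p q : V → ℝ} (hp : p v ≠ 1)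
    (hq : q ∈ Δ.realization) (hqp : q ≠ p) (hqv : q v ≤ 1 / 2) :
    ∃ w ∈ Δ.realization, w ≠ p ∧ w v = 1 / 2 := by
  obtain ⟨e⟩ := h
  -- The coordinate `w v` on the connected punctured circle passes from `q v ≤ 1 / 2` to `1` at the
  -- vertex `v`, hence takes the value `1 / 2`.
  have hc := (isPreconnected_diff_of_homeomorph_circle e p).image (fun w => w v)
    (continuous_apply v).continuousOn
  have hv1 : seg v v 0 v = 1 := by simp [seg]
  have h1 : (1 : ℝ) ∈ (fun w : V → ℝ => w v) '' (Δ.realization \ {p}) :=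
    ⟨seg v v 0, ⟨seg_mem_of_vert hv v, fun he => hp (by rw [← he, hv1])⟩, hv1⟩
  obtain ⟨w, hw, hwv⟩ := hc.Icc_subset ⟨q, ⟨hq, hqp⟩, rfl⟩ h1 (⟨hqv, by norm_num⟩ :
    (1 / 2 : ℝ) ∈ Set.Icc (q v) 1)
  exact ⟨w, hw.1, hw.2, hwv⟩

/-- A point of the realization near a vertex `v` lies on an edge if `v` has at most one
neighbour. -/
lemma exists_adj_of_apply_eq_half {Δ : FinSimplicialComplex V} {v : V} {w : V → ℝ}
    (hw : w ∈ Δ.realization) (hwv : w v = 1 / 2) :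
    ∃ a, Δ.Adj v a ∧ ((∀ b, Δ.Adj v b → b = a) → w = seg v a (1 / 2)) := by
  obtain ⟨hw0, s, hs, hws, hsum⟩ := hw
  have hvs : v ∈ s := by
    by_contra hvs
    rw [hws v hvs] at hwv
    norm_num at hwv
  have hadj : ∀ a ∈ s, a ≠ v → Δ.Adj v a := fun a ha hav => ⟨hav.symm, Δ.down_closed s hs _
    (Finset.insert_subset hvs (Finset.singleton_subset_iff.mpr ha))⟩
  have hex : ∃ a ∈ s, a ≠ v := by
    by_contra! hcon
    rw [Finset.sum_eq_single_of_mem v hvs fun b hb hbv => absurd (hcon b hb) hbv, hwv] at hsum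
    norm_num at hsum
  obtain ⟨a, has, hav⟩ := hex
  refine ⟨a, hadj a has hav, fun huniq => ?_⟩
  have hs2 : s = {v, a} := by
    refine subset_antisymm (fun b hb => ?_)
      (Finset.insert_subset hvs (Finset.singleton_subset_iff.mpr has))
    by_cases hbv : b = v
    · simp [hbv]
    · simp [huniq b (hadj b hb hbv)]
  rw [hs2, Finset.sum_pair hav.symm, hwv] at hsum
  ext b
  by_cases hbv : b = v
  · rw [hbv, seg_apply_left hav.symm, hwv]
    norm_num
  by_cases hba : b = a
  · rw [hba, seg_apply_right hav.symm]
    linarith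
  · rw [seg_apply_of_ne hbv hba, hws b (by simp [hs2, hbv, hba])]

lemma IsSimplicialSphere.exists_vert_ne {Δ : FinSimplicialComplex V}
    (h : Δ.IsSimplicialSphere 1) (v : V) : ∃ a, a ≠ v ∧ {a} ∈ Δ.faces := by
  by_contra! hcon
  have key : ∀ p ∈ Δ.realization, p = seg v v 0 := by
    rintro p ⟨-, s, hs, hps, hsum⟩
    have hsv : s ⊆ {v} := fun x hx => Finset.mem_singleton.mpr <| by
      by_contra hxv
      exact hcon x hxv (Δ.down_closed s hs _ (Finset.singleton_subset_iff.mpr hx))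
    rcases Finset.subset_singleton_iff.mp hsv with rfl | rfl
    · simp at hsum
    · ext w
      by_cases hw : w = v
      · subst hw
        simpa [seg] using hsum
      · rw [hps w (by simpa using hw), seg_apply_of_ne hw hw]
  obtain ⟨p, hp, q, hq, hne⟩ := h.nontrivial
  exact hne ((key p hp).trans (key q hq).symm)

lemma IsSimplicialSphere.exists_adj {Δ : FinSimplicialComplex V} (h : Δ.IsSimplicialSphere 1)
    {v : V} (hv : {v} ∈ Δ.faces) : ∃ a, Δ.Adj v a := by
  obtain ⟨a, hav, ha⟩ := h.exists_vert_ne v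
  -- The point `p = 0` is not in the realization, so nothing is removed here.
  obtain ⟨w, hw, -, hwv⟩ := h.exists_apply_eq_half hv (p := 0) (q := seg a a 0) (by simp)
    (seg_mem_of_vert ha a) (fun he => by simpa [seg] using congrFun he a)
    (by rw [seg_apply_of_ne hav.symm hav.symm]; norm_num)
  obtain ⟨b, hb, -⟩ := exists_adj_of_apply_eq_half hw hwv
  exact ⟨b, hb⟩

/-- Removing the midpoint of the only edge at `v` would cut `v` off from `a`. -/
lemma IsSimplicialSphere.exists_adj_ne {Δ : FinSimplicialComplex V} (h : Δ.IsSimplicialSphere 1)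
    {v a : V} (ha : Δ.Adj v a) : ∃ b, b ≠ a ∧ Δ.Adj v b := by
  by_contra! hcon
  have huniq : ∀ b, Δ.Adj v b → b = a := fun b hb => by
    by_contra hba
    exact hcon b hba hb
  obtain ⟨w, hw, hne, hwv⟩ := h.exists_apply_eq_half ha.left_mem (p := seg v a (1 / 2))
    (q := seg a a 0) (by rw [seg_apply_left ha.1]; norm_num) (seg_mem_of_vert ha.symm.left_mem a)
    (fun he => by
      have := congrFun he v
      rw [seg_apply_of_ne ha.1 ha.1, seg_apply_left ha.1] at this
      norm_num at this)
    (by rw [seg_apply_of_ne ha.1 ha.1]; norm_num)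
  obtain ⟨b, hb, hb'⟩ := exists_adj_of_apply_eq_half hw hwv
  obtain rfl := huniq b hb
  exact hne (hb' huniq)

/-- In a chart onto the line, half-edges to three distinct neighbours would leave `v` in pairwise
opposite directions. -/
lemma IsSimplicialSphere.adj_le_two {Δ : FinSimplicialComplex V} (h : Δ.IsSimplicialSphere 1)
    {v a b c : V} (ha : Δ.Adj v a) (hb : Δ.Adj v b) (hc : Δ.Adj v c) :
    a = b ∨ a = c ∨ b = c := by
  by_contra! hcon
  obtain ⟨e⟩ := h
  -- The chart is punctured at the vertex `a`, which half-edges starting at `v` avoid.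
  obtain ⟨F, hF, hbij⟩ := exists_bijOn_of_homeomorph_circle e (seg_mem_of_vert ha.symm.left_mem a)
  have hne : ∀ {x y}, Δ.Adj v x → Δ.Adj v y → x ≠ y → ∀ t : ℝ,
      seg v x (1 / 2 * 1) ≠ seg v y (1 / 2 * t) := fun {x y} hx hy hxy t he => by
    have := congrFun he x
    rw [seg_apply_right hx.1, seg_apply_of_ne hx.1.symm hxy] at this
    norm_num at this
  have hmem : ∀ {x}, Δ.Adj v x → ∀ t ∈ Set.Icc (0 : ℝ) 1,
      seg v x (1 / 2 * t) ∈ Δ.realization \ {seg a a 0} := fun {x} hx t ht => by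
    refine ⟨hx.seg_mem ⟨by linarith [ht.1], by linarith [ht.2]⟩, fun he => ?_⟩
    have := congrFun he v
    rw [seg_apply_left hx.1, seg_apply_of_ne ha.1 ha.1] at this
    linarith [ht.2]
  have key : ∀ {x y}, Δ.Adj v x → Δ.Adj v y → x ≠ y →
      (F (seg v x (1 / 2 * 1)) - F (seg v v 0)) * (F (seg v y (1 / 2 * 1)) - F (seg v v 0)) < 0 := by
    intro x y hx hy hxy
    have := sub_mul_sub_neg_of_injOn hF hbij.injOn (g := fun t => seg v x (1 / 2 * t))
      (h := fun t => seg v y (1 / 2 * t)) ((continuous_seg v x).comp (by fun_prop))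
      ((continuous_seg v y).comp (by fun_prop)) (hmem hx) (hmem hy)
      (by simp only [mul_zero]; exact seg_zero v x y) (fun t _ => hne hx hy hxy t)
      (fun t _ => hne hy hx hxy.symm t)
    simp only [mul_zero, seg_zero v x v] at this
    exact this
  have h1 := key ha hb hcon.1
  have h2 := key ha hc hcon.2.1
  have h3 := key hb hc hcon.2.2
  rw [mul_neg_iff] at h1 h2 h3
  rcases h1 with h1 | h1 <;> rcases h2 with h2 | h2 <;> rcases h3 with h3 | h3 <;> linarith

/-- Minimality follows from `exists_eq_seg`: a subgraph without vertices of degree one covers the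
midpoint of every edge, and so contains the edge. -/
lemma IsSimplicialSphere.isCycle {Δ : FinSimplicialComplex V} (h : Δ.IsSimplicialSphere 1) :
    Δ.IsCycle := by
  refine ⟨fun s hs => h.card_le_two hs, ?_, fun v hv => h.exists_adj hv, fun x y hxy => hxy.symm,
    fun x hx => hx.1 rfl, fun x y hxy => h.exists_adj_ne hxy,
    fun x a b c ha hb hc => h.adj_le_two ha hb hc, fun A hA hs hne h2 x y hxy => ?_⟩
  · obtain ⟨p, ⟨-, s, hs, -, hsum⟩, -⟩ := h.nontrivial
    obtain ⟨v, hv⟩ := Finset.nonempty_of_sum_ne_zero (hsum.trans_ne one_ne_zero)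
    exact ⟨v, Δ.down_closed s hs _ (Finset.singleton_subset_iff.mpr hv)⟩
  · obtain ⟨x', y', hxy', t, ht, he⟩ := exists_eq_seg h hA hs hne h2
      (hxy.seg_mem (t := 1 / 2) ⟨by norm_num, by norm_num⟩)
    have hmem : ∀ z, seg x y (1 / 2) z ≠ 0 → z = x' ∨ z = y' := fun z hz => by
      by_contra! hcon
      exact hz (by rw [he, seg_apply_of_ne hcon.1 hcon.2])
    have hx := hmem x (by rw [seg_apply_left hxy.1]; norm_num)
    have hy := hmem y (by rw [seg_apply_right hxy.1]; norm_num)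
    rcases hx with rfl | rfl <;> rcases hy with rfl | rfl
    · exact absurd rfl hxy.1
    · exact hxy'
    · exact hs _ _ hxy'
    · exact absurd rfl hxy.1

end

end FinSimplicialComplex
end

theorem mainTheorem6 {F : Type*} [Field F] {V : Type*} [LinearOrder V] :
    (∀ (d : ℕ) (Δ Δ' : FinSimplicialComplex V),
      Δ.IsHomologySphere F d → FinSimplicialComplex.IsBistellarMove 0 Δ Δ' →
        (Δ.GenericallyAnisotropic F ↔ Δ'.GenericallyAnisotropic F)) ∧
    (∀ (d : ℕ) (Δ : FinSimplicialComplex V),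
      FinSimplicialComplex.IsStackedSphere d Δ → Δ.GenericallyAnisotropic F) ∧
    (∀ Δ : FinSimplicialComplex V,
      Δ.IsSimplicialSphere 1 → Δ.GenericallyAnisotropic F) :=
  ⟨fun _ _ _ h hm => FinSimplicialComplex.genericallyAnisotropic_iff_of_isBistellarMove F h hm,
    fun _ _ h => h.genericallyAnisotropic F,
    fun _ h => h.isCycle.isStackedSphere.genericallyAnisotropic F⟩
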